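/- **Theorem 1.** Fix $n$ vertices, each holding one of the opinions $1,\dots,k$, where $1\le k\le n$. The dynamics are synchronous on the complete graph with self-loops, and all random choices are independent and uniform over the $n$ vertices. In each round of *3-Majority* every vertex samples three vertices $w_1,w_2,w_3$; it adopts the opinion of $w_1$ if $w_1$ and $w_2$ hold the same opinion, and that of $w_3$ otherwise. In each round of *2-Choices* every vertex samples two vertices; it adopts their opinion if they agree, and keeps its own otherwise. The consensus time $\tau$ is the first time $t\ge 0$ at which all vertices hold the same opinion ($\tau=\infty$ if there is none). 1. (3-Majority, consensus time) There are constants $C,a,c>0$ such that for all $2\le k\le n$: from every initial configuration, $\Pr[\tau\le C(\log n)^a\min\{\sqrt n,k\}]\ge 1-Cn^{-c}$; and there is an initial configuration from which $\Pr[\tau\ge \min\{\sqrt n,k\}/(C(\log n)^a)]\ge 1-Cn^{-c}$. 2. (3-Majority, plurality) There is a constant $c>0$ such that for all functions $\varepsilon(n)\to 0$ and $g(n)\to\infty$ there is $C>0$ for which the following holds for all $n\ge 2$ and $1\le k\le n$. If $k\le \varepsilon(n)\sqrt n/\log n$ and in the initial configuration some opinion $i$ is held by at least $g(n)\sqrt{n\log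 n}$ more vertices than every other opinion, then with probability at least $1-Cn^{-c}$ consensus on opinion $i$ is reached. (That is, $k=o(\sqrt n/\log n)$ and a lead of $\omega(\sqrt{n\log n})$ suffice with high probability.) 3. (2-Choices, consensus time) There are constants $C,a,c>0$ such that for all $2\le k\le n$: from every initial configuration, $\Pr[\tau\le C(\log n)^a k]\ge 1-Cn^{-c}$; and there is an initial configuration from which $\Pr[\tau\ge k/(C(\log n)^a)]\ge 1-Cn^{-c}$. 4. (2-Choices, plurality) There is a constant $c>0$ such that for all functions $\varepsilon(n)\to 0$ and $g(n)\to\infty$ there is $C>0$ for which the following holds for all $n\ge 2$ and $1\le k\le n$. If $k\le \varepsilon(n)\,n/(\log n)^2$ and in the initial configuration some opinion $i$, held by a fraction $\alpha_i$ of the vertices, is held by at least $g(n)\sqrt{\alpha_i\, n\log n}$ more vertices than every other opinion, then with probability at least $1-Cn^{-c}$ consensus on opinion $i$ is reached. (That is, $k=o(n/(\log n)^2)$ and a lead of $\omega(\sqrt{\alpha_i n\log n})$ suffice with high probability.) -/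

import Mathlib

open MeasureTheory Filter Topology
open scoped ENNReal

namespace ConsensusDynamics

/-- A configuration: every one of the `n` vertices holds one of the `k` opinions. -/
abbrev Config (n k : ℕ) : Type := Fin n → Fin k

/-- All the random choices of a run in which every vertex samples `h` vertices in every round:
`ω (t, v, s)` is the `s`-th vertex that the vertex `v` samples in the round that leads from
time `t` to time `t + 1`. -/
abbrev Samples (n h : ℕ) : Type := ℕ × Fin n × Fin h → Fin n

/-- The law of the random choices: all samples are independent and uniform on the vertex set
(uniform neighbours in the complete graph with self-loops, drawn with replacement). -/
noncomputable def sampleLaw (n h : ℕ) [NeZero n] : Measure (Samples n h) :=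
  Measure.infinitePi fun _ => (PMF.uniformOfFintype (Fin n)).toMeasure

/-- One round of 3-Majority, given the three vertices sampled by every vertex: a vertex adopts
the opinion of its first two samples if they agree and that of its third sample otherwise. -/
def threeMajorityStep {n k : ℕ} (x : Config n k) (w : Fin n → Fin 3 → Fin n) : Config n k :=
  fun v => if x (w v 0) = x (w v 1) then x (w v 0) else x (w v 2)

/-- One round of 2-Choices, given the two vertices sampled by every vertex: a vertex adopts
the opinion of its two samples if they agree and keeps its own opinion otherwise. -/
def twoChoicesStep {n k : ℕ} (x : Config n k) (w : Fin n → Fin 2 → Fin n) : Config n k :=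
  fun v => if x (w v 0) = x (w v 1) then x (w v 0) else x v

/-- The synchronous process with one-round rule `step`, started in `x₀` and driven by `ω`. -/
def process {n k h : ℕ} (step : Config n k → (Fin n → Fin h → Fin n) → Config n k)
    (x₀ : Config n k) (ω : Samples n h) : ℕ → Config n k
  | 0 => x₀
  | t + 1 => step (process step x₀ ω t) fun v s => ω (t, v, s)

/-- The process 3-Majority. -/
def threeMajority {n k : ℕ} (x₀ : Config n k) (ω : Samples n 3) : ℕ → Config n k :=
  process threeMajorityStep x₀ ω

/-- The process 2-Choices. -/
def twoChoices {n k : ℕ} (x₀ : Config n k) (ω : Samples n 2) : ℕ → Config n k :=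
  process twoChoicesStep x₀ ω

/-- All vertices hold the opinion `i`. -/
def ConsensusOn {n k : ℕ} (x : Config n k) (i : Fin k) : Prop := ∀ v, x v = i

/-- The consensus time of a trajectory: the first time at which all vertices hold the same
opinion, and `∞` if there is no such time. -/
noncomputable def consensusTime {n k : ℕ} (X : ℕ → Config n k) : ℝ≥0∞ :=
  ⨅ (t : ℕ) (_ : ∃ i, ConsensusOn (X t) i), (t : ℝ≥0∞)

/-- The number of vertices that hold the opinion `i`. -/
def support {n k : ℕ} (x : Config n k) (i : Fin k) : ℕ :=
  (Finset.univ.filter fun v => x v = i).card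

/-- The fraction of vertices that hold the opinion `i`. -/
noncomputable def fraction {n k : ℕ} (x : Config n k) (i : Fin k) : ℝ :=
  (support x i : ℝ) / n

end ConsensusDynamics

open ConsensusDynamics

set_option linter.unusedSectionVars false

/-! Write α_j for the fraction of opinion j, γ = Σ α_j² for the collision probability and ℓ = log n.
In both dynamics the expected new fraction of j is α_j(1 + α_j - γ): opinions above γ grow, those
below shrink. The dynamics differ in their noise: in one round α_j has variance of order α_j S/n,
where S = 1 for 3-Majority, while S(z) = 2z for 2-Choices when all fractions are at most z, since
there a vertex moves only if its two samples agree. They also differ in the amount d by which the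
noise raises γ in expectation while γ is small: 1/(2n) against 1/n². `IsPluralityDynamics` records
these facts, and both processes are analysed through it.

Upper bound on the consensus time. Let γ = z with n z² much larger than ℓ³ S(z), and suppose γ
stayed near z for a large multiple of ℓ/z rounds. If two opinions are both of size about z, their
difference is amplified by 1 + Θ(z) per round, and the noise drives it away from 0; so one of them
soon falls below 3z/4 or exceeds 2z. In the first case it dies out; in the second it would grow
exponentially past 1, which is impossible. Hence no two opinions survive together: either there is
consensus or γ has left its window, and as a submartingale it leaves upwards (`surv_epoch_le`).
Repeating this, γ grows by factors 11/10, the waiting times form a geometric series, and consensus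
takes O(ℓ/γ) rounds (`surv_not_consensus_le`). Always γ ≥ 1/k, which settles few opinions. For many,
the drift d lifts γ to the required level g in O(g/d) rounds (`surv_collision_lt_le`), where g is
n^(-1/2) for 3-Majority and 1/n for 2-Choices up to logarithms, so that g/d is about √n and n
respectively; in this case k is at least about 1/g.

Lower bound. Start from m nearly equal opinions, with m = k for 2-Choices and m about min(√n, k) for
3-Majority. While every fraction is at most 8ℓ/m, each drifts upwards by only O(ℓ²/m²) per round,
and the noise is harmless for about m/ℓ² rounds (`le_surv_not_consensus`).

Plurality. Divide all fractions by the accumulated expected growth of the leader. The leader becomes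
a martingale, and the noise of all opinions stays at its initial scale. While a rival is comparable
to the leader, the normalized lead grows by 1 + Θ(z) per round, so an initial lead δ with nδ² at
least a large multiple of ℓ S(z) is never lost; a rival that is clearly behind decays geometrically
and dies (`surv_not_consensusOn_le`).

Tail bounds come from comparing survival and exit probabilities with explicit supersolutions, mostly
exponentials, of the backward equation. -/

namespace ConsensusDynamics

open Finset
open scoped BigOperators

/-! ### Survival and exit probabilities of Markov chains. -/

section MarkovChain

variable {S W : Type*} [Fintype W] [Nonempty W]

open Classical in
/-- The expectation of `f` at time `t` on the event that the chain which moves from `x` to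
`step x w` with a uniform `w` stays in `D` up to time `t`. -/
noncomputable def surv (step : S → W → S) (D : S → Prop) (f : S → ℝ) : ℕ → S → ℝ
  | 0, x => if D x then f x else 0
  | t + 1, x => if D x then 𝔼 w, surv step D f t (step x w) else 0

open Classical in
/-- The probability that the chain leaves `D` within `t` rounds and that the first state
outside `D` lies in `B`. -/
noncomputable def exitProb (step : S → W → S) (D B : S → Prop) : ℕ → S → ℝ
  | 0, x => if D x then 0 else if B x then 1 else 0
  | t + 1, x => if D x then 𝔼 w, exitProb step D B t (step x w) else if B x then 1 else 0

variable {step : S → W → S} {D B E U R : S → Prop} {f : S → ℝ}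

lemma surv_nonneg (hf : ∀ x, 0 ≤ f x) : ∀ t x, 0 ≤ surv step D f t x
  | 0, x => by
    unfold surv; split_ifs
    exacts [hf x, le_rfl]
  | t + 1, x => by
    unfold surv; split_ifs
    exacts [expect_nonneg fun w _ => surv_nonneg hf t _, le_rfl]

lemma surv_of_not {x : S} (h : ¬ D x) (t : ℕ) : surv step D f t x = 0 := by
  cases t <;> simp [surv, h]

lemma surv_le_of_le {M : ℝ} (hM : 0 ≤ M) (hf : ∀ x, f x ≤ M) :
    ∀ t x, surv step D f t x ≤ M
  | 0, x => by
    unfold surv; split_ifs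
    exacts [hf x, hM]
  | t + 1, x => by
    unfold surv; split_ifs
    exacts [expect_le univ_nonempty fun w _ => surv_le_of_le hM hf t _, hM]

lemma surv_mono {g : S → ℝ} (hDE : ∀ x, D x → E x) (hg : ∀ x, 0 ≤ g x)
    (hfg : ∀ x, D x → f x ≤ g x) : ∀ t x, surv step D f t x ≤ surv step E g t x
  | 0, x => by
    unfold surv
    by_cases h : D x
    · simp [h, hDE x h, hfg x h]
    · simp only [h, if_false]; split_ifs
      exacts [hg x, le_rfl]
  | t + 1, x => by
    by_cases h : D x
    · simp only [surv, h, hDE x h, if_true]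
      exact expect_le_expect fun w _ => surv_mono hDE hg hfg t _
    · rw [surv_of_not h]; exact surv_nonneg hg _ _

lemma surv_sum {ι : Type*} (s : Finset ι) (f : ι → S → ℝ) :
    ∀ t x, surv step D (fun y => ∑ i ∈ s, f i y) t x = ∑ i ∈ s, surv step D (f i) t x
  | 0, x => by
    unfold surv; split_ifs <;> simp
  | t + 1, x => by
    unfold surv; split_ifs
    · simp_rw [surv_sum s f t]; rw [expect_sum_comm]
    · simp

/-- Comparison principle for the backward equation. The index of `F` counts the rounds that remain,
so a test function whose parameter depends on time is tuned backwards from the final round. -/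
lemma surv_le_of_supersolution {T : ℕ} {F : ℕ → S → ℝ} (hF : ∀ t x, 0 ≤ F t x)
    (hf : ∀ x, D x → f x ≤ F 0 x)
    (hs : ∀ t < T, ∀ x, D x → 𝔼 w, F t (step x w) ≤ F (t + 1) x) :
    ∀ t ≤ T, ∀ x, surv step D f t x ≤ F t x
  | 0, _, x => by
    unfold surv; split_ifs with h
    exacts [hf x h, hF 0 x]
  | t + 1, ht, x => by
    unfold surv; split_ifs with h
    · exact (expect_le_expect fun w _ =>
        surv_le_of_supersolution hF hf hs t (by omega) _).trans (hs t (by omega) x h)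
    · exact hF _ x

lemma exitProb_nonneg : ∀ t x, 0 ≤ exitProb step D B t x
  | 0, x => by
    unfold exitProb; split_ifs <;> norm_num
  | t + 1, x => by
    unfold exitProb; split_ifs
    exacts [expect_nonneg fun w _ => exitProb_nonneg t _, zero_le_one, le_rfl]

lemma exitProb_le_of_supersolution {T : ℕ} {F : ℕ → S → ℝ} (hF : ∀ t x, 0 ≤ F t x)
    (hB : ∀ t ≤ T, ∀ x, ¬ D x → B x → 1 ≤ F t x)
    (hs : ∀ t < T, ∀ x, D x → 𝔼 w, F t (step x w) ≤ F (t + 1) x) :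
    ∀ t ≤ T, ∀ x, exitProb step D B t x ≤ F t x
  | 0, _, x => by
    unfold exitProb; split_ifs with h h'
    exacts [hF 0 x, hB 0 (by omega) x h h', hF 0 x]
  | t + 1, ht, x => by
    unfold exitProb; split_ifs with h h'
    · exact (expect_le_expect fun w _ =>
        exitProb_le_of_supersolution hF hB hs t (by omega) _).trans (hs t (by omega) x h)
    · exact hB _ ht x h h'
    · exact hF _ x

lemma exitProb_mono {B' : S → Prop} (h : ∀ x, ¬ D x → B x → B' x) :
    ∀ t x, exitProb step D B t x ≤ exitProb step D B' t x
  | 0, x => by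
    unfold exitProb; split_ifs with h1 h2 h3 <;> simp_all
  | t + 1, x => by
    unfold exitProb; split_ifs with h1 h2 h3
    · exact expect_le_expect fun w _ => exitProb_mono h t _
    all_goals simp_all

lemma exitProb_or {B' : S → Prop} : ∀ t x, exitProb step D (fun y => B y ∨ B' y) t x ≤
    exitProb step D B t x + exitProb step D B' t x
  | 0, x => by
    unfold exitProb; split_ifs with h1 h2 h3 <;> simp_all
  | t + 1, x => by
    unfold exitProb; split_ifs with h1 h2 h3
    · rw [← expect_add_distrib]
      exact expect_le_expect fun w _ => exitProb_or t _
    all_goals simp_all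

lemma exitProb_exists {ι : Type*} [Fintype ι] {B : ι → S → Prop} :
    ∀ t x, exitProb step D (fun y => ∃ i, B i y) t x ≤ ∑ i, exitProb step D (B i) t x
  | 0, x => by
    by_cases h1 : D x
    · simp [exitProb, h1]
    · by_cases h2 : ∃ i, B i x
      · obtain ⟨i, hi⟩ := h2
        refine le_trans ?_ (single_le_sum (fun j _ => exitProb_nonneg 0 x) (mem_univ i))
        simp only [exitProb, h1, hi, if_true, if_false]
        split_ifs <;> norm_num
      · refine le_trans ?_ (sum_nonneg fun j _ => exitProb_nonneg 0 x)
        simp [exitProb, h1, h2]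
  | t + 1, x => by
    by_cases h1 : D x
    · simp only [exitProb, h1, if_true]
      rw [← expect_sum_comm]
      exact expect_le_expect fun w _ => exitProb_exists t _
    · by_cases h2 : ∃ i, B i x
      · obtain ⟨i, hi⟩ := h2
        refine le_trans ?_ (single_le_sum (fun j _ => exitProb_nonneg (t + 1) x) (mem_univ i))
        simp only [exitProb, h1, hi, if_true, if_false]
        split_ifs <;> norm_num
      · refine le_trans ?_ (sum_nonneg fun j _ => exitProb_nonneg (t + 1) x)
        simp [exitProb, h1, h2]

/-- Strong Markov property at the first visit to `R`: either `R` is avoided for `T₁` rounds, or at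
the visit between `T₂` and `T₁ + T₂` rounds remain. Hence the hypothesis is needed for this whole
range of `m`. -/
lemma surv_first_hit {T₁ T₂ : ℕ} {ε : ℝ} (hε : 0 ≤ ε) (hf1 : ∀ x, f x ≤ 1)
    (h : ∀ x, D x → R x → ∀ m, T₂ ≤ m → m ≤ T₁ + T₂ → surv step D f m x ≤ ε) (x : S) :
    surv step D f (T₁ + T₂) x ≤ surv step (fun y => D y ∧ ¬ R y) (fun _ => 1) T₁ x + ε := by
  have key : ∀ t ≤ T₁, ∀ x, surv step D f (t + T₂) x ≤
      surv step (fun y => D y ∧ ¬ R y) (fun _ => 1) t x + ε := by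
    intro t
    induction t with
    | zero =>
      intro _ x
      by_cases hD : D x
      · by_cases hR : R x
        · have := h x hD hR T₂ le_rfl (by omega)
          simpa [surv, hD, hR] using this
        · have := surv_le_of_le (step := step) (D := D) zero_le_one hf1 T₂ x
          simp only [zero_add, surv, hD, hR, not_false_eq_true, and_self, if_true]
          linarith
      · rw [surv_of_not hD]
        exact add_nonneg (surv_nonneg (fun _ => zero_le_one) _ _) hε
    | succ t ih =>
      intro ht x
      by_cases hD : D x
      · by_cases hR : R x
        · have := h x hD hR (t + 1 + T₂) (by omega) (by omega)
          have h2 := surv_nonneg (step := step) (D := fun y => D y ∧ ¬ R y)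
            (fun _ => (zero_le_one : (0 : ℝ) ≤ 1)) (t + 1) x
          linarith
        · rw [show t + 1 + T₂ = (t + T₂) + 1 by omega]
          simp only [surv, hD, hR, not_false_eq_true, and_self, if_true]
          rw [← Fintype.expect_const (ι := W) ε, ← expect_add_distrib]
          exact expect_le_expect fun w _ => ih (by omega) _
      · rw [surv_of_not hD]
        exact add_nonneg (surv_nonneg (fun _ => zero_le_one) _ _) hε
  exact key T₁ le_rfl x

lemma exitProb_first_hit {T : ℕ} {ε : ℝ} (hε : 0 ≤ ε)
    (h : ∀ x, D x → R x → ∀ m ≤ T, exitProb step D B m x ≤ ε) :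
    ∀ t ≤ T, ∀ x, exitProb step D B t x ≤
      exitProb step (fun y => D y ∧ ¬ R y) (fun y => B y ∧ ¬ D y) t x + ε := by
  intro t
  induction t with
  | zero =>
    intro _ x
    by_cases hD : D x
    · simp only [exitProb, hD, if_true]
      split_ifs <;> linarith
    · by_cases hB : B x
      · simp [exitProb, hD, hB, hε]
      · simp [exitProb, hD, hB, hε]
  | succ t ih =>
    intro ht x
    by_cases hD : D x
    · by_cases hR : R x
      · have := h x hD hR (t + 1) ht
        have h2 := exitProb_nonneg (step := step) (D := fun y => D y ∧ ¬ R y)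
          (B := fun y => B y ∧ ¬ D y) (t + 1) x
        linarith
      · simp only [exitProb, hD, hR, not_false_eq_true, and_self, if_true]
        rw [← Fintype.expect_const (ι := W) ε, ← expect_add_distrib]
        exact expect_le_expect fun w _ => ih (by omega) _
    · by_cases hB : B x
      · simp [exitProb, hD, hB, hε]
      · simp [exitProb, hD, hB, hε]

/-- An auxiliary constraint `E` may be imposed at the price of the probability that it is the first
thing to fail. This allows drift estimates that hold only inside `E`. -/
lemma surv_le_restrict (E : S → Prop) (hf : ∀ x, f x ≤ 1) :
    ∀ t x, surv step D f t x ≤ surv step (fun y => D y ∧ E y) f t x +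
      exitProb step (fun y => D y ∧ E y) (fun y => ¬ E y) t x
  | 0, x => by
    by_cases hD : D x <;> by_cases hE : E x <;> simp [surv, exitProb, hD, hE, hf x]
  | t + 1, x => by
    by_cases hD : D x <;> by_cases hE : E x
    · simp only [surv, exitProb, hD, hE, and_self, if_true]
      rw [← expect_add_distrib]
      exact expect_le_expect fun w _ => surv_le_restrict E hf t _
    · have := surv_le_of_le (step := step) (D := D) zero_le_one hf (t + 1) x
      rw [surv_of_not (D := fun y => D y ∧ E y) (by tauto)]
      simpa [exitProb, hD, hE] using this
    · rw [surv_of_not hD, surv_of_not (D := fun y => D y ∧ E y) (by tauto)]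
      simp [exitProb, hD, hE]
    · rw [surv_of_not hD, surv_of_not (D := fun y => D y ∧ E y) (by tauto)]
      simp [exitProb, hD, hE]

lemma exitProb_le_restrict (E : S → Prop) :
    ∀ t x, exitProb step D B t x ≤
      exitProb step (fun y => D y ∧ E y) (fun y => ¬ E y ∨ (¬ D y ∧ B y)) t x
  | 0, x => by
    by_cases hD : D x <;> by_cases hE : E x <;> by_cases hB : B x <;> simp [exitProb, hD, hE, hB]
  | t + 1, x => by
    by_cases hD : D x <;> by_cases hE : E x
    · simp only [exitProb, hD, hE, and_self, if_true]
      exact expect_le_expect fun w _ => exitProb_le_restrict E t _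
    · simp only [exitProb, hD, hE, if_true, and_false, if_false, not_false_eq_true, true_or]
      refine expect_le univ_nonempty fun w _ => ?_
      refine exitProb_le_of_supersolution (F := fun _ _ => 1) (T := t) (by simp) (by simp)
        (by simp) t le_rfl _
    all_goals
      by_cases hB : B x <;> simp [exitProb, hD, hE, hB]

-- A run that avoids the target `U` either stays in the window `D` to the end or leaves it for the
-- first time through `B`; leaving it into `U` would have stopped the run.
open Classical in
lemma surv_not_le (hDB : ∀ x, ¬ D x → ¬ U x → B x) :
    ∀ t x, surv step (fun y => ¬ U y) (fun _ => 1) t x ≤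
      surv step D (fun y => if U y then 0 else 1) t x + exitProb step D B t x
  | 0, x => by
    have := hDB x
    by_cases hU : U x <;> by_cases hD : D x <;> simp_all [surv, exitProb]
    split_ifs <;> norm_num
  | t + 1, x => by
    have h1 : ∀ y, (0 : ℝ) ≤ if U y then 0 else 1 := fun y => by split_ifs <;> norm_num
    by_cases hU : U x
    · rw [surv_of_not (by simpa using hU)]
      exact add_nonneg (surv_nonneg h1 _ _) (exitProb_nonneg _ _)
    · by_cases hD : D x
      · simp only [surv, exitProb, hD, hU, not_false_eq_true, if_true]
        rw [← expect_add_distrib]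
        exact expect_le_expect fun w _ => surv_not_le hDB t _
      · have := hDB x hD hU
        have h2 := surv_le_of_le (step := step) (D := fun y => ¬ U y) (f := fun _ => 1)
          zero_le_one (fun _ => le_rfl) (t + 1) x
        rw [surv_of_not hD]
        simpa [exitProb, hD, this] using h2

/-- Markov property at multiples of `T`; the bound `q` is uniform in the starting state. -/
lemma surv_mul_le_pow {q : ℝ} {T : ℕ} (hq : 0 ≤ q)
    (h : ∀ x, surv step D (fun _ => 1) T x ≤ q) (m : ℕ) :
    ∀ x, surv step D (fun _ => 1) (m * T) x ≤ q ^ m := by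
  induction m with
  | zero => intro x; simpa using surv_le_of_le zero_le_one (fun _ => le_rfl) _ x
  | succ m ih =>
    intro x
    have key : ∀ t x, surv step D (fun _ => 1) (t + m * T) x ≤
        q ^ m * surv step D (fun _ => 1) t x := by
      intro t
      induction t with
      | zero =>
        intro x
        by_cases hD : D x
        · simpa [surv, hD] using ih x
        · simp [surv_of_not hD]
      | succ t iht =>
        intro x
        rw [show t + 1 + m * T = (t + m * T) + 1 by omega]
        by_cases hD : D x
        · simp only [surv, hD, if_true]
          rw [mul_expect]
          exact expect_le_expect fun w _ => iht _
        · simp [surv_of_not hD]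
    have := key T x
    rw [show (m + 1) * T = T + m * T by ring, pow_succ]
    exact this.trans (mul_le_mul_of_nonneg_left (h x) (pow_nonneg hq m))

lemma surv_succ_le : ∀ t x, surv step D (fun _ => 1) (t + 1) x ≤ surv step D (fun _ => 1) t x
  | 0, x => by
    by_cases hD : D x
    · have := surv_le_of_le (step := step) (D := D) (f := fun _ => 1)
        zero_le_one (fun _ => le_rfl) 1 x
      simpa [surv, hD] using this
    · simp [surv_of_not hD]
  | t + 1, x => by
    by_cases hD : D x
    · rw [surv, surv]
      simp only [hD, if_true]
      exact expect_le_expect fun w _ => surv_succ_le t _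
    · simp [surv_of_not hD]

lemma surv_antitone (x : S) : Antitone fun t => surv step D (fun _ => 1) t x :=
  antitone_nat_of_succ_le fun t => surv_succ_le t x

/-- Optional stopping: each round spent in `D` raises the bounded potential by `d` in expectation,
so the expected number of such rounds, times `d`, is at most `M`. Since survival decreases in time,
`t` times its value at `t` is at most its sum. -/
lemma surv_mul_le_of_drift {φ : S → ℝ} {d M : ℝ} (hM : ∀ x, φ x ≤ M) (hφ : ∀ x, 0 ≤ φ x)
    (hd : 0 ≤ d) (h : ∀ x, D x → φ x + d ≤ 𝔼 w, φ (step x w)) (t : ℕ) (x : S) :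
    t * d * surv step D (fun _ => 1) t x ≤ M := by
  have key : ∀ t x, d * ∑ s ∈ range t, surv step D (fun _ => 1) s x ≤ M - φ x := by
    intro t
    induction t with
    | zero => intro x; simpa using hM x
    | succ t ih =>
      intro x
      by_cases hD : D x
      · rw [sum_range_succ']
        simp only [surv, hD, if_true]
        rw [← expect_sum_comm]
        have h1 : 𝔼 w, d * ∑ s ∈ range t, surv step D (fun _ => 1) s (step x w) ≤
            𝔼 w, (M - φ (step x w)) := expect_le_expect fun w _ => ih _
        rw [expect_sub_distrib, Fintype.expect_const, ← mul_expect] at h1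
        have := h x hD
        linarith
      · simp only [surv_of_not hD, sum_const_zero, mul_zero]
        linarith [hM x]
  have h1 : (t : ℝ) * surv step D (fun _ => 1) t x ≤
      ∑ s ∈ range t, surv step D (fun _ => 1) s x := by
    have := card_nsmul_le_sum (range t) (fun s => surv step D (fun _ => 1) s x)
      (surv step D (fun _ => 1) t x) fun s hs => surv_antitone x (mem_range.1 hs).le
    simpa using this
  nlinarith [key t x, hφ x, mul_le_mul_of_nonneg_left h1 hd]

lemma one_sub_exitProb_le : ∀ t x, 1 - exitProb step D (fun _ => True) t x ≤
    surv step D (fun _ => 1) t x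
  | 0, x => by
    by_cases hD : D x <;> simp [surv, exitProb, hD]
  | t + 1, x => by
    by_cases hD : D x
    · simp only [surv, exitProb, hD, if_true]
      rw [← Fintype.expect_const (ι := W) (1 : ℝ), ← expect_sub_distrib]
      exact expect_le_expect fun w _ => by simpa using one_sub_exitProb_le t (step x w)
    · simp [surv, exitProb, hD]

/-- Enlarging the state by a component that is updated deterministically does not change the
law of the original component. -/
lemma surv_prod {Q : Type*} (u : S × Q → Q) : ∀ t x p,
    surv (fun z w => (step z.1 w, u z)) (fun z => D z.1) (fun z => f z.1) t (x, p) =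
      surv step D f t x
  | 0, x, p => by simp [surv]
  | t + 1, x, p => by
    simp only [surv]
    split_ifs
    · exact expect_congr rfl fun w _ => surv_prod u t _ _
    · rfl

end MarkovChain

/-! ### From the recursion to the law of the infinite family of samples. -/

section Trajectory

variable {S W : Type*} [Fintype W] [Nonempty W]

/-- The trajectory from `x` driven by a sequence of choices. -/
def trajectory (step : S → W → S) (x : S) (w : ℕ → W) : ℕ → S
  | 0 => x
  | t + 1 => step (trajectory step x w t) (w t)

lemma trajectory_succ' (step : S → W → S) (x : S) (w : ℕ → W) : ∀ t,
    trajectory step x w (t + 1) = trajectory step (step x (w 0)) (fun s => w (s + 1)) t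
  | 0 => rfl
  | t + 1 => by
    rw [trajectory, trajectory_succ' step x w t]; rfl

lemma trajectory_congr (step : S → W → S) (x : S) {w w' : ℕ → W} : ∀ {t},
    (∀ s < t, w s = w' s) → trajectory step x w t = trajectory step x w' t
  | 0, _ => rfl
  | t + 1, h => by
    rw [trajectory, trajectory, trajectory_congr step x fun s hs => h s (by omega), h t (by omega)]

open Classical in
/-- Extension of a finite sequence of choices to an infinite one. -/
noncomputable def extend {T : ℕ} (w : Fin T → W) (t : ℕ) : W :=
  -- The default value is harmless: a trajectory up to time `T` reads only the choices before `T`.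
  if h : t < T then w ⟨t, h⟩ else Classical.arbitrary W

lemma extend_cons_zero {T : ℕ} (a : W) (w : Fin T → W) :
    extend (Fin.cons a w : Fin (T + 1) → W) 0 = a := by
  simp [extend]

lemma extend_cons_succ {T : ℕ} (a : W) (w : Fin T → W) :
    (fun s => extend (Fin.cons a w : Fin (T + 1) → W) (s + 1)) = extend w := by
  funext s
  unfold extend
  by_cases h : s < T
  · simp only [h, dif_pos, Nat.add_lt_add_iff_right]
    exact Fin.cons_succ (α := fun _ => W) a w ⟨s, h⟩
  · simp [h]

open Classical in
lemma expect_trajectory (step : S → W → S) (D : S → Prop) : ∀ (T : ℕ) (x : S),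
    𝔼 w : Fin T → W, (if ∀ t ≤ T, D (trajectory step x (extend w) t) then (1 : ℝ) else 0) =
      surv step D (fun _ => 1) T x
  | 0, x => by
    simp [surv, trajectory]
  | T + 1, x => by
    rw [← Fintype.expect_equiv (Fin.consEquiv fun _ : Fin (T + 1) => W)
      (fun p : W × (Fin T → W) => if D x ∧ ∀ t ≤ T, D (trajectory step (step x p.1) (extend p.2) t)
        then (1 : ℝ) else 0) _ ?_]
    · rw [← univ_product_univ, expect_product]
      by_cases hD : D x
      · simp only [hD, true_and, surv, if_true]
        exact expect_congr rfl fun w _ => expect_trajectory step D T _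
      · simp [hD, surv]
    · rintro ⟨a, w⟩
      congr 1
      have hc : (Fin.consEquiv fun _ : Fin (T + 1) => W) (a, w) =
        (Fin.cons a w : Fin (T + 1) → W) := rfl
      rw [hc, eq_iff_iff]
      constructor
      · rintro ⟨h0, h⟩ t ht
        rcases t with _ | t
        · exact h0
        · rw [trajectory_succ', extend_cons_zero, extend_cons_succ]
          exact h t (by omega)
      · intro h
        refine ⟨h 0 (by omega), fun t ht => ?_⟩
        have := h (t + 1) (by omega)
        rwa [trajectory_succ', extend_cons_zero, extend_cons_succ] at this

end Trajectory

lemma process_eq_trajectory {n k h : ℕ} (step : Config n k → (Fin n → Fin h → Fin n) → Config n k)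
    (x : Config n k) (ω : Samples n h) : ∀ t,
    process step x ω t = trajectory step x (fun s v i => ω (s, v, i)) t
  | 0 => rfl
  | t + 1 => by rw [process, trajectory, process_eq_trajectory step x ω t]

lemma infinitePi_uniform_real {ι α : Type*} [Fintype ι] [DecidableEq ι] [Fintype α] [Nonempty α]
    [MeasurableSpace α] [MeasurableSingletonClass α] (A : Set (ι → α)) [DecidablePred (· ∈ A)] :
    (Measure.infinitePi fun _ : ι => (PMF.uniformOfFintype α).toMeasure).real A =
      𝔼 f : ι → α, if f ∈ A then (1 : ℝ) else 0 := by
  classical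
  have h1 : A = ((univ.filter (· ∈ A) : Finset (ι → α)) : Set (ι → α)) := by ext; simp
  rw [show (Measure.infinitePi fun _ : ι => (PMF.uniformOfFintype α).toMeasure).real A =
    (Measure.infinitePi fun _ : ι => (PMF.uniformOfFintype α).toMeasure).real
      ((univ.filter (· ∈ A) : Finset (ι → α)) : Set (ι → α)) by rw [← h1],
    ← sum_measureReal_singleton, Fintype.expect_eq_sum_div_card]
  have h2 : ∀ f : ι → α, (Measure.infinitePi fun _ : ι =>
      (PMF.uniformOfFintype α).toMeasure).real {f} = 1 / (Fintype.card (ι → α) : ℝ) := by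
    intro f
    rw [Measure.real, Measure.infinitePi_singleton_of_fintype]
    simp
  simp [h2, div_eq_mul_inv]

/-- The event depends only on the samples of the first `T` rounds. Projecting the product measure to
these finitely many coordinates gives the uniform law, where probability is an average over `w`. -/
lemma sampleLaw_real_stay {n k h : ℕ} [NeZero n]
    (step : Config n k → (Fin n → Fin h → Fin n) → Config n k) (D : Config n k → Prop)
    (x : Config n k) (T : ℕ) :
    (sampleLaw n h).real {ω | ∀ t ≤ T, D (process step x ω t)} =
      surv step D (fun _ => 1) T x := by
  classical
  rw [← expect_trajectory]
  let e : Fin T × Fin n × Fin h → ℕ × Fin n × Fin h := fun p => (p.1, p.2)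
  have he : Function.Injective e := fun p q hpq => by
    simp only [e, Prod.mk.injEq] at hpq
    exact Prod.ext (Fin.ext hpq.1) hpq.2
  let A : Set (Fin T × Fin n × Fin h → Fin n) :=
    {f | ∀ t ≤ T, D (trajectory step x (extend fun s v i => f (s, v, i)) t)}
  have hpre : {ω : Samples n h | ∀ t ≤ T, D (process step x ω t)} =
      (fun ω i => ω (e i)) ⁻¹' A := by
    ext ω
    simp only [Set.mem_ofPred_eq, Set.mem_preimage, A]
    refine forall₂_congr fun t ht => ?_
    rw [process_eq_trajectory, trajectory_congr step x]
    intro s hs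
    have : s < T := by omega
    simp [extend, this, e]
  have hmap := Measure.map_infinitePi_infinitePi_of_inj
    (P := fun _ : ℕ × Fin n × Fin h => (PMF.uniformOfFintype (Fin n)).toMeasure) he
  have hm : Measurable fun (ω : Samples n h) (i : Fin T × Fin n × Fin h) => ω (e i) := by fun_prop
  rw [hpre, sampleLaw, ← map_measureReal_apply hm (Set.toFinite A).measurableSet, hmap,
    infinitePi_uniform_real]
  let E : (Fin T × Fin n × Fin h → Fin n) ≃ (Fin T → Fin n → Fin h → Fin n) :=
    ⟨fun f s v i => f (s, v, i), fun g p => g p.1 p.2.1 p.2.2, fun _ => rfl, fun _ => rfl⟩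
  exact Fintype.expect_equiv E _ _ fun f => if_congr Iff.rfl rfl rfl

/-- The event that the process is in `D` throughout is measurable. -/
lemma measurableSet_stay {n k h : ℕ}
    (step : Config n k → (Fin n → Fin h → Fin n) → Config n k) (D : Config n k → Prop)
    (x : Config n k) (T : ℕ) :
    MeasurableSet {ω : Samples n h | ∀ t ≤ T, D (process step x ω t)} := by
  classical
  let e : Fin T × Fin n × Fin h → ℕ × Fin n × Fin h := fun p => (p.1, p.2)
  rcases Nat.eq_zero_or_pos n with rfl | hn
  · exact (Set.toFinite _).measurableSet
  have : NeZero n := ⟨hn.ne'⟩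
  let A : Set (Fin T × Fin n × Fin h → Fin n) :=
    {f | ∀ t ≤ T, D (trajectory step x (extend fun s v i => f (s, v, i)) t)}
  have hpre : {ω : Samples n h | ∀ t ≤ T, D (process step x ω t)} =
      (fun ω i => ω (e i)) ⁻¹' A := by
    ext ω
    simp only [Set.mem_ofPred_eq, Set.mem_preimage, A]
    refine forall₂_congr fun t ht => ?_
    rw [process_eq_trajectory, trajectory_congr step x]
    intro s hs
    have : s < T := by omega
    simp [extend, this, e]
  rw [hpre]
  exact (by fun_prop : Measurable fun (ω : Samples n h) i => ω (e i)) (Set.toFinite A).measurableSet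

lemma sampleLaw_real_hit {n k h : ℕ} [NeZero n]
    (step : Config n k → (Fin n → Fin h → Fin n) → Config n k) (U : Config n k → Prop)
    (x : Config n k) (T : ℕ) :
    (sampleLaw n h).real {ω | ∃ t ≤ T, U (process step x ω t)} =
      1 - surv step (fun y => ¬ U y) (fun _ => 1) T x := by
  have : IsProbabilityMeasure (sampleLaw n h) := by unfold sampleLaw; infer_instance
  have hc := probReal_compl_eq_one_sub (μ := sampleLaw n h)
    (measurableSet_stay step (fun y => ¬ U y) x T)
  rw [← sampleLaw_real_stay, ← hc]
  congr 1
  ext ω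
  simp

lemma sampleLaw_consensusTime_le {n k h : ℕ} [NeZero n]
    (step : Config n k → (Fin n → Fin h → Fin n) → Config n k) (x : Config n k) (T : ℕ) {Y ε : ℝ}
    (hT : (T : ℝ) ≤ Y)
    (hs : surv step (fun y => ¬ ∃ i, ConsensusOn y i) (fun _ => 1) T x ≤ ε) :
    1 - ε ≤ (sampleLaw n h).real {ω | consensusTime (process step x ω) ≤ ENNReal.ofReal Y} := by
  have : IsProbabilityMeasure (sampleLaw n h) := by unfold sampleLaw; infer_instance
  have h1 := sampleLaw_real_hit step (fun y => ∃ i, ConsensusOn y i) x T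
  refine le_trans (by linarith) (h1.symm.le.trans (measureReal_mono ?_))
  rintro ω ⟨t, ht, hU⟩
  refine (iInf₂_le (f := fun (t : ℕ) (_ : ∃ i, ConsensusOn (process step x ω t) i) => (t : ℝ≥0∞))
    t hU).trans ?_
  rw [← ENNReal.ofReal_natCast]
  exact ENNReal.ofReal_le_ofReal (le_trans (by exact_mod_cast ht) hT)

lemma sampleLaw_le_consensusTime {n k h : ℕ} [NeZero n]
    (step : Config n k → (Fin n → Fin h → Fin n) → Config n k) (x : Config n k) (T : ℕ) {Y ε : ℝ}
    (hT : Y ≤ T + 1)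
    (hs : 1 - ε ≤ surv step (fun y => ¬ ∃ i, ConsensusOn y i) (fun _ => 1) T x) :
    1 - ε ≤ (sampleLaw n h).real {ω | ENNReal.ofReal Y ≤ consensusTime (process step x ω)} := by
  have : IsProbabilityMeasure (sampleLaw n h) := by unfold sampleLaw; infer_instance
  rw [← sampleLaw_real_stay] at hs
  refine hs.trans (measureReal_mono ?_)
  intro ω hω
  change ENNReal.ofReal Y ≤ consensusTime _
  unfold consensusTime
  refine le_iInf₂ fun t ht => ?_
  -- No consensus through time `T` means consensus at `T + 1` at the earliest, which accounts for
  -- the extra round allowed in `Y`.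
  have : T < t := by
    by_contra h
    exact hω t (by omega) ht
  rw [← ENNReal.ofReal_natCast]
  refine ENNReal.ofReal_le_ofReal (hT.trans ?_)
  exact_mod_cast this

/-! ### Sums of independent contributions of the vertices. -/

section Independence

variable {ι U : Type*} [Fintype ι] [DecidableEq ι] [Fintype U] [Nonempty U]

lemma expect_prod_apply (g : ι → U → ℝ) :
    𝔼 w : ι → U, ∏ v, g v (w v) = ∏ v, 𝔼 u, g v u := by
  simp only [Fintype.expect_eq_sum_div_card]
  rw [prod_div_distrib, prod_univ_sum, Fintype.piFinset_univ]
  simp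

lemma expect_apply_one (v : ι) (g : U → ℝ) : 𝔼 w : ι → U, g (w v) = 𝔼 u, g u := by
  have h := expect_prod_apply (ι := ι) (U := U) fun v' => if v' = v then g else fun _ => 1
  rw [Fintype.prod_eq_single v fun v' hv' => by simp [hv']] at h
  simp only [if_true] at h
  rw [← h]
  refine expect_congr rfl fun w _ => ?_
  rw [Fintype.prod_eq_single v fun v' hv' => by simp [hv']]
  simp

lemma expect_apply_two {v v' : ι} (hv : v ≠ v') (g g' : U → ℝ) :
    𝔼 w : ι → U, g (w v) * g' (w v') = (𝔼 u, g u) * 𝔼 u, g' u := by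
  have h := expect_prod_apply (ι := ι) (U := U)
    fun a => if a = v then g else if a = v' then g' else fun _ => 1
  rw [Fintype.prod_eq_mul v v' hv fun a ha => by simp [ha.1, ha.2]] at h
  simp only [if_true, hv.symm, if_false] at h
  rw [← h]
  refine expect_congr rfl fun w _ => ?_
  rw [Fintype.prod_eq_mul v v' hv fun a ha => by simp [ha.1, ha.2]]
  simp [hv.symm]

lemma expect_sq_sum_of_centered (g : ι → U → ℝ) (h0 : ∀ v, 𝔼 u, g v u = 0) :
    𝔼 w : ι → U, (∑ v, g v (w v)) ^ 2 = ∑ v, 𝔼 u, g v u ^ 2 := by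
  have h1 : ∀ w : ι → U, (∑ v, g v (w v)) ^ 2 = ∑ v, ∑ v', g v (w v) * g v' (w v') := fun w => by
    rw [sq, sum_mul_sum]
  simp_rw [h1]
  rw [expect_sum_comm]
  refine sum_congr rfl fun v _ => ?_
  rw [expect_sum_comm, Fintype.sum_eq_single v]
  · simp_rw [← sq]
    exact expect_apply_one v fun u => g v u ^ 2
  · intro v' hv'
    rw [expect_apply_two hv'.symm, h0, zero_mul]

/-- Bernstein's argument: |s(X - m)| ≤ 1, and there e^y ≤ 1 + y + y²; the linear term has mean zero.
-/
lemma expect_exp_centered_le (X : U → ℝ) (hX : ∀ u, |X u| ≤ 1) {s : ℝ} (hs : |s| ≤ 1 / 2) :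
    𝔼 u, Real.exp (s * (X u - 𝔼 u', X u')) ≤
      Real.exp (s ^ 2 * 𝔼 u, (X u - 𝔼 u', X u') ^ 2) := by
  set m := 𝔼 u', X u' with hm
  have hm1 : |m| ≤ 1 := (abs_expect_le _ _).trans (expect_le univ_nonempty fun u _ => hX u)
  have h1 : ∀ u, Real.exp (s * (X u - m)) ≤ 1 + s * (X u - m) + s ^ 2 * (X u - m) ^ 2 := by
    intro u
    have h2 : |s * (X u - m)| ≤ 1 := by
      rw [abs_mul]
      have : |X u - m| ≤ 2 := (abs_sub _ _).trans (by linarith [hX u])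
      nlinarith [abs_nonneg s, abs_nonneg (X u - m)]
    have := (abs_le.1 (Real.abs_exp_sub_one_sub_id_le h2)).2
    nlinarith
  calc 𝔼 u, Real.exp (s * (X u - m))
      ≤ 𝔼 u, (1 + s * (X u - m) + s ^ 2 * (X u - m) ^ 2) := expect_le_expect fun u _ => h1 u
    _ = 1 + s ^ 2 * 𝔼 u, (X u - m) ^ 2 := by
        rw [expect_add_distrib, expect_add_distrib, ← mul_expect, ← mul_expect,
          expect_sub_distrib, Fintype.expect_const, Fintype.expect_const, ← hm]
        ring
    _ ≤ _ := by
        rw [add_comm]; exact Real.add_one_le_exp _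

lemma expect_sq_centered (X : U → ℝ) :
    𝔼 u, (X u - 𝔼 u', X u') ^ 2 = 𝔼 u, X u ^ 2 - (𝔼 u, X u) ^ 2 := by
  set m := 𝔼 u', X u' with hm
  have : ∀ u, (X u - m) ^ 2 = X u ^ 2 - (2 * m) * X u + m ^ 2 := fun u => by ring
  simp_rw [this]
  rw [expect_add_distrib, expect_sub_distrib, ← mul_expect, Fintype.expect_const, ← hm]
  ring

/-- The variance is the least mean square deviation. The reference point `a` is taken to be 0 for
3-Majority and the value at the vertex's own opinion for 2-Choices. -/
lemma expect_sq_centered_le (X : U → ℝ) (a : ℝ) :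
    𝔼 u, (X u - 𝔼 u', X u') ^ 2 ≤ 𝔼 u, (X u - a) ^ 2 := by
  rw [expect_sq_centered]
  have : ∀ u, (X u - a) ^ 2 = X u ^ 2 - (2 * a) * X u + a ^ 2 := fun u => by ring
  simp_rw [this]
  rw [expect_add_distrib, expect_sub_distrib, ← mul_expect, Fintype.expect_const]
  nlinarith [sq_nonneg (a - 𝔼 u, X u)]

end Independence

/-! ### Fractions, collision probability and expected drift. -/

section Configurations

variable {n k : ℕ} [NeZero n]

/-- The collision probability: the probability that two random vertices hold the same opinion. -/
noncomputable def collision (x : Config n k) : ℝ := ∑ j, fraction x j ^ 2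

/-- The average of `f` over the opinions held by the vertices. -/
noncomputable def lin (f : Fin k → ℝ) (x : Config n k) : ℝ := (∑ v, f (x v)) / n

lemma cast_pos_of_neZero : (0 : ℝ) < n := by exact_mod_cast Nat.pos_of_ne_zero (NeZero.ne n)

lemma one_le_cast_of_neZero : (1 : ℝ) ≤ n := by
  exact_mod_cast Nat.one_le_iff_ne_zero.2 (NeZero.ne n)

lemma lin_eq_sum (f : Fin k → ℝ) (x : Config n k) : lin f x = ∑ j, f j * fraction x j := by
  unfold lin fraction support
  simp_rw [← mul_div_assoc, ← sum_div]
  congr 1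
  simp_rw [card_filter, Nat.cast_sum, mul_sum]
  rw [sum_comm]
  simp

lemma lin_eq_expect (f : Fin k → ℝ) (x : Config n k) : lin f x = 𝔼 v, f (x v) := by
  rw [Fintype.expect_eq_sum_div_card, lin, Fintype.card_fin]

lemma expect_comp (f : Fin k → ℝ) (x : Config n k) :
    𝔼 v, f (x v) = ∑ j, f j * fraction x j := by
  rw [← lin_eq_expect, lin_eq_sum]

lemma fraction_nonneg (x : Config n k) (j : Fin k) : 0 ≤ fraction x j := by
  unfold fraction; positivity

lemma sum_fraction (x : Config n k) : ∑ j, fraction x j = 1 := by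
  have h := lin_eq_sum (fun _ => (1 : ℝ)) x
  simp only [one_mul] at h
  rw [← h, lin]
  simp [cast_pos_of_neZero.ne']

lemma fraction_le_one (x : Config n k) (j : Fin k) : fraction x j ≤ 1 := by
  rw [← sum_fraction x]
  exact single_le_sum (fun i _ => fraction_nonneg x i) (mem_univ j)

lemma fraction_add_le_one (x : Config n k) {i j : Fin k} (h : i ≠ j) :
    fraction x i + fraction x j ≤ 1 := by
  rw [← sum_fraction x, ← sum_pair h]
  exact sum_le_sum_of_subset_of_nonneg (subset_univ _) fun i _ _ => fraction_nonneg x i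

lemma lin_single (x : Config n k) (i : Fin k) :
    lin (fun j => if j = i then 1 else 0) x = fraction x i := by
  rw [lin_eq_sum]; simp

lemma lin_sub (f g : Fin k → ℝ) (x : Config n k) :
    lin (fun j => f j - g j) x = lin f x - lin g x := by
  simp [lin, sum_sub_distrib, sub_div]

lemma collision_nonneg (x : Config n k) : 0 ≤ collision x := sum_nonneg fun _ _ => sq_nonneg _

lemma sq_fraction_le_collision (x : Config n k) (j : Fin k) :
    fraction x j ^ 2 ≤ collision x :=
  single_le_sum (f := fun j => fraction x j ^ 2) (fun _ _ => sq_nonneg _) (mem_univ j)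

lemma collision_le_of_le (x : Config n k) {a : ℝ} (h : ∀ j, fraction x j ≤ a) :
    collision x ≤ a := by
  calc collision x ≤ ∑ j, a * fraction x j := sum_le_sum fun j _ => by
        rw [sq]; exact mul_le_mul_of_nonneg_right (h j) (fraction_nonneg x j)
    _ = a := by rw [← mul_sum, sum_fraction, mul_one]

lemma collision_le_one (x : Config n k) : collision x ≤ 1 :=
  collision_le_of_le x (fraction_le_one x)

lemma inv_le_collision (x : Config n k) : 1 / (n : ℝ) ≤ collision x := by
  have hn : (0 : ℝ) < n := cast_pos_of_neZero
  have h : ∀ j, fraction x j * (1 / n) ≤ fraction x j ^ 2 := by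
    intro j
    unfold fraction
    rw [div_mul_div_comm, mul_one, div_pow, ← sq]
    refine div_le_div_of_nonneg_right ?_ (by positivity)
    have : support x j ≤ support x j ^ 2 := Nat.le_self_pow two_ne_zero _
    exact_mod_cast this
  calc 1 / (n : ℝ) = ∑ j, fraction x j * (1 / n) := by rw [← sum_mul, sum_fraction, one_mul]
    _ ≤ _ := sum_le_sum fun j _ => h j

lemma inv_card_le_collision (x : Config n k) : 1 ≤ k * collision x := by
  have h := sq_sum_le_card_mul_sum_sq (s := (univ : Finset (Fin k))) (f := fun j => fraction x j)
  rw [sum_fraction] at h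
  simpa [collision] using h

/-- Nonnegativity of the variance of α_J, where J is the opinion of a random vertex and so has mean
α_J equal to γ. This is why the drift never lowers γ. -/
lemma sq_collision_le (x : Config n k) : collision x ^ 2 ≤ ∑ j, fraction x j ^ 3 := by
  have h : 0 ≤ ∑ j, fraction x j * (fraction x j - collision x) ^ 2 :=
    sum_nonneg fun j _ => mul_nonneg (fraction_nonneg x j) (sq_nonneg _)
  have h2 : ∑ j, fraction x j * (fraction x j - collision x) ^ 2 =
      ∑ j, fraction x j ^ 3 - 2 * collision x * ∑ j, fraction x j ^ 2 +
        collision x ^ 2 * ∑ j, fraction x j := by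
    rw [mul_sum, mul_sum, ← sum_sub_distrib, ← sum_add_distrib]
    exact sum_congr rfl fun j _ => by ring
  rw [h2, sum_fraction, ← collision] at h
  nlinarith

lemma sum_cube_le (x : Config n k) : ∑ j, fraction x j ^ 3 ≤ collision x :=
  sum_le_sum fun j _ => pow_le_pow_of_le_one (fraction_nonneg x j) (fraction_le_one x j) (by norm_num)

lemma sum_fourth_le (x : Config n k) : ∑ j, fraction x j ^ 4 ≤ collision x ^ 2 := by
  calc ∑ j, fraction x j ^ 4 ≤ ∑ j, collision x * fraction x j ^ 2 := sum_le_sum fun j _ => by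
        nlinarith [sq_fraction_le_collision x j, sq_nonneg (fraction x j)]
    _ = _ := by rw [← mul_sum, ← collision, sq]

/-- The convex function γ lies above its tangent at `x`. Lower tails of the quadratic quantity γ
thus reduce to those of a linear statistic, a sum of independent terms. -/
lemma collision_sub_ge (x y : Config n k) :
    2 * (lin (fraction x) y - collision x) ≤ collision y - collision x := by
  have h : 0 ≤ ∑ j, (fraction y j - fraction x j) ^ 2 := sum_nonneg fun j _ => sq_nonneg _
  have h2 : ∑ j, (fraction y j - fraction x j) ^ 2 =
      ∑ j, fraction y j ^ 2 - 2 * ∑ j, fraction x j * fraction y j + ∑ j, fraction x j ^ 2 := by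
    rw [mul_sum, ← sum_sub_distrib, ← sum_add_distrib]
    exact sum_congr rfl fun j _ => by ring
  rw [h2, ← lin_eq_sum, ← collision, ← collision] at h
  linarith

/-- The expectation of `lin f` after one round of either dynamics. -/
noncomputable def mean (f : Fin k → ℝ) (x : Config n k) : ℝ :=
  ∑ j, f j * (fraction x j * (1 + fraction x j - collision x))

lemma mean_single (x : Config n k) (i : Fin k) :
    mean (fun j => if j = i then 1 else 0) x =
      fraction x i * (1 + fraction x i - collision x) := by
  simp [mean]

lemma mean_sub (f g : Fin k → ℝ) (x : Config n k) :
    mean (fun j => f j - g j) x = mean f x - mean g x := by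
  simp [mean, sub_mul, sum_sub_distrib]

end Configurations

/-! ### One round in which the vertices update independently. -/

section OneRound

variable {n k : ℕ} [NeZero n] {U : Type*} [Fintype U] [Nonempty U] (rule : Fin n → U → Fin k)
  (f : Fin k → ℝ)

lemma expect_lin_rule :
    𝔼 w : Fin n → U, lin f (fun v => rule v (w v)) = (∑ v, 𝔼 u, f (rule v u)) / n := by
  unfold lin
  rw [← expect_div, expect_sum_comm]
  congr 1
  exact sum_congr rfl fun v _ => expect_apply_one v fun u => f (rule v u)

lemma lin_rule_sub (w : Fin n → U) :
    lin f (fun v => rule v (w v)) - (∑ v, 𝔼 u, f (rule v u)) / n =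
      (∑ v, (f (rule v (w v)) - 𝔼 u, f (rule v u))) / n := by
  rw [lin, ← sub_div, sum_sub_distrib]

lemma expect_sq_lin_rule :
    𝔼 w : Fin n → U, (lin f (fun v => rule v (w v)) - (∑ v, 𝔼 u, f (rule v u)) / n) ^ 2 =
      (∑ v, 𝔼 u, (f (rule v u) - 𝔼 u', f (rule v u')) ^ 2) / n ^ 2 := by
  simp_rw [lin_rule_sub, div_pow]
  rw [← expect_div, expect_sq_sum_of_centered fun v u => f (rule v u) - 𝔼 u', f (rule v u')]
  intro v
  rw [expect_sub_distrib, Fintype.expect_const, sub_self]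

lemma expect_exp_lin_rule_le (hf : ∀ j, |f j| ≤ 1) {t : ℝ} (ht : |t| ≤ n / 2) :
    𝔼 w : Fin n → U, Real.exp (t * (lin f (fun v => rule v (w v)) -
      (∑ v, 𝔼 u, f (rule v u)) / n)) ≤
      Real.exp (t ^ 2 / n ^ 2 * ∑ v, 𝔼 u, (f (rule v u) - 𝔼 u', f (rule v u')) ^ 2) := by
  have hn : (0 : ℝ) < n := cast_pos_of_neZero
  have h1 : ∀ w : Fin n → U, Real.exp (t * (lin f (fun v => rule v (w v)) -
      (∑ v, 𝔼 u, f (rule v u)) / n)) =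
      ∏ v, Real.exp (t / n * (f (rule v (w v)) - 𝔼 u, f (rule v u))) := by
    intro w
    rw [lin_rule_sub, ← Real.exp_sum, ← mul_sum]
    congr 1
    ring
  simp_rw [h1]
  rw [expect_prod_apply fun v u => Real.exp (t / n * (f (rule v u) - 𝔼 u, f (rule v u))),
    mul_sum, Real.exp_sum]
  refine prod_le_prod (fun v _ => expect_nonneg fun u _ => (Real.exp_pos _).le) fun v _ => ?_
  have := expect_exp_centered_le (fun u => f (rule v u)) (fun u => hf _) (s := t / n) (by
    rw [abs_div, abs_of_pos hn, div_le_iff₀ hn]; linarith)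
  rwa [div_pow] at this

end OneRound

/-! ### The common interface and its verification for both dynamics. -/

/-- A function of the size of an opinion that bounds the variance of its support. -/
structure IsNoiseScale (S : ℝ → ℝ) : Prop where
  mono : ∀ a b, 0 ≤ a → a ≤ b → S a ≤ S b
  scale : ∀ c z, 1 ≤ c → 0 ≤ z → S (c * z) ≤ c * S z
  le : ∀ z, 0 ≤ z → z ≤ 1 → z ≤ S z
  le_two : ∀ z, 0 ≤ z → z ≤ 1 → S z ≤ 2

/-- The properties common to 3-Majority and 2-Choices on which the analysis rests. -/
structure IsPluralityDynamics {n k : ℕ} {W : Type*} [Fintype W]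
    (step : Config n k → W → Config n k) (noise : Config n k → Fin k → ℝ) (S : ℝ → ℝ) (d : ℝ) :
    Prop where
  expect_lin : ∀ f x, 𝔼 w, lin f (step x w) = mean f x
  expect_exp : ∀ f x t, (∀ j, |f j| ≤ 1) → |t| ≤ (n : ℝ) / 2 →
    𝔼 w, Real.exp (t * (lin f (step x w) - mean f x)) ≤
      Real.exp (t ^ 2 / n * ∑ j, 2 * fraction x j * noise x j * f j ^ 2)
  noise_nonneg : ∀ x j, 0 ≤ noise x j
  noise_le : ∀ x j z, fraction x j ≤ z → collision x ≤ z → noise x j ≤ S z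
  noise_cube : ∀ x, ∑ j, fraction x j * noise x j * fraction x j ^ 2 ≤ collision x * S (collision x)
  -- The one field that bounds the noise of a difference from below: it is what breaks the tie
  -- between two equally strong opinions.
  variance_ge : ∀ x i j z, i ≠ j → 3 / 4 * z ≤ fraction x i → fraction x i ≤ 2 * z →
    3 / 4 * z ≤ fraction x j → fraction x j ≤ 2 * z → 9 / 10 * z ≤ collision x →
    collision x ≤ 11 / 10 * z → z * S z / (200 * n) ≤
      𝔼 w, (lin (fun a => (if a = i then 1 else 0) - (if a = j then 1 else 0)) (step x w) -
        mean (fun a => (if a = i then 1 else 0) - (if a = j then 1 else 0)) x) ^ 2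
  drift : ∀ x, collision x ≤ 1 / 16 → collision x + d ≤ 𝔼 w, collision (step x w)

lemma expect_fin_succ {V : Type*} [Fintype V] {m : ℕ} (G : (Fin (m + 1) → V) → ℝ) :
    𝔼 u, G u = 𝔼 a, 𝔼 u' : Fin m → V, G (Fin.cons a u') := by
  rw [← Fintype.expect_equiv (Fin.consEquiv fun _ : Fin (m + 1) => V)
    (fun p : V × (Fin m → V) => G (Fin.cons p.1 p.2)) _ fun p => rfl,
    ← univ_product_univ, expect_product]

lemma expect_fin_two {V : Type*} [Fintype V] [Nonempty V] (G : V → V → ℝ) :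
    𝔼 u : Fin 2 → V, G (u 0) (u 1) = 𝔼 a, 𝔼 b, G a b := by
  rw [expect_fin_succ]
  refine expect_congr rfl fun a _ => ?_
  rw [expect_fin_succ]
  refine expect_congr rfl fun b _ => ?_
  exact Fintype.expect_const _

lemma expect_fin_three {V : Type*} [Fintype V] [Nonempty V] (G : V → V → V → ℝ) :
    𝔼 u : Fin 3 → V, G (u 0) (u 1) (u 2) = 𝔼 a, 𝔼 b, 𝔼 c, G a b c := by
  rw [expect_fin_succ]
  refine expect_congr rfl fun a _ => ?_
  exact expect_fin_two fun b c => G a b c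

section Rules

variable {n k : ℕ} [NeZero n] (x : Config n k) (φ : Fin k → ℝ)

lemma expect_agree (ψ : ℝ) :
    𝔼 a, 𝔼 b, (if x a = x b then φ (x a) else ψ) =
      ∑ j, φ j * fraction x j ^ 2 + (1 - collision x) * ψ := by
  have h1 : ∀ i, 𝔼 b, (if i = x b then φ i else ψ) = ψ + (φ i - ψ) * fraction x i := by
    intro i
    rw [expect_comp (fun j => if i = j then φ i else ψ)]
    have : ∀ j, (if i = j then φ i else ψ) * fraction x j =
        ψ * fraction x j + if i = j then (φ i - ψ) * fraction x j else 0 := by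
      intro j; split_ifs <;> ring
    simp_rw [this]
    rw [sum_add_distrib, ← mul_sum, sum_fraction]
    simp
  simp_rw [h1]
  rw [expect_comp (fun i => ψ + (φ i - ψ) * fraction x i)]
  have : ∀ i, (ψ + (φ i - ψ) * fraction x i) * fraction x i =
      ψ * fraction x i + φ i * fraction x i ^ 2 - ψ * fraction x i ^ 2 := fun i => by ring
  simp_rw [this]
  rw [sum_sub_distrib, sum_add_distrib, ← mul_sum, ← mul_sum, sum_fraction, ← collision]
  ring

lemma expect_threeMajority_rule :
    𝔼 u : Fin 3 → Fin n, φ (if x (u 0) = x (u 1) then x (u 0) else x (u 2)) = mean φ x := by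
  rw [expect_fin_three fun a b c => φ (if x a = x b then x a else x c)]
  have h : ∀ a b, 𝔼 c, φ (if x a = x b then x a else x c) =
      if x a = x b then φ (x a) else ∑ j, φ j * fraction x j := by
    intro a b
    split_ifs
    · exact Fintype.expect_const _
    · exact expect_comp φ x
  simp_rw [h]
  rw [expect_agree, mean, mul_sum, ← sum_add_distrib]
  exact sum_congr rfl fun j _ => by ring

lemma expect_twoChoices_rule (v : Fin n) :
    𝔼 u : Fin 2 → Fin n, φ (if x (u 0) = x (u 1) then x (u 0) else x v) =
      ∑ j, φ j * fraction x j ^ 2 + (1 - collision x) * φ (x v) := by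
  rw [expect_fin_two fun a b => φ (if x a = x b then x a else x v), ← expect_agree]
  refine expect_congr rfl fun a _ => expect_congr rfl fun b _ => ?_
  split_ifs <;> rfl

lemma expect_twoChoices_rule_sum :
    (∑ v, 𝔼 u : Fin 2 → Fin n, φ (if x (u 0) = x (u 1) then x (u 0) else x v)) / n =
      mean φ x := by
  have hn : (n : ℝ) ≠ 0 := cast_pos_of_neZero.ne'
  simp_rw [expect_twoChoices_rule]
  rw [sum_add_distrib, ← mul_sum, add_div, mul_div_assoc, ← lin, lin_eq_sum, mean, mul_sum]
  rw [sum_const, card_univ, Fintype.card_fin, nsmul_eq_mul, mul_div_cancel_left₀ _ hn,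
    ← sum_add_distrib]
  exact sum_congr rfl fun j _ => by ring

/-- Apply (1 + u)² ≥ 1 + 2u with u = α_j - γ and sum; the linear term is 2(Σ α_j³ - γ²) ≥ 0. -/
lemma collision_le_sum_mean_sq :
    collision x ≤ ∑ j, mean (fun a => if a = j then 1 else 0) x ^ 2 := by
  have h : ∀ j, fraction x j ^ 2 + 2 * (fraction x j ^ 3 - collision x * fraction x j ^ 2) ≤
      mean (fun a => if a = j then 1 else 0) x ^ 2 := by
    intro j
    rw [mean_single]
    nlinarith [sq_nonneg (fraction x j * (fraction x j - collision x))]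
  refine le_trans ?_ (sum_le_sum fun j _ => h j)
  rw [sum_add_distrib, ← mul_sum, sum_sub_distrib, ← mul_sum, ← collision]
  nlinarith [sq_collision_le x]

/-- A second moment is squared mean plus variance. The squared means already sum to at least γ, and
the indicator vector of the new opinion of a vertex has total variance 1 - Σ p_j². -/
lemma collision_add_le_expect {U : Type*} [Fintype U] [Nonempty U] (rule : Fin n → U → Fin k)
    (hr : ∀ f, (∑ v, 𝔼 u, f (rule v u)) / n = mean f x) :
    collision x + (∑ v, (1 - ∑ j, (𝔼 u, if rule v u = j then (1 : ℝ) else 0) ^ 2)) / n ^ 2 ≤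
      𝔼 w : Fin n → U, collision (fun v => rule v (w v)) := by
  have h1 : ∀ j, 𝔼 w : Fin n → U, fraction (fun v => rule v (w v)) j ^ 2 =
      mean (fun a => if a = j then 1 else 0) x ^ 2 +
      (∑ v, ((𝔼 u, if rule v u = j then (1 : ℝ) else 0) -
        (𝔼 u, if rule v u = j then (1 : ℝ) else 0) ^ 2)) / n ^ 2 := by
    intro j
    have h2 := expect_sq_lin_rule rule (fun a => if a = j then 1 else 0)
    have h3 := expect_lin_rule rule (fun a => if a = j then 1 else 0)
    have h4 := hr (fun a => if a = j then 1 else 0)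
    rw [← h3, expect_sq_centered, h3, h4] at h2
    simp_rw [expect_sq_centered] at h2
    simp only [lin_single, ite_pow, one_pow, zero_pow (two_ne_zero)] at h2
    linarith
  unfold collision
  rw [expect_sum_comm]
  simp_rw [h1]
  rw [sum_add_distrib, ← sum_div, sum_comm]
  refine add_le_add (collision_le_sum_mean_sq x) (le_of_eq ?_)
  congr 1
  refine sum_congr rfl fun v _ => ?_
  rw [sum_sub_distrib, ← expect_sum_comm]
  simp

end Rules

lemma isNoiseScale_one : IsNoiseScale fun _ => 1 where
  mono _ _ _ _ := le_rfl
  scale c z hc _ := by simpa using hc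
  le z _ h := h
  le_two z _ _ := by norm_num

lemma isNoiseScale_two_mul : IsNoiseScale fun z => 2 * z where
  mono a b _ h := by linarith
  scale c z hc _ := by linarith
  le z h _ := by linarith
  le_two z _ h := by linarith

lemma abs_ind_sub_le {k : ℕ} (i j a : Fin k) :
    |(if a = i then (1 : ℝ) else 0) - (if a = j then 1 else 0)| ≤ 1 := by
  split_ifs <;> norm_num

lemma sq_ind_sub {k : ℕ} {i j : Fin k} (h : i ≠ j) (a : Fin k) :
    ((if a = i then (1 : ℝ) else 0) - (if a = j then 1 else 0)) ^ 2 =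
      (if a = i then 1 else 0) + (if a = j then 1 else 0) := by
  split_ifs with h1 h2
  · exact absurd (h1.symm.trans h2) h
  all_goals norm_num

/-- The new opinion of a vertex has the same law for all vertices, so a fraction of order z has
vertex variance of order z: the noise scale is constant. For γ ≤ 1/16 every vertex adds at least 1/2
to the total variance, whence d = 1/(2n). -/
theorem isPluralityDynamics_threeMajority (n k : ℕ) [NeZero n] :
    IsPluralityDynamics (threeMajorityStep (n := n) (k := k)) (fun _ _ => 1) (fun _ => 1)
      (1 / (2 * n)) := by
  have hn : (0 : ℝ) < n := cast_pos_of_neZero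
  let rule (x : Config n k) (_ : Fin n) (u : Fin 3 → Fin n) : Fin k :=
    if x (u 0) = x (u 1) then x (u 0) else x (u 2)
  have hstep : ∀ x w, threeMajorityStep (n := n) (k := k) x w = fun v => rule x v (w v) :=
    fun x w => rfl
  have hE : ∀ (φ : Fin k → ℝ) x v, 𝔼 u, φ (rule x v u) = mean φ x :=
    fun φ x v => expect_threeMajority_rule x φ
  have hr : ∀ x f, (∑ v, 𝔼 u, f (rule x v u)) / n = mean f x := by
    intro x f
    simp_rw [hE]
    simp [hn.ne']
  refine ⟨?_, ?_, fun _ _ => zero_le_one, fun _ _ _ _ _ => le_rfl, ?_, ?_, ?_⟩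
  · intro f x
    simp_rw [hstep]
    rw [expect_lin_rule, hr]
  · intro f x t hf ht
    simp_rw [hstep]
    have h := expect_exp_lin_rule_le (rule x) f hf ht
    rw [hr] at h
    refine h.trans (Real.exp_le_exp.2 ?_)
    have h2 : ∀ v, 𝔼 u, (f (rule x v u) - 𝔼 u', f (rule x v u')) ^ 2 ≤
        ∑ j, 2 * fraction x j * 1 * f j ^ 2 := by
      intro v
      refine (expect_sq_centered_le _ 0).trans ?_
      simp only [sub_zero]
      rw [hE (fun j => f j ^ 2) x v, mean]
      refine sum_le_sum fun j _ => ?_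
      have : fraction x j * (1 + fraction x j - collision x) ≤ 2 * fraction x j := by
        nlinarith [fraction_nonneg x j, fraction_le_one x j, collision_nonneg x]
      nlinarith [sq_nonneg (f j)]
    calc t ^ 2 / n ^ 2 * ∑ v, 𝔼 u, (f (rule x v u) - 𝔼 u', f (rule x v u')) ^ 2
        ≤ t ^ 2 / n ^ 2 * ∑ v : Fin n, ∑ j, 2 * fraction x j * 1 * f j ^ 2 :=
          mul_le_mul_of_nonneg_left (sum_le_sum fun v _ => h2 v) (by positivity)
      _ = _ := by
          rw [sum_const, card_univ, Fintype.card_fin, nsmul_eq_mul]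
          field_simp
  · intro x
    have := sum_cube_le x
    simp only [mul_one]
    refine le_trans (le_of_eq ?_) this
    exact sum_congr rfl fun j _ => by ring
  · intro x i j z hij h1 h2 h3 h4 h5 h6
    simp_rw [hstep]
    rw [← hr, expect_sq_lin_rule]
    simp_rw [expect_sq_centered]
    have h7 : ∀ v, 𝔼 u, (((if rule x v u = i then (1 : ℝ) else 0) -
        if rule x v u = j then 1 else 0) ^ 2) =
        mean (fun a => (if a = i then 1 else 0) + (if a = j then 1 else 0)) x := by
      intro v
      rw [← hE _ x v]
      exact expect_congr rfl fun u _ => sq_ind_sub hij _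
    have h8 : ∀ v, 𝔼 u, (((if rule x v u = i then (1 : ℝ) else 0) -
        if rule x v u = j then 1 else 0)) =
        mean (fun a => (if a = i then 1 else 0) - (if a = j then 1 else 0)) x :=
      fun v => hE (fun a => (if a = i then 1 else 0) - (if a = j then 1 else 0)) x v
    simp_rw [h7, h8]
    rw [sum_const, card_univ, Fintype.card_fin, nsmul_eq_mul, mean_sub, mean_single, mean_single]
    have h9 : mean (fun a => (if a = i then 1 else 0) + (if a = j then 1 else 0)) x =
        fraction x i * (1 + fraction x i - collision x) +
        fraction x j * (1 + fraction x j - collision x) := by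
      simp [mean, add_mul, sum_add_distrib]
    rw [h9, mul_one]
    have h10 := fraction_add_le_one x hij
    have hz : 0 ≤ z := by
      by_contra hz
      have := fraction_nonneg x i
      linarith
    set p := fraction x i * (1 + fraction x i - collision x) with hp
    set q := fraction x j * (1 + fraction x j - collision x) with hq
    have hpz : z / 2 ≤ p := by rw [hp]; nlinarith
    have hqz : z / 2 ≤ q := by rw [hq]; nlinarith
    have hpq : p + q ≤ 1 := by
      have h := sum_pair (f := fun j => fraction x j * (1 + fraction x j - collision x)) hij
      have h11 : ∑ j, fraction x j * (1 + fraction x j - collision x) = 1 := by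
        have : ∀ j, fraction x j * (1 + fraction x j - collision x) =
          fraction x j * (1 - collision x) + fraction x j ^ 2 := fun j => by ring
        simp_rw [this]
        rw [sum_add_distrib, ← sum_mul, sum_fraction, ← collision]
        ring
      rw [hp, hq, ← h]
      refine le_trans ?_ h11.le
      refine sum_le_sum_of_subset_of_nonneg (subset_univ _) fun a _ _ => ?_
      have := collision_le_one x
      have := fraction_nonneg x a
      nlinarith
    have h12 : z / 200 ≤ p + q - (p - q) ^ 2 := by
      nlinarith
    have h13 : z / (200 * n) = z / 200 / n := by rw [div_div]
    rw [h13]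
    have h14 : (n : ℝ) * (p + q - (p - q) ^ 2) / n ^ 2 = (p + q - (p - q) ^ 2) / n := by
      field_simp
    rw [h14]
    exact div_le_div_of_nonneg_right h12 hn.le
  · intro x hx
    simp_rw [hstep]
    refine le_trans ?_ (collision_add_le_expect x (rule x) (hr x))
    have h1 : ∀ v, (1 / 2 : ℝ) ≤ 1 - ∑ j, (𝔼 u, if rule x v u = j then (1 : ℝ) else 0) ^ 2 := by
      intro v
      have h2 : ∀ j, 𝔼 u, (if rule x v u = j then (1 : ℝ) else 0) =
          fraction x j * (1 + fraction x j - collision x) := fun j => by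
        rw [← mean_single]; exact hE (fun a => if a = j then 1 else 0) x v
      simp_rw [h2]
      have h3 : ∑ j, (fraction x j * (1 + fraction x j - collision x)) ^ 2 ≤
          ∑ j, 4 * fraction x j ^ 2 := by
        refine sum_le_sum fun j _ => ?_
        rw [mul_pow, mul_comm]
        refine mul_le_mul_of_nonneg_right ?_ (sq_nonneg _)
        have := fraction_nonneg x j
        have := fraction_le_one x j
        have := collision_nonneg x
        nlinarith
      rw [← mul_sum, ← collision] at h3
      linarith
    have h4 : ∑ v : Fin n, (1 / 2 : ℝ) ≤
        ∑ v, (1 - ∑ j, (𝔼 u, if rule x v u = j then (1 : ℝ) else 0) ^ 2) :=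
      sum_le_sum fun v _ => h1 v
    rw [sum_const, card_univ, Fintype.card_fin, nsmul_eq_mul] at h4
    refine add_le_add le_rfl ?_
    calc 1 / (2 * (n : ℝ)) = (n * (1 / 2)) / n ^ 2 := by field_simp
      _ ≤ _ := div_le_div_of_nonneg_right h4 (by positivity)

/-- A vertex changes its mind with probability at most γ and joins j with probability α_j² unless it
already holds j. This yields the noise α_j + γ. The total variance is at least nγ when γ ≤ 1/16, and
nγ ≥ 1 gives d = 1/n². -/
theorem isPluralityDynamics_twoChoices (n k : ℕ) [NeZero n] :
    IsPluralityDynamics (twoChoicesStep (n := n) (k := k))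
      (fun x j => fraction x j + collision x) (fun z => 2 * z) (1 / n ^ 2) := by
  have hn : (0 : ℝ) < n := cast_pos_of_neZero
  let rule (x : Config n k) (v : Fin n) (u : Fin 2 → Fin n) : Fin k :=
    if x (u 0) = x (u 1) then x (u 0) else x v
  have hstep : ∀ x w, twoChoicesStep (n := n) (k := k) x w = fun v => rule x v (w v) :=
    fun x w => rfl
  have hE : ∀ (φ : Fin k → ℝ) x v, 𝔼 u, φ (rule x v u) =
      ∑ j, φ j * fraction x j ^ 2 + (1 - collision x) * φ (x v) :=
    fun φ x v => expect_twoChoices_rule x φ v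
  have hr : ∀ x f, (∑ v, 𝔼 u, f (rule x v u)) / n = mean f x :=
    fun x f => expect_twoChoices_rule_sum x f
  refine ⟨?_, ?_, fun x j => add_nonneg (fraction_nonneg x j) (collision_nonneg x),
    fun x j z h1 h2 => by linarith, ?_, ?_, ?_⟩
  · intro f x
    simp_rw [hstep]
    rw [expect_lin_rule, hr]
  · intro f x t hf ht
    simp_rw [hstep]
    have h := expect_exp_lin_rule_le (rule x) f hf ht
    rw [hr] at h
    refine h.trans (Real.exp_le_exp.2 ?_)
    have h2 : ∀ v, 𝔼 u, (f (rule x v u) - 𝔼 u', f (rule x v u')) ^ 2 ≤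
        ∑ j, 2 * f j ^ 2 * fraction x j ^ 2 + 2 * collision x * f (x v) ^ 2 := by
      intro v
      refine (expect_sq_centered_le _ (f (x v))).trans ?_
      rw [hE (fun j => (f j - f (x v)) ^ 2) x v]
      have h3 : ∀ j, (f j - f (x v)) ^ 2 * fraction x j ^ 2 ≤
          2 * f j ^ 2 * fraction x j ^ 2 + 2 * f (x v) ^ 2 * fraction x j ^ 2 := by
        intro j
        rw [← add_mul]
        refine mul_le_mul_of_nonneg_right ?_ (sq_nonneg _)
        nlinarith [sq_nonneg (f j + f (x v))]
      have h4 := sum_le_sum fun j (_ : j ∈ univ) => h3 j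
      rw [sum_add_distrib, ← mul_sum, ← collision] at h4
      simp only [sub_self, zero_pow two_ne_zero, mul_zero, add_zero]
      linarith
    have h5 := sum_le_sum fun v (_ : v ∈ univ) => h2 v
    rw [sum_add_distrib, ← mul_sum, sum_const, card_univ, Fintype.card_fin, nsmul_eq_mul] at h5
    have h6 : ∑ v, f (x v) ^ 2 = n * ∑ j, f j ^ 2 * fraction x j := by
      rw [← lin_eq_sum (fun j => f j ^ 2), lin]
      field_simp
    rw [h6] at h5
    calc t ^ 2 / n ^ 2 * ∑ v, 𝔼 u, (f (rule x v u) - 𝔼 u', f (rule x v u')) ^ 2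
        ≤ t ^ 2 / n ^ 2 * (n * ∑ j, 2 * f j ^ 2 * fraction x j ^ 2 +
          2 * collision x * (n * ∑ j, f j ^ 2 * fraction x j)) :=
          mul_le_mul_of_nonneg_left h5 (by positivity)
      _ = t ^ 2 / n * (∑ j, 2 * f j ^ 2 * fraction x j ^ 2 +
          2 * collision x * ∑ j, f j ^ 2 * fraction x j) := by field_simp
      _ = _ := by
          rw [mul_sum, ← sum_add_distrib]
          congr 1
          exact sum_congr rfl fun j _ => by ring
  · intro x
    have h1 := sum_fourth_le x
    have h2 := sum_cube_le x
    have h3 : ∑ j, fraction x j * (fraction x j + collision x) * fraction x j ^ 2 =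
        ∑ j, fraction x j ^ 4 + collision x * ∑ j, fraction x j ^ 3 := by
      rw [mul_sum, ← sum_add_distrib]
      exact sum_congr rfl fun j _ => by ring
    rw [h3]
    nlinarith [collision_nonneg x]
  · intro x i j z hij h1 h2 h3 h4 h5 h6
    have h10 := fraction_add_le_one x hij
    have hz : 0 ≤ z := by
      by_contra hz
      have := fraction_nonneg x i
      linarith
    simp_rw [hstep]
    rw [← hr, expect_sq_lin_rule]
    -- The vertices holding i suffice: there are n α_i of them, with α_i of order z, and each has
    -- variance of order z.
    have hV : ∀ v, (if x v = i then 3 / 200 * z else 0 : ℝ) ≤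
        𝔼 u, (((if rule x v u = i then (1 : ℝ) else 0) - (if rule x v u = j then 1 else 0)) -
          𝔼 u', ((if rule x v u' = i then (1 : ℝ) else 0) -
            (if rule x v u' = j then 1 else 0))) ^ 2 := by
      intro v
      split_ifs with hv
      · rw [expect_sq_centered, hE (fun a => ((if a = i then (1 : ℝ) else 0) -
          if a = j then 1 else 0)) x v, hE (fun a => ((if a = i then (1 : ℝ) else 0) -
          if a = j then 1 else 0) ^ 2) x v]
        simp_rw [sq_ind_sub hij]
        simp only [hv, hij, if_true, if_false, add_mul, sub_mul, sum_add_distrib, sum_sub_distrib,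
          ite_mul, one_mul, zero_mul, sum_ite_eq', mem_univ]
        have hs : 26 / 100 + fraction x i ^ 2 ≤ 1 - collision x + fraction x i ^ 2 := by
          linarith
        have hγ : fraction x i ^ 2 + fraction x j ^ 2 ≤ collision x := by
          rw [← sum_pair (f := fun j => fraction x j ^ 2) hij]
          exact sum_le_sum_of_subset_of_nonneg (subset_univ _) fun a _ _ => sq_nonneg _
        -- A vertex of opinion i must have a real chance of being converted. If α_i² is not most of
        -- γ, the remainder of γ provides it; otherwise z is bounded below and α_j² alone is of
        -- order z.
        have hs1 : 6 / 100 * z ≤ collision x - fraction x i ^ 2 := by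
          by_cases hc : fraction x i ^ 2 ≤ collision x / 2
          · linarith
          · have h7 : fraction x i ^ 2 ≤ 4 * z ^ 2 := by
              have := fraction_nonneg x i
              nlinarith
            have h8 : 11 / 100 ≤ z := by nlinarith
            have h9 : 9 / 16 * z ^ 2 ≤ fraction x j ^ 2 := by nlinarith
            nlinarith
        set β := fraction x j ^ 2
        set a := fraction x i ^ 2
        have hβ : 0 ≤ β := sq_nonneg _
        have ha : 0 ≤ a := sq_nonneg _
        have hγ1 := collision_le_one x
        have hβ1 : β ≤ 1 := by linarith
        nlinarith [mul_nonneg hβ (sub_nonneg.2 hβ1), mul_nonneg ha hβ,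
          mul_le_mul_of_nonneg_right (show (26 : ℝ) / 100 ≤ 1 - collision x + a by linarith)
            (show 0 ≤ collision x - a by linarith)]
      · exact expect_nonneg fun u _ => sq_nonneg _
    have h11 := sum_le_sum fun v (_ : v ∈ univ) => hV v
    have h12 : ∑ v, (if x v = i then 3 / 200 * z else 0 : ℝ) = n * fraction x i * (3 / 200 * z) := by
      rw [← sum_filter, sum_const, nsmul_eq_mul, ← support, fraction]
      field_simp
    rw [h12] at h11
    refine le_trans ?_ (div_le_div_of_nonneg_right h11 (by positivity))
    have h13 : (n : ℝ) * fraction x i * (3 / 200 * z) / n ^ 2 = fraction x i * (3 / 200 * z) / n := by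
      field_simp
    have h14 : z * (2 * z) / (200 * n) = (z * (2 * z) / 200) / n := by rw [div_div]
    rw [h13, h14]
    refine div_le_div_of_nonneg_right ?_ hn.le
    nlinarith
  · intro x hx
    simp_rw [hstep]
    refine le_trans ?_ (collision_add_le_expect x (rule x) (hr x))
    have hγ := collision_nonneg x
    have hmax : ∀ j, fraction x j ≤ 1 / 4 := fun j => by
      have := sq_fraction_le_collision x j
      nlinarith [fraction_nonneg x j]
    have h1 : ∀ v, 2 * collision x - 2 * collision x ^ 2 - 2 * fraction x (x v) ^ 2 ≤
        1 - ∑ j, (𝔼 u, if rule x v u = j then (1 : ℝ) else 0) ^ 2 := by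
      intro v
      have h2 : ∀ j, 𝔼 u, (if rule x v u = j then (1 : ℝ) else 0) =
          fraction x j ^ 2 + (1 - collision x) * if x v = j then 1 else 0 := fun j => by
        rw [hE (fun a => if a = j then 1 else 0) x v]
        simp
      have h3 : ∀ j, (fraction x j ^ 2 + (1 - collision x) * if x v = j then 1 else 0) ^ 2 =
          fraction x j ^ 4 + if x v = j then 2 * (1 - collision x) * fraction x j ^ 2 +
            (1 - collision x) ^ 2 else 0 := by
        intro j; split_ifs <;> ring
      simp_rw [h2, h3]
      rw [sum_add_distrib, sum_ite_eq]
      simp only [mem_univ, if_true]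
      have := sum_fourth_le x
      nlinarith [sq_nonneg (fraction x (x v))]
    have h4 := sum_le_sum fun v (_ : v ∈ univ) => h1 v
    have h5 : ∑ v, fraction x (x v) ^ 2 ≤ n * (collision x / 4) := by
      have h6 := lin_eq_sum (fun j => fraction x j ^ 2) x
      rw [lin, div_eq_iff hn.ne'] at h6
      rw [h6, mul_comm]
      refine mul_le_mul_of_nonneg_left ?_ hn.le
      rw [collision, sum_div]
      refine sum_le_sum fun j _ => ?_
      have := mul_le_mul_of_nonneg_left (hmax j) (sq_nonneg (fraction x j))
      linarith
    rw [sum_sub_distrib, sum_const, card_univ, Fintype.card_fin, nsmul_eq_mul, ← mul_sum] at h4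
    have h7 : 1 ≤ n * collision x := by
      have := inv_le_collision x
      rwa [div_le_iff₀' hn] at this
    refine add_le_add le_rfl (div_le_div_of_nonneg_right (le_trans ?_ h4) (by positivity))
    nlinarith

section Alive

variable {n k : ℕ} [NeZero n]

lemma inv_le_fraction_apply (x : Config n k) (v : Fin n) : 1 / (n : ℝ) ≤ fraction x (x v) := by
  unfold fraction
  refine div_le_div_of_nonneg_right ?_ cast_pos_of_neZero.le
  have : 0 < support x (x v) := card_pos.2 ⟨v, by simp⟩
  exact_mod_cast this

lemma exists_alive_of_not_consensusOn {x : Config n k} {i : Fin k} (h : ¬ ConsensusOn x i) :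
    ∃ j, j ≠ i ∧ 1 / (n : ℝ) ≤ fraction x j := by
  unfold ConsensusOn at h
  push Not at h
  obtain ⟨v, hv⟩ := h
  exact ⟨x v, hv, inv_le_fraction_apply x v⟩

lemma exists_alive_pair_of_not_consensus {x : Config n k} (h : ¬ ∃ i, ConsensusOn x i) :
    ∃ i j, i ≠ j ∧ 1 / (n : ℝ) ≤ fraction x i ∧ 1 / (n : ℝ) ≤ fraction x j := by
  push Not at h
  obtain ⟨j, hj, hj'⟩ := exists_alive_of_not_consensusOn (h (x 0))
  exact ⟨x 0, j, hj.symm, inv_le_fraction_apply x 0, hj'⟩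

end Alive

/-! ### Exponential moments of fractions and of their differences. -/

namespace IsPluralityDynamics

variable {n k : ℕ} [NeZero n] {W : Type*} [Fintype W] [Nonempty W]
  {step : Config n k → W → Config n k} {noise : Config n k → Fin k → ℝ} {S : ℝ → ℝ} {d : ℝ}

lemma expect_exp_lin_le (h : IsPluralityDynamics step noise S d) (f : Fin k → ℝ)
    (hf : ∀ j, |f j| ≤ 1) (x : Config n k) {t : ℝ} (ht : |t| ≤ n / 2) :
    𝔼 w, Real.exp (t * lin f (step x w)) ≤
      Real.exp (t * mean f x + t ^ 2 / n * ∑ j, 2 * fraction x j * noise x j * f j ^ 2) := by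
  have h1 := h.expect_exp f x t hf ht
  rw [Real.exp_add]
  calc 𝔼 w, Real.exp (t * lin f (step x w))
      = Real.exp (t * mean f x) * 𝔼 w, Real.exp (t * (lin f (step x w) - mean f x)) := by
        rw [mul_expect]
        refine expect_congr rfl fun w _ => ?_
        rw [← Real.exp_add]; congr 1; ring
    _ ≤ _ := mul_le_mul_of_nonneg_left h1 (Real.exp_pos _).le

lemma expect_fraction (h : IsPluralityDynamics step noise S d) (x : Config n k) (i : Fin k) :
    𝔼 w, fraction (step x w) i = fraction x i * (1 + fraction x i - collision x) := by
  rw [← mean_single, ← h.expect_lin]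
  simp_rw [lin_single]

lemma abs_ind_le {i a : Fin k} : |(if a = i then (1 : ℝ) else 0)| ≤ 1 := by
  split_ifs <;> norm_num

lemma expect_exp_fraction_le (h : IsPluralityDynamics step noise S d) (x : Config n k) (i : Fin k)
    {t : ℝ} (ht : |t| ≤ n / 2) :
    𝔼 w, Real.exp (t * fraction (step x w) i) ≤
      Real.exp (t * (fraction x i * (1 + fraction x i - collision x)) +
        t ^ 2 / n * (2 * fraction x i * noise x i)) := by
  have h1 := h.expect_exp_lin_le (fun j => if j = i then 1 else 0) (fun j => abs_ind_le) x ht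
  simpa [lin_single, mean_single] using h1

lemma mean_ind_sub (x : Config n k) (i j : Fin k) :
    mean (fun a => (if a = i then 1 else 0) - (if a = j then 1 else 0)) x =
      (1 + (fraction x i + fraction x j - collision x)) * (fraction x i - fraction x j) := by
  rw [mean_sub, mean_single, mean_single]; ring

lemma sum_noise_ind_sub {i j : Fin k} (hij : i ≠ j) (s : Fin k → ℝ) :
    ∑ a, s a * ((if a = i then (1 : ℝ) else 0) - (if a = j then 1 else 0)) ^ 2 = s i + s j := by
  simp_rw [sq_ind_sub hij]
  simp [mul_add, sum_add_distrib]

lemma expect_exp_sub_le (h : IsPluralityDynamics step noise S d) (x : Config n k) {i j : Fin k}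
    (hij : i ≠ j) {t : ℝ} (ht : |t| ≤ n / 2) :
    𝔼 w, Real.exp (t * (fraction (step x w) i - fraction (step x w) j)) ≤
      Real.exp (t * ((1 + (fraction x i + fraction x j - collision x)) *
        (fraction x i - fraction x j)) +
        t ^ 2 / n * (2 * fraction x i * noise x i + 2 * fraction x j * noise x j)) := by
  have h1 := h.expect_exp_lin_le
    (fun a => (if a = i then 1 else 0) - (if a = j then 1 else 0)) (abs_ind_sub_le i j) x ht
  rw [sum_noise_ind_sub hij, mean_ind_sub] at h1
  simpa [lin_sub, lin_single] using h1

end IsPluralityDynamics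

/-! ### The inverse-square potential that breaks ties. -/

section InverseSquare

variable {W : Type*} [Fintype W] [Nonempty W]

lemma sq_add_fourth_le_exp (y : ℝ) :
    y ^ 2 / 2 + y ^ 4 / 24 ≤ Real.exp y + Real.exp (-y) - 2 := by
  have key : ∀ y : ℝ, 0 ≤ y → y ^ 2 / 2 + y ^ 4 / 24 ≤ Real.exp y + Real.exp (-y) - 2 := by
    intro y hy
    have h1 := Real.sum_le_exp_of_nonneg hy 5
    simp only [sum_range_succ, range_zero, sum_empty, Nat.factorial] at h1
    have h2 := Real.add_one_le_exp (-y)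
    have : 0 ≤ y ^ 3 := by positivity
    norm_num at h1
    linarith
  rcases le_total 0 y with hy | hy
  · exact key y hy
  · have := key (-y) (by linarith)
    rw [neg_neg] at this
    nlinarith

/-- Moment bounds from a bound on the moment generating function near zero. -/
lemma expect_moments_le {ξ : W → ℝ} {v N : ℝ} (hv : 0 < v) (hN : 0 < N)
    (h : ∀ t, |t| ≤ N / 2 → 𝔼 w, Real.exp (t * ξ w) ≤ Real.exp (t ^ 2 * v)) :
    𝔼 w, ξ w ^ 2 ≤ 8 * v ∧ 𝔼 w, ξ w ^ 4 ≤ 96 * v * (v + 4 / N ^ 2) := by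
  set q := v + 4 / N ^ 2 with hq
  have hq0 : 0 < q := by positivity
  -- The largest rate for which both t²v ≤ 1 and t ≤ N/2 are guaranteed.
  set t := √(1 / q) with ht
  have ht2 : t ^ 2 = 1 / q := Real.sq_sqrt (by positivity)
  have ht0 : 0 < t := Real.sqrt_pos.2 (by positivity)
  have htN : |t| ≤ N / 2 := by
    rw [abs_of_pos ht0]
    refine abs_le_of_sq_le_sq' ?_ (by positivity) |>.2
    rw [ht2, div_le_iff₀ hq0, hq]
    have : (N / 2) ^ 2 * (v + 4 / N ^ 2) = (N / 2) ^ 2 * v + 1 := by field_simp; ring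
    rw [this]
    have : 0 ≤ (N / 2) ^ 2 * v := by positivity
    linarith
  have htv : t ^ 2 * v ≤ 1 := by
    rw [ht2, one_div, inv_mul_le_iff₀ hq0, mul_one, hq]
    have : 0 ≤ 4 / N ^ 2 := by positivity
    linarith
  have htv0 : 0 ≤ t ^ 2 * v := by positivity
  have h1 := h t htN
  have h2 := h (-t) (by rwa [abs_neg])
  rw [neg_sq] at h2
  have h3 : Real.exp (t ^ 2 * v) - 1 ≤ 2 * (t ^ 2 * v) := by
    have := (abs_le.1 (Real.abs_exp_sub_one_sub_id_le (x := t ^ 2 * v)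
      (by rw [abs_of_nonneg htv0]; exact htv))).2
    nlinarith
  have h4 : 𝔼 w, (t ^ 2 / 2 * ξ w ^ 2 + t ^ 4 / 24 * ξ w ^ 4) ≤
      𝔼 w, (Real.exp (t * ξ w) + Real.exp (-t * ξ w) - 2) := by
    refine expect_le_expect fun w _ => ?_
    have := sq_add_fourth_le_exp (t * ξ w)
    rw [neg_mul]
    refine le_trans (le_of_eq ?_) this
    ring
  rw [expect_sub_distrib, expect_add_distrib, expect_add_distrib, Fintype.expect_const,
    ← mul_expect, ← mul_expect] at h4
  have h5 : t ^ 2 / 2 * 𝔼 w, ξ w ^ 2 + t ^ 4 / 24 * 𝔼 w, ξ w ^ 4 ≤ 4 * (t ^ 2 * v) := by linarith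
  have h6 : 0 ≤ 𝔼 w, ξ w ^ 2 := expect_nonneg fun w _ => sq_nonneg _
  have h7 : 0 ≤ 𝔼 w, ξ w ^ 4 := expect_nonneg fun w _ => by positivity
  have ht2' : 0 < t ^ 2 := by positivity
  constructor
  · have h8 : t ^ 2 * 𝔼 w, ξ w ^ 2 ≤ t ^ 2 * (8 * v) := by
      have : 0 ≤ t ^ 4 / 24 * 𝔼 w, ξ w ^ 4 := by positivity
      nlinarith
    exact le_of_mul_le_mul_left h8 ht2'
  · have h8 : t ^ 2 * (t ^ 2 * 𝔼 w, ξ w ^ 4) ≤ t ^ 2 * (96 * v) := by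
      have : 0 ≤ t ^ 2 / 2 * 𝔼 w, ξ w ^ 2 := by positivity
      nlinarith
    have h9 := le_of_mul_le_mul_left h8 ht2'
    rwa [ht2, one_div, inv_mul_le_iff₀ hq0, mul_comm q] at h9

/-- Put (m + ξ)² + b = B(1 + η). For η ≥ -1/2 a second-order expansion of 1/(1 + η) works. For η <
-1/2 the perturbation satisfies B² ≤ 256 ξ⁴, so the fourth-order term pays for the trivial bound
1/(1 + η) ≤ B/b. -/
lemma inv_sq_add_le {m ξ b : ℝ} (hb : 0 < b) :
    1 / ((m + ξ) ^ 2 + b) ≤ 1 / (m ^ 2 + b) * (1 - (2 * m * ξ + ξ ^ 2) / (m ^ 2 + b) +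
      16 * m ^ 2 * ξ ^ 2 / (m ^ 2 + b) ^ 2 + 260 * ξ ^ 4 / (b * (m ^ 2 + b))) := by
  set B := m ^ 2 + b with hB
  have hbB : b ≤ B := by rw [hB]; nlinarith [sq_nonneg m]
  have hB0 : 0 < B := hb.trans_le hbB
  set η := (2 * m * ξ + ξ ^ 2) / B with hη
  have hηB : η * B = 2 * m * ξ + ξ ^ 2 := by rw [hη]; field_simp
  have h1 : (m + ξ) ^ 2 + b = B * (1 + η) := by
    rw [mul_add, mul_comm B η, hηB, hB]; ring
  have h1' : b ≤ B * (1 + η) := by rw [← h1]; nlinarith [sq_nonneg (m + ξ)]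
  have hη1 : 0 < 1 + η := by
    by_contra hc
    nlinarith
  have h2 : 2 * η ^ 2 ≤ 16 * m ^ 2 * ξ ^ 2 / B ^ 2 + 4 * ξ ^ 4 / (b * B) := by
    have : 4 * ξ ^ 4 / B ^ 2 ≤ 4 * ξ ^ 4 / (b * B) := by
      refine div_le_div_of_nonneg_left (by positivity) (by positivity) ?_
      rw [sq]; exact mul_le_mul_of_nonneg_right hbB hB0.le
    have h3 : 2 * η ^ 2 ≤ (16 * m ^ 2 * ξ ^ 2 + 4 * ξ ^ 4) / B ^ 2 := by
      rw [hη, div_pow, ← mul_div_assoc]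
      refine div_le_div_of_nonneg_right ?_ (by positivity)
      nlinarith [sq_nonneg (2 * m * ξ - ξ ^ 2)]
    rw [add_div] at h3
    linarith
  have h3 : 1 / (1 + η) ≤ 1 - η + 2 * η ^ 2 + 256 * ξ ^ 4 / (b * B) := by
    by_cases hc : -1 / 2 ≤ η
    · have : 0 ≤ 256 * ξ ^ 4 / (b * B) := by positivity
      have h4 : 1 / (1 + η) ≤ 1 - η + 2 * η ^ 2 := by
        rw [div_le_iff₀ hη1]
        nlinarith [sq_nonneg η]
      linarith
    · push Not at hc
      have h4 : B ^ 2 ≤ 256 * ξ ^ 4 := by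
        have h5 : B / 2 < -(2 * m * ξ) - ξ ^ 2 := by nlinarith
        have h6 : m ^ 2 ≤ B := by rw [hB]; linarith
        have h7 : B ^ 2 / 4 ≤ 4 * m ^ 2 * ξ ^ 2 := by
          have : B / 2 ≤ -(2 * m * ξ) := by nlinarith [sq_nonneg ξ]
          nlinarith
        have h8 : B ≤ 16 * ξ ^ 2 := by
          have : B * (B - 16 * ξ ^ 2) ≤ 0 := by nlinarith [sq_nonneg ξ]
          by_contra hcc
          push Not at hcc
          nlinarith
        nlinarith [sq_nonneg ξ]
      have h5 : 1 / (1 + η) ≤ B / b := by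
        rw [div_le_div_iff₀ hη1 hb]; linarith
      have h6 : B / b ≤ 256 * ξ ^ 4 / (b * B) := by
        rw [div_le_div_iff₀ hb (by positivity)]
        nlinarith
      nlinarith [sq_nonneg η]
  have h4 : 1 / ((m + ξ) ^ 2 + b) = 1 / B * (1 / (1 + η)) := by
    rw [h1]; field_simp
  rw [h4]
  refine mul_le_mul_of_nonneg_left ?_ (by positivity)
  have h5 : 256 * ξ ^ 4 / (b * B) + 4 * ξ ^ 4 / (b * B) = 260 * ξ ^ 4 / (b * B) := by ring
  linarith

/-- A quantity that grows in expectation by a factor `1 + r` and has a variance comparable with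
`r b` moves away from `0`. -/
lemma expect_inv_sq_add_le {X' : W → ℝ} {X r b v N ρ : ℝ} (hb : 0 < b) (hv : 0 < v) (hN : 0 < N)
    (hr1 : r ≤ 1) (hρ : 0 ≤ ρ) (hrρ : 4 * ρ ≤ r)
    (hmean : 𝔼 w, X' w = (1 + r) * X)
    (hexp : ∀ t, |t| ≤ N / 2 →
      𝔼 w, Real.exp (t * (X' w - (1 + r) * X)) ≤ Real.exp (t ^ 2 * v))
    (hvar : ρ * b ≤ 𝔼 w, (X' w - (1 + r) * X) ^ 2)
    (h1 : 512 * v ≤ r * b)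
    (h2 : 49920 * v * (v + 4 / N ^ 2) ≤ b * 𝔼 w, (X' w - (1 + r) * X) ^ 2) :
    𝔼 w, 1 / (X' w ^ 2 + b) ≤ (1 - ρ / 2) * (1 / (X ^ 2 + b)) := by
  set m := (1 + r) * X with hm
  obtain ⟨hσ, h4⟩ := expect_moments_le hv hN hexp
  set σ := 𝔼 w, (X' w - m) ^ 2 with hσdef
  have hr0 : 0 ≤ r := by linarith
  set B := m ^ 2 + b with hB
  have hbB : b ≤ B := by rw [hB]; nlinarith [sq_nonneg m]
  have hB0 : 0 < B := hb.trans_le hbB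
  have hσ0 : 0 ≤ σ := expect_nonneg fun w _ => sq_nonneg _
  have h5 : 𝔼 w, 1 / (X' w ^ 2 + b) ≤ 1 / B * (1 - σ / B + 16 * m ^ 2 * σ / B ^ 2 +
      260 * (𝔼 w, (X' w - m) ^ 4) / (b * B)) := by
    have h6 : 𝔼 w, 1 / (X' w ^ 2 + b) ≤ 𝔼 w, 1 / B * (1 - (2 * m / B * (X' w - m) +
        1 / B * (X' w - m) ^ 2) + 16 * m ^ 2 / B ^ 2 * (X' w - m) ^ 2 +
        260 / (b * B) * (X' w - m) ^ 4) := by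
      refine expect_le_expect fun w _ => ?_
      have := inv_sq_add_le (m := m) (ξ := X' w - m) hb
      rw [add_sub_cancel] at this
      refine this.trans (le_of_eq ?_)
      rw [← hB]; ring
    refine h6.trans (le_of_eq ?_)
    rw [← mul_expect, expect_add_distrib, expect_add_distrib, expect_sub_distrib,
      expect_add_distrib, Fintype.expect_const, ← mul_expect, ← mul_expect, ← mul_expect,
      ← mul_expect, expect_sub_distrib, hmean, Fintype.expect_const, sub_self, ← hσdef]
    ring
  -- The two gains: `u` comes from the multiplicative growth and acts far from 0; `w` is half the
  -- gain from the variance and acts near 0, where the potential is concave. The second-order error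
  -- is absorbed by `u` and the fourth-order error by `w`.
  set u := r * X ^ 2 / B with hu
  set w := σ / (2 * B) with hw
  have hu0 : 0 ≤ u := by positivity
  have hw0 : 0 ≤ w := by positivity
  have hm2 : m ^ 2 ≤ 4 * X ^ 2 := by
    rw [hm, mul_pow]
    exact mul_le_mul_of_nonneg_right (by nlinarith) (sq_nonneg X)
  have h6 : 16 * m ^ 2 * σ / B ^ 2 ≤ u := by
    rw [hu, div_le_div_iff₀ (by positivity) hB0]
    have h7 : 16 * m ^ 2 * σ ≤ r * X ^ 2 * B := by
      calc 16 * m ^ 2 * σ ≤ 16 * (4 * X ^ 2) * (8 * v) := by gcongr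
        _ = X ^ 2 * (512 * v) := by ring
        _ ≤ X ^ 2 * (r * b) := mul_le_mul_of_nonneg_left h1 (sq_nonneg X)
        _ ≤ X ^ 2 * (r * B) := by gcongr
        _ = _ := by ring
    rw [pow_two B, ← mul_assoc]
    exact mul_le_mul_of_nonneg_right h7 hB0.le
  have h7 : 260 * (𝔼 w, (X' w - m) ^ 4) / (b * B) ≤ w := by
    rw [hw, div_le_div_iff₀ (by positivity) (by positivity)]
    have : 260 * (𝔼 w, (X' w - m) ^ 4) * 2 ≤ σ * b := by linarith
    have := mul_le_mul_of_nonneg_right this hB0.le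
    linarith
  have h8 : σ / B = 2 * w := by rw [hw]; field_simp
  have hw1 : w ≤ 1 / 4 := by
    have : r * b ≤ b := mul_le_of_le_one_left hb.le hr1
    rw [hw, div_le_iff₀ (by positivity)]
    linarith
  have h9 : 1 / B ≤ 1 / (X ^ 2 + b) * (1 - 2 * u) := by
    have : 1 - 2 * u = (B - 2 * r * X ^ 2) / B := by rw [hu]; field_simp
    rw [this, div_mul_div_comm, one_mul, div_le_div_iff₀ hB0 (by positivity), one_mul]
    have : X ^ 2 + b ≤ B - 2 * r * X ^ 2 := by
      have : 0 ≤ r ^ 2 * X ^ 2 := by positivity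
      rw [hB, hm, mul_pow]; linarith
    exact mul_le_mul_of_nonneg_right this hB0.le
  have h10 : ρ / 2 ≤ u / 2 + w := by
    have : u / 2 + w = (r * X ^ 2 + σ) / (2 * B) := by rw [hu, hw]; field_simp
    rw [this, le_div_iff₀ (by positivity)]
    have : B ≤ 4 * X ^ 2 + b := by rw [hB]; linarith
    have h11 := mul_le_mul_of_nonneg_right hrρ (sq_nonneg X)
    have h12 := mul_le_mul_of_nonneg_left this hρ
    linarith
  calc 𝔼 w, 1 / (X' w ^ 2 + b) ≤ 1 / B * (1 + u - w) := by
        refine h5.trans (mul_le_mul_of_nonneg_left ?_ (by positivity))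
        linarith
    _ ≤ 1 / (X ^ 2 + b) * (1 - 2 * u) * (1 + u - w) :=
        mul_le_mul_of_nonneg_right h9 (by linarith)
    _ = 1 / (X ^ 2 + b) * ((1 - 2 * u) * (1 + u - w)) := by ring
    _ ≤ 1 / (X ^ 2 + b) * (1 - ρ / 2) := by
        refine mul_le_mul_of_nonneg_left ?_ (by positivity)
        have h13 : u * w ≤ u * (1 / 4) := mul_le_mul_of_nonneg_left hw1 hu0
        have h14 := sq_nonneg u
        linarith
    _ = _ := mul_comm _ _

end InverseSquare

/-! ### Scales at which the drift beats the noise. -/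

/-- The scale `z` dominates the noise of `n` vertices. -/
structure IsLargeScale (n : ℕ) (S : ℝ → ℝ) (ℓ z : ℝ) : Prop where
  one_le : 1 ≤ ℓ
  exp_eq : Real.exp ℓ = n
  pos : 0 < z
  le_one : z ≤ 1
  threshold : 10 ^ 20 * ℓ ^ 3 * S z ≤ n * z ^ 2

namespace IsLargeScale

variable {n : ℕ} {S : ℝ → ℝ} {ℓ z : ℝ}

lemma cast_pos (H : IsLargeScale n S ℓ z) : (0 : ℝ) < n := H.exp_eq ▸ Real.exp_pos ℓ

lemma scale_pos (H : IsLargeScale n S ℓ z) (hS : IsNoiseScale S) : 0 < S z :=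
  H.pos.trans_le (hS.le z H.pos.le H.le_one)

lemma le_mul (H : IsLargeScale n S ℓ z) (hS : IsNoiseScale S) : 10 ^ 20 * ℓ ^ 3 ≤ n * z := by
  have h1 := hS.le z H.pos.le H.le_one
  have h2 := H.threshold
  have h3 : 0 ≤ 10 ^ 20 * ℓ ^ 3 := by have := H.one_le; positivity
  have h4 : 10 ^ 20 * ℓ ^ 3 * z ≤ n * z * z := by nlinarith
  exact le_of_mul_le_mul_right h4 H.pos

lemma le_mul' (H : IsLargeScale n S ℓ z) (hS : IsNoiseScale S) : 10 ^ 20 * ℓ ≤ n * z := by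
  refine le_trans ?_ (H.le_mul hS)
  have : ℓ ≤ ℓ ^ 3 := le_self_pow₀ H.one_le (by norm_num)
  linarith

lemma rate_le (H : IsLargeScale n S ℓ z) (hS : IsNoiseScale S) {a : ℝ} (ha : a ≤ 10 ^ 19) :
    a * ℓ / z ≤ n / 2 := by
  rw [div_le_div_iff₀ H.pos two_pos]
  have := H.le_mul' hS
  have := H.one_le
  nlinarith

/-- Testing at rate aℓ/z for a number T of rounds with Tz = O(ℓ) accumulates a variance term of
order ℓ³ S(z)/(n z²), which the threshold makes negligible against the gain of several ℓ. -/
lemma cost_le (H : IsLargeScale n S ℓ z) {q a T : ℝ} (hq : 0 ≤ q)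
    (hqa : q * a ^ 2 ≤ 10 ^ 6) (hT : T * z ≤ 2 * 10 ^ 13 * ℓ) (hS : 0 ≤ S z) :
    T * (q * (a * ℓ / z) ^ 2 * z * S z / n) ≤ ℓ := by
  have hz := H.pos
  have hn := H.cast_pos
  have hℓ := H.one_le
  have h1 : T * (q * (a * ℓ / z) ^ 2 * z * S z / n) =
      (q * a ^ 2) * (ℓ ^ 2 * (T * z) * S z) / (n * z ^ 2) := by field_simp
  rw [h1, div_le_iff₀ (by positivity)]
  calc (q * a ^ 2) * (ℓ ^ 2 * (T * z) * S z)
      ≤ (q * a ^ 2) * (ℓ ^ 2 * (2 * 10 ^ 13 * ℓ) * S z) := by gcongr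
    _ ≤ 10 ^ 6 * (ℓ ^ 2 * (2 * 10 ^ 13 * ℓ) * S z) :=
        mul_le_mul_of_nonneg_right hqa (by positivity)
    _ ≤ 10 ^ 20 * ℓ ^ 3 * S z := by
        have : 0 ≤ ℓ ^ 3 * S z := by positivity
        nlinarith
    _ ≤ n * z ^ 2 := H.threshold
    _ ≤ ℓ * (n * z ^ 2) := le_mul_of_one_le_left (by positivity) hℓ

lemma scale_le (H : IsLargeScale n S ℓ z) (hS : IsNoiseScale S) {c : ℝ} (hc : 1 ≤ c) :
    S (c * z) ≤ c * S z := hS.scale c z hc H.pos.le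

/-- Raising z by a factor c multiplies S(z) by at most c but z² by c². -/
lemma mono {z' : ℝ} (H : IsLargeScale n S ℓ z) (hS : IsNoiseScale S) (h : z ≤ z') (h1 : z' ≤ 1) :
    IsLargeScale n S ℓ z' := by
  have hz := H.pos
  have hℓ := H.one_le
  refine ⟨hℓ, H.exp_eq, hz.trans_le h, h1, ?_⟩
  have h2 : S z' ≤ z' / z * S z := by
    have := H.scale_le hS (c := z' / z) (by rwa [one_le_div hz])
    rwa [div_mul_cancel₀ _ hz.ne'] at this
  have h3 : 1 ≤ z' / z := by rwa [one_le_div hz]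
  have hS0 := (H.scale_pos hS).le
  calc 10 ^ 20 * ℓ ^ 3 * S z' ≤ 10 ^ 20 * ℓ ^ 3 * (z' / z * S z) := by gcongr
    _ = z' / z * (10 ^ 20 * ℓ ^ 3 * S z) := by ring
    _ ≤ z' / z * (n * z ^ 2) := mul_le_mul_of_nonneg_left H.threshold (by positivity)
    _ ≤ z' / z * (z' / z * (n * z ^ 2)) := by
        have : 0 ≤ z' / z * (n * z ^ 2) := by have := H.cast_pos; positivity
        nlinarith
    _ = n * z' ^ 2 := by field_simp

end IsLargeScale

/-! ### One epoch with γ near z: weak, strong and unresolved opinions. -/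

namespace IsPluralityDynamics

variable {n k : ℕ} [NeZero n] {W : Type*} [Fintype W] [Nonempty W]
  {step : Config n k → W → Config n k} {noise : Config n k → Fin k → ℝ} {S : ℝ → ℝ} {d ℓ z : ℝ}

/-- The configurations whose collision probability is close to `z`. -/
def Near (z : ℝ) (x : Config n k) : Prop := 9 / 10 * z ≤ collision x ∧ collision x ≤ 11 / 10 * z

lemma collision_le_mean (x : Config n k) : collision x ≤ mean (fraction x) x := by
  have h : mean (fraction x) x = collision x + (∑ j, fraction x j ^ 3 - collision x ^ 2) := by
    have : ∀ j, fraction x j * (fraction x j * (1 + fraction x j - collision x)) =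
        fraction x j ^ 2 + fraction x j ^ 3 - collision x * fraction x j ^ 2 := fun j => by ring
    unfold mean
    simp_rw [this]
    rw [sum_sub_distrib, sum_add_distrib, ← mul_sum, ← collision]
    ring
  rw [h]
  linarith [sq_collision_le x]

lemma expect_exp_neg_collision_le (h : IsPluralityDynamics step noise S d) (x : Config n k)
    {t : ℝ} (ht0 : 0 ≤ t) (ht : t ≤ n / 4) :
    𝔼 w, Real.exp (-t * collision (step x w)) ≤
      Real.exp (-t * collision x + 8 * t ^ 2 / n * (collision x * S (collision x))) := by
  have hn : (0 : ℝ) < n := cast_pos_of_neZero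
  have h1 := h.expect_exp_lin_le (fraction x)
    (fun j => by rw [abs_of_nonneg (fraction_nonneg x j)]; exact fraction_le_one x j) x
    (t := -(2 * t)) (by rw [abs_neg, abs_of_nonneg (by positivity)]; linarith)
  have h2 : ∀ w, Real.exp (-t * collision (step x w)) ≤
      Real.exp (t * collision x) * Real.exp (-(2 * t) * lin (fraction x) (step x w)) := by
    intro w
    rw [← Real.exp_add]
    refine Real.exp_le_exp.2 ?_
    have := mul_le_mul_of_nonneg_left (collision_sub_ge x (step x w)) ht0
    linarith
  refine (expect_le_expect fun w _ => h2 w).trans ?_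
  rw [← mul_expect]
  refine (mul_le_mul_of_nonneg_left h1 (Real.exp_pos _).le).trans ?_
  rw [← Real.exp_add]
  refine Real.exp_le_exp.2 ?_
  have h3 := mul_le_mul_of_nonneg_left (collision_le_mean x) ht0
  have h4 : ∑ j, 2 * fraction x j * noise x j * fraction x j ^ 2 =
      2 * ∑ j, fraction x j * noise x j * fraction x j ^ 2 := by
    rw [mul_sum]; exact sum_congr rfl fun j _ => by ring
  have h5 := h.noise_cube x
  have h6 : (-(2 * t)) ^ 2 / n * ∑ j, 2 * fraction x j * noise x j * fraction x j ^ 2 ≤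
      8 * t ^ 2 / n * (collision x * S (collision x)) := by
    rw [h4]
    have : (-(2 * t)) ^ 2 / n * (2 * ∑ j, fraction x j * noise x j * fraction x j ^ 2) =
      8 * t ^ 2 / n * ∑ j, fraction x j * noise x j * fraction x j ^ 2 := by ring
    rw [this]
    exact mul_le_mul_of_nonneg_left h5 (by positivity)
  linarith

lemma exitProb_collision_lt_le (h : IsPluralityDynamics step noise S d) (hS : IsNoiseScale S)
    (H : IsLargeScale n S ℓ z) {x : Config n k} (hx : z ≤ collision x) {T : ℕ}
    (hT : T * z ≤ 2 * 10 ^ 13 * ℓ) :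
    exitProb step (Near z) (fun y => collision y < 9 / 10 * z) T x ≤ Real.exp (-(6 * ℓ)) := by
  have hn := H.cast_pos
  have hz := H.pos
  have hS0 := H.scale_pos hS
  have hℓ := H.one_le
  -- The gap z/10 is worth 7ℓ at this rate; the accumulated noise costs at most ℓ.
  set t := 70 * ℓ / z with ht
  have ht0 : 0 ≤ t := by positivity
  set c := 10 * t ^ 2 * z * S z / n with hc
  have hc0 : 0 ≤ c := by positivity
  have key := exitProb_le_of_supersolution (step := step) (D := Near z)
    (B := fun y => collision y < 9 / 10 * z) (T := T)
    (F := fun s y => Real.exp (t * (9 / 10 * z) + s * c) * Real.exp (-t * collision y))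
    (fun s y => by positivity) ?_ ?_ T le_rfl x
  · refine key.trans ?_
    rw [← Real.exp_add]
    refine Real.exp_le_exp.2 ?_
    have h1 : T * c ≤ ℓ := H.cost_le (by norm_num) (by norm_num) hT hS0.le
    have h2 : t * z = 70 * ℓ := by rw [ht]; field_simp
    have h3 := mul_le_mul_of_nonneg_left hx ht0
    linarith
  · intro s _ y _ hy
    rw [← Real.exp_add]
    refine Real.one_le_exp ?_
    have : 0 ≤ s * c := by positivity
    nlinarith
  · rintro s _ y ⟨hy1, hy2⟩
    rw [← mul_expect]
    have ht4 : t ≤ n / 4 := by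
      have := H.rate_le hS (a := 140) (by norm_num)
      have h2 : 140 * ℓ / z = 2 * t := by rw [ht]; ring
      linarith
    refine (mul_le_mul_of_nonneg_left (h.expect_exp_neg_collision_le y ht0 ht4)
      (Real.exp_pos _).le).trans ?_
    rw [← Real.exp_add, ← Real.exp_add]
    refine Real.exp_le_exp.2 ?_
    have h3 : S (collision y) ≤ 11 / 10 * S z :=
      (hS.mono _ _ (collision_nonneg y) hy2).trans (H.scale_le hS (by norm_num))
    have h4 : collision y * S (collision y) ≤ (11 / 10 * z) * (11 / 10 * S z) := by
      have := collision_nonneg y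
      have := this.trans (hS.le _ this (collision_le_one y))
      gcongr
    have h5 : 8 * t ^ 2 / n * (collision y * S (collision y)) ≤ c := by
      calc 8 * t ^ 2 / n * (collision y * S (collision y))
          ≤ 8 * t ^ 2 / n * ((11 / 10 * z) * (11 / 10 * S z)) :=
            mul_le_mul_of_nonneg_left h4 (by positivity)
        _ = 968 / 1000 * c := by rw [hc]; ring
        _ ≤ c := by linarith
    push_cast
    linarith

lemma noise_le_of_le (h : IsPluralityDynamics step noise S d) (hS : IsNoiseScale S)
    (H : IsLargeScale n S ℓ z) {x : Config n k} {i : Fin k} {c : ℝ} (hc : 1 ≤ c)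
    (h1 : fraction x i ≤ c * z) (h2 : collision x ≤ c * z) : noise x i ≤ c * S z :=
  (h.noise_le x i _ h1 h2).trans (H.scale_le hS hc)

/-- Below 85z/100 an opinion is smaller than γ ≥ 9z/10 by z/20, so its expectation contracts by 1 -
z/20 per round, and leaving this range requires climbing z/10 without upward drift. A living opinion
has n α_i ≥ 1, so Markov's inequality finishes. -/
lemma surv_alive_le_of_weak (h : IsPluralityDynamics step noise S d) (hS : IsNoiseScale S)
    (H : IsLargeScale n S ℓ z) {x : Config n k} {i : Fin k} (hx : fraction x i ≤ 3 / 4 * z)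
    {m : ℕ} (hm1 : 140 * ℓ ≤ m * z) (hm2 : m * z ≤ 2 * 10 ^ 13 * ℓ) :
    surv step (Near z) (fun y => if 1 / (n : ℝ) ≤ fraction y i then 1 else 0) m x ≤
      2 * Real.exp (-(6 * ℓ)) := by
  have hn := H.cast_pos
  have hz := H.pos
  have hz1 := H.le_one
  have hS0 := H.scale_pos hS
  have hℓ := H.one_le
  refine (surv_le_restrict (fun y => fraction y i ≤ 85 / 100 * z)
    (fun y => by split_ifs <;> norm_num) m x).trans ?_
  rw [two_mul]
  refine add_le_add ?_ ?_
  · have key := surv_le_of_supersolution (step := step)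
      (D := fun y => Near z y ∧ fraction y i ≤ 85 / 100 * z)
      (f := fun y => if 1 / (n : ℝ) ≤ fraction y i then 1 else 0) (T := m)
      (F := fun s y => (1 - z / 20) ^ s * (n * fraction y i))
      (fun s y => mul_nonneg (pow_nonneg (by linarith) _)
        (mul_nonneg hn.le (fraction_nonneg y i))) ?_ ?_ m le_rfl x
    · refine key.trans ?_
      have h1 : (1 - z / 20) ^ m ≤ Real.exp (-(7 * ℓ)) := by
        calc (1 - z / 20) ^ m ≤ Real.exp (-(z / 20)) ^ m := by
              refine pow_le_pow_left₀ (by linarith) ?_ m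
              have := Real.add_one_le_exp (-(z / 20))
              linarith
          _ = Real.exp (-(m * z / 20)) := by rw [← Real.exp_nat_mul]; congr 1; ring
          _ ≤ _ := Real.exp_le_exp.2 (by linarith)
      calc (1 - z / 20) ^ m * (n * fraction x i) ≤ Real.exp (-(7 * ℓ)) * (n * 1) := by
            have := fraction_nonneg x i
            have := fraction_le_one x i
            gcongr
        _ = Real.exp (-(6 * ℓ)) := by
            rw [mul_one, ← H.exp_eq, ← Real.exp_add]; congr 1; ring
    · intro y _
      split_ifs with hy
      · rw [div_le_iff₀' hn] at hy
        simpa using hy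
      · have := fraction_nonneg y i
        positivity
    · rintro s _ y ⟨⟨hy1, hy2⟩, hy3⟩
      simp_rw [← mul_expect]
      rw [h.expect_fraction, pow_succ, mul_assoc]
      refine mul_le_mul_of_nonneg_left ?_ (pow_nonneg (by linarith) _)
      have h1 : fraction y i * (1 + fraction y i - collision y) ≤
          fraction y i * (1 - z / 20) :=
        mul_le_mul_of_nonneg_left (by linarith) (fraction_nonneg y i)
      calc n * (fraction y i * (1 + fraction y i - collision y))
          ≤ n * (fraction y i * (1 - z / 20)) := mul_le_mul_of_nonneg_left h1 hn.le
        _ = _ := by ring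
  · set t := 70 * ℓ / z with ht
    have ht0 : 0 ≤ t := by positivity
    set c := 3 * t ^ 2 * z * S z / n with hc
    have hc0 : 0 ≤ c := by positivity
    have key := exitProb_le_of_supersolution (step := step)
      (D := fun y => Near z y ∧ fraction y i ≤ 85 / 100 * z)
      (B := fun y => ¬ fraction y i ≤ 85 / 100 * z) (T := m)
      (F := fun s y => Real.exp (-(t * (85 / 100 * z)) + s * c) * Real.exp (t * fraction y i))
      (fun s y => by positivity) ?_ ?_ m le_rfl x
    · refine key.trans ?_
      rw [← Real.exp_add]
      refine Real.exp_le_exp.2 ?_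
      have h1 : m * c ≤ ℓ := H.cost_le (by norm_num) (by norm_num) hm2 hS0.le
      have h2 : t * z = 70 * ℓ := by rw [ht]; field_simp
      have h3 := mul_le_mul_of_nonneg_left hx ht0
      linarith
    · intro s _ y _ hy
      rw [← Real.exp_add]
      refine Real.one_le_exp ?_
      have : 0 ≤ s * c := by positivity
      push Not at hy
      nlinarith
    · rintro s _ y ⟨⟨hy1, hy2⟩, hy3⟩
      rw [← mul_expect]
      refine (mul_le_mul_of_nonneg_left (h.expect_exp_fraction_le y i (t := t)
        (by rw [abs_of_nonneg ht0]; exact H.rate_le hS (by norm_num))) (Real.exp_pos _).le).trans ?_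
      rw [← Real.exp_add, ← Real.exp_add]
      refine Real.exp_le_exp.2 ?_
      have h3 := h.noise_le_of_le hS H (x := y) (i := i) (c := 11 / 10) (by norm_num)
        (by linarith) hy2
      have h0 := fraction_nonneg y i
      have h4 : 2 * fraction y i * noise y i ≤ 2 * (85 / 100 * z) * (11 / 10 * S z) := by
        have := h.noise_nonneg y i
        gcongr
      have h5 : t ^ 2 / n * (2 * fraction y i * noise y i) ≤ c := by
        calc t ^ 2 / n * (2 * fraction y i * noise y i)
            ≤ t ^ 2 / n * (2 * (85 / 100 * z) * (11 / 10 * S z)) :=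
              mul_le_mul_of_nonneg_left h4 (by positivity)
          _ = 187 / 300 * c := by rw [hc]; ring
          _ ≤ c := by linarith
      have h6 : fraction y i * (1 + fraction y i - collision y) ≤ fraction y i := by
        nlinarith
      have h7 := mul_le_mul_of_nonneg_left h6 ht0
      push_cast
      linarith

end IsPluralityDynamics

namespace IsPluralityDynamics

variable {n k : ℕ} [NeZero n] {W : Type*} [Fintype W] [Nonempty W]
  {step : Config n k → W → Config n k} {noise : Config n k → Fin k → ℝ} {S : ℝ → ℝ} {d ℓ z : ℝ}

/-- The noise is measured at the opinion's own scale a = α_i: there S(a) ≤ (a/z) S(z), so the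
variance term is proportional to a² and is absorbed by the drift a(a - γ). -/
lemma expect_exp_neg_fraction_le (h : IsPluralityDynamics step noise S d) (hS : IsNoiseScale S)
    (H : IsLargeScale n S ℓ z) {y : Config n k} {i : Fin k} (hy : collision y ≤ 11 / 10 * z)
    (hi : 3 / 2 * z ≤ fraction y i) {t : ℝ} (ht0 : 0 ≤ t) (ht : t ≤ 14 * ℓ / z) :
    𝔼 w, Real.exp (-t * fraction (step y w) i) ≤
      Real.exp (-t * ((1 + z / 5) * fraction y i)) := by
  have hn := H.cast_pos
  have hz := H.pos
  have hS0 := H.scale_pos hS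
  have hℓ := H.one_le
  refine (h.expect_exp_fraction_le y i (t := -t)
    (by rw [abs_neg, abs_of_nonneg ht0]
        exact ht.trans (H.rate_le hS (by norm_num)))).trans ?_
  refine Real.exp_le_exp.2 ?_
  set a := fraction y i with ha
  have ha0 : 0 < a := by linarith
  have h1 : noise y i ≤ a / z * S z := by
    have h2 : 1 ≤ a / z := by rw [one_le_div hz]; linarith
    refine h.noise_le_of_le hS H h2 ?_ ?_
    · rw [div_mul_cancel₀ _ hz.ne']
    · rw [div_mul_cancel₀ _ hz.ne']; linarith
  have h3 : t * (2 * S z / (n * z)) ≤ 2 / 15 := by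
    calc t * (2 * S z / (n * z)) ≤ 14 * ℓ / z * (2 * S z / (n * z)) :=
          mul_le_mul_of_nonneg_right ht (by positivity)
      _ = 28 * ℓ * S z / (n * z ^ 2) := by field_simp; ring
      _ ≤ 2 / 15 := by
          rw [div_le_iff₀ (by positivity)]
          have h4 := H.threshold
          have h5 : ℓ * S z ≤ ℓ ^ 3 * S z :=
            mul_le_mul_of_nonneg_right (le_self_pow₀ hℓ (by norm_num)) hS0.le
          have h6 : 0 ≤ ℓ * S z := by positivity
          linarith
  have h4 : t ^ 2 / n * (2 * a * noise y i) ≤ t * (2 / 15 * a ^ 2) := by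
    calc t ^ 2 / n * (2 * a * noise y i) ≤ t ^ 2 / n * (2 * a * (a / z * S z)) := by gcongr
      _ = t * a ^ 2 * (t * (2 * S z / (n * z))) := by field_simp
      _ ≤ t * a ^ 2 * (2 / 15) := mul_le_mul_of_nonneg_left h3 (by positivity)
      _ = _ := by ring
  have h5 : (1 + z / 5) * a + 2 / 15 * a ^ 2 ≤ a * (1 + a - collision y) := by nlinarith
  have h6 := mul_le_mul_of_nonneg_left h5 ht0
  rw [neg_sq]
  linarith

/-- An opinion well above γ grows by 1 + z/5 per round and so cannot remain at most 1 for 30ℓ/z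
rounds; survival in the window is therefore unlikely. Falling from 2z to 3z/2 first costs 7ℓ in the
exponent. -/
lemma surv_le_of_strong (h : IsPluralityDynamics step noise S d) (hS : IsNoiseScale S)
    (H : IsLargeScale n S ℓ z) (hn14 : 14 ≤ n) {x : Config n k} {i : Fin k}
    (hx : 2 * z ≤ fraction x i) {m : ℕ} (hm : 30 * ℓ ≤ m * z) :
    surv step (Near z) (fun _ => 1) m x ≤ 2 * Real.exp (-(6 * ℓ)) := by
  have hn := H.cast_pos
  have hz := H.pos
  have hz1 := H.le_one
  have hS0 := H.scale_pos hS
  have hℓ := H.one_le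
  set t := 14 * ℓ / z with ht
  have ht0 : 0 < t := by positivity
  have htz : t * z = 14 * ℓ := by rw [ht]; field_simp
  refine (surv_le_restrict (fun y => 3 / 2 * z ≤ fraction y i) (fun y => le_rfl) m x).trans ?_
  rw [two_mul]
  refine add_le_add ?_ ?_
  · set ρ := 1 + z / 5 with hρ
    have hρ1 : 1 ≤ ρ := by rw [hρ]; linarith
    have hρ0 : 0 < ρ := by linarith
    -- The rate with `s` rounds to go is μρ^s: it starts at `t`, where the fraction is at least 2z,
    -- and ends at μ ≤ 1, where the test function is trivially of order one.
    set μ := t / ρ ^ m with hμ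
    have hμ0 : 0 ≤ μ := by positivity
    have hμ1 : μ ≤ 1 := by
      rw [hμ, div_le_one (by positivity)]
      have h1 : Real.exp (z / 10) ≤ ρ := by
        have := (abs_le.1 (Real.abs_exp_sub_one_sub_id_le (x := z / 10)
          (by rw [abs_of_nonneg (by positivity)]; linarith))).2
        rw [hρ]; nlinarith
      have h2 : Real.exp (3 * ℓ) ≤ ρ ^ m := by
        calc Real.exp (3 * ℓ) ≤ Real.exp (m * (z / 10)) := Real.exp_le_exp.2 (by linarith)
          _ = Real.exp (z / 10) ^ m := by rw [Real.exp_nat_mul]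
          _ ≤ ρ ^ m := pow_le_pow_left₀ (Real.exp_pos _).le h1 m
      refine le_trans ?_ h2
      have h3 : Real.exp (3 * ℓ) = (n : ℝ) ^ 3 := by
        rw [← H.exp_eq, ← Real.exp_nat_mul]; norm_num
      have hln : ℓ ≤ n := by rw [← H.exp_eq]; linarith [Real.add_one_le_exp ℓ]
      have h14 : (14 : ℝ) ≤ n := by exact_mod_cast hn14
      rw [h3, ht, div_le_iff₀ hz]
      have h4 : 1 ≤ n * z := by have := H.le_mul' hS; linarith
      have h5 : 14 * ℓ ≤ (n : ℝ) * n := by nlinarith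
      calc 14 * ℓ ≤ (n : ℝ) * n * 1 := by linarith
        _ ≤ (n : ℝ) * n * (n * z) := mul_le_mul_of_nonneg_left h4 (by positivity)
        _ = _ := by ring
    have key := surv_le_of_supersolution (step := step)
      (D := fun y => Near z y ∧ 3 / 2 * z ≤ fraction y i) (f := fun _ => 1) (T := m)
      (F := fun s y => Real.exp μ * Real.exp (-(μ * ρ ^ s) * fraction y i))
      (fun s y => by positivity) ?_ ?_ m le_rfl x
    · refine key.trans ?_
      rw [← Real.exp_add]
      refine Real.exp_le_exp.2 ?_
      have h1 : μ * ρ ^ m = t := by rw [hμ]; field_simp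
      rw [h1]
      nlinarith
    · intro y _
      rw [← Real.exp_add]
      refine Real.one_le_exp ?_
      have := mul_le_mul_of_nonneg_left (fraction_le_one y i) hμ0
      simp only [pow_zero, mul_one]
      linarith
    · rintro s hs y ⟨⟨hy1, hy2⟩, hy3⟩
      rw [← mul_expect]
      refine mul_le_mul_of_nonneg_left ((h.expect_exp_neg_fraction_le hS H hy2 hy3
        (by positivity) ?_).trans (le_of_eq ?_)) (Real.exp_pos _).le
      · rw [hμ, div_mul_eq_mul_div, div_le_iff₀ (by positivity)]
        exact mul_le_mul_of_nonneg_left (pow_le_pow_right₀ hρ1 hs.le) ht0.le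
      · congr 1; rw [pow_succ]; ring
  · have key := exitProb_le_of_supersolution (step := step)
      (D := fun y => Near z y ∧ 3 / 2 * z ≤ fraction y i)
      (B := fun y => ¬ 3 / 2 * z ≤ fraction y i) (T := m)
      (F := fun _ y => Real.exp (t * (3 / 2 * z)) * Real.exp (-t * fraction y i))
      (fun s y => by positivity) ?_ ?_ m le_rfl x
    · refine key.trans ?_
      rw [← Real.exp_add]
      exact Real.exp_le_exp.2 (by nlinarith)
    · intro s _ y _ hy
      rw [← Real.exp_add]
      push Not at hy
      exact Real.one_le_exp (by nlinarith)
    · rintro s hs y ⟨⟨hy1, hy2⟩, hy3⟩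
      rw [← mul_expect]
      refine mul_le_mul_of_nonneg_left ((h.expect_exp_neg_fraction_le hS H hy2 hy3
        ht0.le le_rfl).trans (Real.exp_le_exp.2 ?_)) (Real.exp_pos _).le
      have h1 : 0 ≤ z / 5 * fraction y i := mul_nonneg (by positivity) (fraction_nonneg y i)
      nlinarith

/-- One of the opinions `i`, `j` is much weaker or much stronger than `z`. -/
def Resolved (z : ℝ) (i j : Fin k) (x : Config n k) : Prop :=
  (fraction x i ≤ 3 / 4 * z ∨ 2 * z ≤ fraction x i) ∨
    (fraction x j ≤ 3 / 4 * z ∨ 2 * z ≤ fraction x j)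

lemma expect_inv_sq_sub_le (h : IsPluralityDynamics step noise S d) (hS : IsNoiseScale S)
    (H : IsLargeScale n S ℓ z) {x : Config n k} {i j : Fin k} (hij : i ≠ j) (hx : Near z x)
    (hR : ¬ Resolved z i j x) :
    𝔼 w, 1 / ((fraction (step x w) i - fraction (step x w) j) ^ 2 + 3 * 10 ^ 9 * S z / n) ≤
      (1 - z / (12 * 10 ^ 11)) *
        (1 / ((fraction x i - fraction x j) ^ 2 + 3 * 10 ^ 9 * S z / n)) := by
  have hn := H.cast_pos
  have hz := H.pos
  have hz1 := H.le_one
  have hS0 := H.scale_pos hS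
  have hℓ := H.one_le
  unfold Resolved at hR
  push Not at hR
  obtain ⟨⟨hi1, hi2⟩, hj1, hj2⟩ := hR
  obtain ⟨hx1, hx2⟩ := hx
  have hsum := fraction_add_le_one x hij
  set r := fraction x i + fraction x j - collision x with hr
  have hri : 4 / 10 * z ≤ r := by rw [hr]; linarith
  have hsi := h.noise_le_of_le hS H (x := x) (i := i) (c := 2) (by norm_num) hi2.le (by linarith)
  have hsj := h.noise_le_of_le hS H (x := x) (i := j) (c := 2) (by norm_num) hj2.le (by linarith)
  have hnoise : 2 * fraction x i * noise x i + 2 * fraction x j * noise x j ≤ 16 * z * S z := by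
    have h1 : fraction x i * noise x i ≤ (2 * z) * (2 * S z) :=
      mul_le_mul hi2.le hsi (h.noise_nonneg x i) (by positivity)
    have h2 : fraction x j * noise x j ≤ (2 * z) * (2 * S z) :=
      mul_le_mul hj2.le hsj (h.noise_nonneg x j) (by positivity)
    linarith
  have hv := h.variance_ge x i j z hij hi1.le hi2.le hj1.le hj2.le hx1 hx2
  rw [mean_ind_sub, ← hr] at hv
  simp only [lin_sub, lin_single] at hv
  -- `b` has the order S(z)/n, the one-round variance divided by the growth rate z; its constant is
  -- large enough for the fourth-moment condition. `ρ` is then the value for which ρb equals the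
  -- variance bound zS(z)/(200n).
  have key := expect_inv_sq_add_le
    (X' := fun w => fraction (step x w) i - fraction (step x w) j)
    (X := fraction x i - fraction x j) (r := r) (b := 3 * 10 ^ 9 * S z / n)
    (v := 16 * z * S z / n) (N := n) (ρ := z / (6 * 10 ^ 11)) (by positivity) (by positivity) hn
    (by rw [hr]; linarith [collision_nonneg x]) (by positivity) (by linarith)
    (by rw [expect_sub_distrib, h.expect_fraction, h.expect_fraction]; ring) ?_ ?_ ?_ ?_
  · refine key.trans (le_of_eq ?_)
    congr 1
    ring
  · intro t ht
    have h1 := h.expect_exp_sub_le x hij ht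
    rw [← hr] at h1
    have h2 : 𝔼 w, Real.exp (t * (fraction (step x w) i - fraction (step x w) j -
        (1 + r) * (fraction x i - fraction x j))) =
        Real.exp (-(t * ((1 + r) * (fraction x i - fraction x j)))) *
          𝔼 w, Real.exp (t * (fraction (step x w) i - fraction (step x w) j)) := by
      rw [mul_expect]
      refine expect_congr rfl fun w _ => ?_
      rw [← Real.exp_add]; congr 1; ring
    rw [h2]
    refine (mul_le_mul_of_nonneg_left h1 (Real.exp_pos _).le).trans ?_
    rw [← Real.exp_add]
    refine Real.exp_le_exp.2 ?_
    have h3 : t ^ 2 / n * (2 * fraction x i * noise x i + 2 * fraction x j * noise x j) ≤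
        t ^ 2 / n * (16 * z * S z) := mul_le_mul_of_nonneg_left hnoise (by positivity)
    have h4 : t ^ 2 * (16 * z * S z / n) = t ^ 2 / n * (16 * z * S z) := by ring
    rw [h4]
    linarith
  · refine le_trans (le_of_eq ?_) hv
    field_simp
    norm_num
  · calc 512 * (16 * z * S z / n) ≤ (4 / 10 * z) * (3 * 10 ^ 9 * S z / n) := by
          have : 0 ≤ z * S z / n := by positivity
          have h2 : 512 * (16 * z * S z / n) = 8192 * (z * S z / n) := by ring
          have h3 : (4 / 10 * z) * (3 * 10 ^ 9 * S z / n) = 12 * 10 ^ 8 * (z * S z / n) := by ring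
          rw [h2, h3]; linarith
      _ ≤ r * (3 * 10 ^ 9 * S z / n) := mul_le_mul_of_nonneg_right hri (by positivity)
  · have h4 : 4 / (n : ℝ) ^ 2 ≤ S z / n := by
      rw [div_le_div_iff₀ (by positivity) hn]
      have h5 : 4 ≤ n * S z := by
        have h6 := H.le_mul' hS
        have h7 := hS.le z hz.le hz1
        nlinarith
      nlinarith
    have h5 : 16 * z * S z / n ≤ 16 * (S z / n) := by
      have : 0 ≤ S z / n := by positivity
      have h6 : 16 * z * S z / n = 16 * (z * (S z / n)) := by ring
      rw [h6]
      nlinarith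
    calc 49920 * (16 * z * S z / n) * (16 * z * S z / n + 4 / n ^ 2)
        ≤ 49920 * (16 * z * S z / n) * (17 * (S z / n)) :=
          mul_le_mul_of_nonneg_left (by linarith) (by positivity)
      _ = 13578240 * (z * (S z / n) ^ 2) := by ring
      _ ≤ 15000000 * (z * (S z / n) ^ 2) := by
          have : 0 ≤ z * (S z / n) ^ 2 := by positivity
          linarith
      _ = 3 * 10 ^ 9 * S z / n * (z * S z / (200 * n)) := by field_simp; norm_num
      _ ≤ _ := mul_le_mul_of_nonneg_left hv (by positivity)

/-- The potential contracts by a factor 1 - Θ(z). Scaled by 1 + b it is at least 1 in every state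
and initially at most 2n² ≤ e^(4ℓ), so the decay e^(-10ℓ) bounds survival. -/
lemma surv_unresolved_le (h : IsPluralityDynamics step noise S d) (hS : IsNoiseScale S)
    (H : IsLargeScale n S ℓ z) {i j : Fin k} (hij : i ≠ j) {T : ℕ}
    (hT : 12 * 10 ^ 12 * ℓ ≤ T * z) (x : Config n k) :
    surv step (fun y => Near z y ∧ ¬ Resolved z i j y) (fun _ => 1) T x ≤
      Real.exp (-(6 * ℓ)) := by
  have hn := H.cast_pos
  have hz := H.pos
  have hz1 := H.le_one
  have hS0 := H.scale_pos hS
  have hℓ := H.one_le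
  set b := 3 * 10 ^ 9 * S z / n with hb
  have hb0 : 0 < b := by positivity
  set q := 1 - z / (12 * 10 ^ 11) with hq
  have hq0 : 0 ≤ q := by rw [hq]; linarith
  have key := surv_le_of_supersolution (step := step)
    (D := fun y => Near z y ∧ ¬ Resolved z i j y) (f := fun _ => 1) (T := T)
    (F := fun s y => q ^ s * ((1 + b) * (1 / ((fraction y i - fraction y j) ^ 2 + b))))
    (fun s y => by positivity) ?_ ?_ T le_rfl x
  · refine key.trans ?_
    have h1 : q ^ T ≤ Real.exp (-(10 * ℓ)) := by
      calc q ^ T ≤ Real.exp (-(z / (12 * 10 ^ 11))) ^ T := by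
            refine pow_le_pow_left₀ hq0 ?_ T
            have := Real.add_one_le_exp (-(z / (12 * 10 ^ 11)))
            rw [hq]; linarith
        _ = Real.exp (-(T * z / (12 * 10 ^ 11))) := by
            rw [← Real.exp_nat_mul]; congr 1; ring
        _ ≤ _ := Real.exp_le_exp.2 (by linarith)
    have h2 : (1 + b) * (1 / ((fraction x i - fraction x j) ^ 2 + b)) ≤ 2 * n ^ 2 := by
      have h3 : 1 / b ≤ n ^ 2 := by
        rw [div_le_iff₀ hb0, hb]
        have h4 : 1 ≤ n * z := by have := H.le_mul' hS; linarith
        have h5 := hS.le z hz.le hz1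
        have h6 : (n : ℝ) ^ 2 * (3 * 10 ^ 9 * S z / n) = 3 * 10 ^ 9 * (n * S z) := by field_simp
        have h7 : n * z ≤ n * S z := mul_le_mul_of_nonneg_left h5 hn.le
        rw [h6]; linarith
      have h4 : 1 / ((fraction x i - fraction x j) ^ 2 + b) ≤ 1 / b :=
        one_div_le_one_div_of_le hb0 (by nlinarith [sq_nonneg (fraction x i - fraction x j)])
      have h5 : (1 + b) * (1 / b) = 1 / b + 1 := by field_simp
      have h6 : (1 : ℝ) ≤ n ^ 2 := one_le_pow₀ one_le_cast_of_neZero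
      have h7 := mul_le_mul_of_nonneg_left h4 (show 0 ≤ 1 + b by positivity)
      linarith
    have h3 : (2 : ℝ) * n ^ 2 ≤ Real.exp (4 * ℓ) := by
      have h4 : (n : ℝ) ^ 2 = Real.exp (2 * ℓ) := by
        rw [← H.exp_eq, ← Real.exp_nat_mul]; norm_num
      have h5 : (2 : ℝ) ≤ Real.exp (2 * ℓ) := by linarith [Real.add_one_le_exp (2 * ℓ)]
      have h6 : Real.exp (4 * ℓ) = Real.exp (2 * ℓ) * Real.exp (2 * ℓ) := by
        rw [← Real.exp_add]; congr 1; ring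
      rw [h4, h6]
      exact mul_le_mul_of_nonneg_right h5 (Real.exp_pos _).le
    calc q ^ T * ((1 + b) * (1 / ((fraction x i - fraction x j) ^ 2 + b)))
        ≤ Real.exp (-(10 * ℓ)) * Real.exp (4 * ℓ) :=
          mul_le_mul h1 (h2.trans h3) (by positivity) (Real.exp_pos _).le
      _ = _ := by rw [← Real.exp_add]; congr 1; ring
  · intro y _
    have h1 : (fraction y i - fraction y j) ^ 2 ≤ 1 := by
      rw [sq_le_one_iff_abs_le_one, abs_le]
      constructor <;>
        linarith [fraction_nonneg y i, fraction_nonneg y j, fraction_le_one y i,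
          fraction_le_one y j]
    rw [pow_zero, one_mul, mul_one_div, one_le_div (by positivity)]
    linarith
  · rintro s _ y ⟨hy1, hy2⟩
    simp_rw [← mul_expect]
    rw [pow_succ, mul_assoc]
    refine mul_le_mul_of_nonneg_left ?_ (pow_nonneg hq0 _)
    calc _ ≤ (1 + b) * (q * (1 / ((fraction y i - fraction y j) ^ 2 + b))) :=
          mul_le_mul_of_nonneg_left (h.expect_inv_sq_sub_le hS H hij hy1 hy2) (by positivity)
      _ = _ := by ring

end IsPluralityDynamics

/-! ### From pairs of opinions to consensus. -/

/-- All vertices hold the same opinion. -/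
def Consensus {n k : ℕ} (x : Config n k) : Prop := ∃ i, ConsensusOn x i

namespace IsPluralityDynamics

variable {n k : ℕ} [NeZero n] {W : Type*} [Fintype W] [Nonempty W]
  {step : Config n k → W → Config n k} {noise : Config n k → Fin k → ℝ} {S : ℝ → ℝ} {d ℓ z : ℝ}

-- After the pair is resolved, a weak member is dead by the end, and a strong member forces γ out of
-- its window; in neither case do both survive with γ still near z.
open Classical in
lemma surv_pair_le (h : IsPluralityDynamics step noise S d) (hS : IsNoiseScale S)
    (H : IsLargeScale n S ℓ z) (hn14 : 14 ≤ n) {i j : Fin k} (hij : i ≠ j) {T₁ T₂ : ℕ}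
    (hT1 : 12 * 10 ^ 12 * ℓ ≤ T₁ * z) (hT2 : 140 * ℓ ≤ T₂ * z)
    (hT : (T₁ + T₂ : ℕ) * z ≤ 2 * 10 ^ 13 * ℓ) (x : Config n k) :
    surv step (Near z) (fun y => if 1 / (n : ℝ) ≤ fraction y i ∧ 1 / (n : ℝ) ≤ fraction y j
      then 1 else 0) (T₁ + T₂) x ≤ 3 * Real.exp (-(6 * ℓ)) := by
  have hz := H.pos
  have hℓ := H.one_le
  have hf0 : ∀ l : Fin k, ∀ y : Config n k,
      (0 : ℝ) ≤ if 1 / (n : ℝ) ≤ fraction y l then 1 else 0 := fun l y => by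
    split_ifs <;> norm_num
  have hf1 : ∀ y : Config n k, (if 1 / (n : ℝ) ≤ fraction y i ∧ 1 / (n : ℝ) ≤ fraction y j
      then (1 : ℝ) else 0) ≤ 1 := fun y => by split_ifs <;> norm_num
  have hfi : ∀ y : Config n k, Near z y → (if 1 / (n : ℝ) ≤ fraction y i ∧
      1 / (n : ℝ) ≤ fraction y j then (1 : ℝ) else 0) ≤
      if 1 / (n : ℝ) ≤ fraction y i then 1 else 0 := fun y _ => by
    split_ifs with h1 h2
    · exact le_rfl
    · exact absurd h1.1 h2
    · exact zero_le_one
    · exact le_rfl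
  have hfj : ∀ y : Config n k, Near z y → (if 1 / (n : ℝ) ≤ fraction y i ∧
      1 / (n : ℝ) ≤ fraction y j then (1 : ℝ) else 0) ≤
      if 1 / (n : ℝ) ≤ fraction y j then 1 else 0 := fun y _ => by
    split_ifs with h1 h2
    · exact le_rfl
    · exact absurd h1.2 h2
    · exact zero_le_one
    · exact le_rfl
  have key := surv_first_hit (step := step) (D := Near z) (R := Resolved z i j)
    (f := fun y => if 1 / (n : ℝ) ≤ fraction y i ∧ 1 / (n : ℝ) ≤ fraction y j
      then 1 else 0) (T₁ := T₁) (T₂ := T₂) (ε := 2 * Real.exp (-(6 * ℓ))) (by positivity) hf1 ?_ x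
  · have := h.surv_unresolved_le hS H hij hT1 x
    linarith
  · intro y _ hy m hm1 hm2
    have hm3 : 140 * ℓ ≤ m * z := hT2.trans
      (mul_le_mul_of_nonneg_right (by exact_mod_cast hm1) hz.le)
    have hm4 : m * z ≤ 2 * 10 ^ 13 * ℓ := le_trans
      (mul_le_mul_of_nonneg_right (by exact_mod_cast hm2) hz.le) hT
    rcases hy with (hy | hy) | (hy | hy)
    · exact (surv_mono (fun _ => id) (hf0 i) hfi m y).trans
        (h.surv_alive_le_of_weak hS H hy hm3 hm4)
    · exact (surv_mono (fun _ => id) (fun _ => zero_le_one) (fun y _ => hf1 y) m y).trans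
        (h.surv_le_of_strong hS H hn14 hy (by linarith))
    · exact (surv_mono (fun _ => id) (hf0 j) hfj m y).trans
        (h.surv_alive_le_of_weak hS H hy hm3 hm4)
    · exact (surv_mono (fun _ => id) (fun _ => zero_le_one) (fun y _ => hf1 y) m y).trans
        (h.surv_le_of_strong hS H hn14 hy (by linarith))

open Classical in
/-- Within `O(ℓ / z)` rounds there is a consensus or the collision probability has grown. -/
lemma surv_epoch_le (h : IsPluralityDynamics step noise S d) (hS : IsNoiseScale S)
    (hk : k ≤ n) {x : Config n k} (H : IsLargeScale n S ℓ (collision x)) (hn14 : 14 ≤ n)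
    {T₁ T₂ : ℕ} (hT1 : 12 * 10 ^ 12 * ℓ ≤ T₁ * collision x)
    (hT2 : 140 * ℓ ≤ T₂ * collision x)
    (hT : (T₁ + T₂ : ℕ) * collision x ≤ 2 * 10 ^ 13 * ℓ) :
    surv step (fun y => ¬ (Consensus y ∨ 11 / 10 * collision x < collision y)) (fun _ => 1)
      (T₁ + T₂) x ≤ Real.exp (-(2 * ℓ)) := by
  set z := collision x with hz
  have hn := H.cast_pos
  refine (surv_not_le (D := Near z) (B := fun y => collision y < 9 / 10 * z) ?_ _ _).trans ?_
  · intro y hy hU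
    unfold Near at hy
    push Not at hU hy
    by_contra hc
    push Not at hc
    exact absurd (hy hc) (not_lt.2 hU.2)
  have h1 := h.exitProb_collision_lt_le hS H (x := x) le_rfl hT
  -- Union bound over ordered pairs: without consensus two distinct opinions are alive.
  let P : Finset (Fin k × Fin k) := univ.filter fun p => p.1 ≠ p.2
  have h2 : surv step (Near z) (fun y => @ite ℝ (Consensus y ∨ 11 / 10 * z < collision y)
      (Classical.propDecidable _) 0 1)
      (T₁ + T₂) x ≤ surv step (Near z) (fun y => ∑ p ∈ P, if 1 / (n : ℝ) ≤ fraction y p.1 ∧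
        1 / (n : ℝ) ≤ fraction y p.2 then 1 else 0) (T₁ + T₂) x := by
    refine surv_mono (fun _ => id) (fun y => sum_nonneg fun p _ => by split_ifs <;> norm_num)
      (fun y _ => ?_) _ _
    split_ifs with hU
    · exact sum_nonneg fun p _ => by split_ifs <;> norm_num
    · push Not at hU
      obtain ⟨i, j, hij, hi, hj⟩ := exists_alive_pair_of_not_consensus hU.1
      refine le_trans ?_ (single_le_sum (f := fun p : Fin k × Fin k =>
        if 1 / (n : ℝ) ≤ fraction y p.1 ∧ 1 / (n : ℝ) ≤ fraction y p.2 then (1 : ℝ) else 0)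
        (fun p _ => by split_ifs <;> norm_num)
        (show (i, j) ∈ P by simp [P, hij]))
      simp only [hi, hj, and_self, if_true, le_refl]
  have h3 : surv step (Near z) (fun y => ∑ p ∈ P, if 1 / (n : ℝ) ≤ fraction y p.1 ∧
        1 / (n : ℝ) ≤ fraction y p.2 then 1 else 0) (T₁ + T₂) x ≤
      n ^ 2 * (3 * Real.exp (-(6 * ℓ))) := by
    rw [surv_sum]
    calc _ ≤ ∑ p ∈ P, 3 * Real.exp (-(6 * ℓ)) := sum_le_sum fun p hp => by
          simp only [P, mem_filter, mem_univ, true_and] at hp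
          exact h.surv_pair_le hS H hn14 hp hT1 hT2 hT x
      _ = P.card * (3 * Real.exp (-(6 * ℓ))) := by rw [sum_const, nsmul_eq_mul]
      _ ≤ n ^ 2 * (3 * Real.exp (-(6 * ℓ))) := by
          refine mul_le_mul_of_nonneg_right ?_ (by positivity)
          have h4 : P.card ≤ k * k := by
            refine (card_filter_le _ _).trans ?_
            rw [card_univ, Fintype.card_prod, Fintype.card_fin]
          have h5 : P.card ≤ n ^ 2 := h4.trans (by nlinarith)
          exact_mod_cast h5
  refine (add_le_add (h2.trans h3) h1).trans ?_
  have hℓ := H.one_le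
  have h4 : (n : ℝ) ^ 2 = Real.exp (2 * ℓ) := by
    rw [← H.exp_eq, ← Real.exp_nat_mul]; norm_num
  have h5 : (4 : ℝ) ≤ n ^ 2 := by
    have : (14 : ℝ) ≤ n := by exact_mod_cast hn14
    nlinarith
  have h6 : Real.exp (-(2 * ℓ)) = n ^ 2 * (n ^ 2 * Real.exp (-(6 * ℓ))) := by
    rw [h4, ← Real.exp_add, ← Real.exp_add]; congr 1; ring
  rw [h6]
  have h7 : 0 < Real.exp (-(6 * ℓ)) := Real.exp_pos _
  have h8 : 4 * (n ^ 2 * Real.exp (-(6 * ℓ))) ≤ n ^ 2 * (n ^ 2 * Real.exp (-(6 * ℓ))) :=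
    mul_le_mul_of_nonneg_right h5 (by positivity)
  have h9 : 4 * Real.exp (-(6 * ℓ)) ≤ n ^ 2 * Real.exp (-(6 * ℓ)) :=
    mul_le_mul_of_nonneg_right h5 h7.le
  linarith

/-- Here `m` counts epochs. An epoch uses at most 2·10¹³ ℓ/z of the budget 3·10¹⁴ ℓ/z, and what is
left suffices at the level 11z/10, because the budget scales as 1/z. So the time is a geometric sum
and only the error depends on `m`. -/
lemma surv_not_consensus_le_of_large (h : IsPluralityDynamics step noise S d)
    (hS : IsNoiseScale S) (hk : k ≤ n) (hn14 : 14 ≤ n) (m : ℕ) :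
    ∀ x : Config n k, IsLargeScale n S ℓ (collision x) → 1 < collision x * (11 / 10) ^ m →
      ∀ T : ℕ, 3 * 10 ^ 14 * ℓ ≤ T * collision x →
      surv step (fun y => ¬ Consensus y) (fun _ => 1) T x ≤ m * Real.exp (-(2 * ℓ)) := by
  induction m with
  | zero =>
    intro x _ h1
    have := collision_le_one x
    simp only [pow_zero, mul_one] at h1
    linarith
  | succ m ih =>
    intro x H hm T hT
    set z := collision x with hz
    have hz0 := H.pos
    have hz1 := H.le_one
    have hℓ := H.one_le
    set T₁ := ⌈12 * 10 ^ 12 * ℓ / z⌉₊ with hT1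
    set T₂ := ⌈140 * ℓ / z⌉₊ with hT2
    have hT1a : 12 * 10 ^ 12 * ℓ ≤ T₁ * z := by
      rw [← div_le_iff₀ hz0]; exact Nat.le_ceil _
    have hT2a : 140 * ℓ ≤ T₂ * z := by
      rw [← div_le_iff₀ hz0]; exact Nat.le_ceil _
    have hT1b : T₁ * z ≤ 12 * 10 ^ 12 * ℓ + z := by
      have := (Nat.ceil_lt_add_one (show 0 ≤ 12 * 10 ^ 12 * ℓ / z by positivity)).le
      calc T₁ * z ≤ (12 * 10 ^ 12 * ℓ / z + 1) * z := mul_le_mul_of_nonneg_right this hz0.le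
        _ = _ := by field_simp
    have hT2b : T₂ * z ≤ 140 * ℓ + z := by
      have := (Nat.ceil_lt_add_one (show 0 ≤ 140 * ℓ / z by positivity)).le
      calc T₂ * z ≤ (140 * ℓ / z + 1) * z := mul_le_mul_of_nonneg_right this hz0.le
        _ = _ := by field_simp
    have hT12 : (T₁ + T₂ : ℕ) * z ≤ 2 * 10 ^ 13 * ℓ := by push_cast; linarith
    have hle : T₁ + T₂ ≤ T := by
      have : ((T₁ + T₂ : ℕ) : ℝ) * z ≤ T * z := by linarith
      exact_mod_cast le_of_mul_le_mul_right this hz0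
    obtain ⟨T', rfl⟩ := Nat.exists_eq_add_of_le hle
    have key := surv_first_hit (step := step) (D := fun y => ¬ Consensus y)
      (R := fun y => 11 / 10 * z < collision y) (f := fun _ => 1) (T₁ := T₁ + T₂) (T₂ := T')
      (ε := m * Real.exp (-(2 * ℓ))) (by positivity) (fun _ => le_rfl) ?_ x
    · have h1 := h.surv_epoch_le hS hk H hn14 hT1a hT2a hT12
      have h2 : (fun y : Config n k => ¬ (Consensus y ∨ 11 / 10 * collision x < collision y)) =
          fun y => ¬ Consensus y ∧ ¬ 11 / 10 * z < collision y := by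
        funext y; rw [not_or]
      rw [h2] at h1
      push_cast
      linarith
    · intro y _ hy s hs _
      refine ih y (H.mono hS (by linarith) (collision_le_one y)) ?_ s ?_
      · have h1 : z * (11 / 10) ^ (m + 1) = 11 / 10 * z * (11 / 10) ^ m := by ring
        rw [h1] at hm
        refine hm.trans_le (mul_le_mul_of_nonneg_right hy.le (by positivity))
      · have h1 : (T' : ℝ) * z ≤ s * z :=
          mul_le_mul_of_nonneg_right (by exact_mod_cast hs) hz0.le
        have h2 : (s : ℝ) * (11 / 10 * z) ≤ s * collision y :=
          mul_le_mul_of_nonneg_left hy.le (by positivity)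
        push_cast at hT hT12
        linarith

/-- From a configuration with a large collision probability, consensus is reached quickly. -/
lemma surv_not_consensus_le (h : IsPluralityDynamics step noise S d)
    (hS : IsNoiseScale S) (hk : k ≤ n) (hn14 : 14 ≤ n) {x : Config n k}
    (H : IsLargeScale n S ℓ (collision x)) {T : ℕ} (hT : 3 * 10 ^ 14 * ℓ ≤ T * collision x) :
    surv step (fun y => ¬ Consensus y) (fun _ => 1) T x ≤ 10 / n := by
  have hn := H.cast_pos
  -- Crude but enough: γ ≥ 1/n and (11/10)^(10n) ≥ n + 1 by Bernoulli, while 10n epochs with error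
  -- n⁻² add up to 10/n.
  refine (h.surv_not_consensus_le_of_large hS hk hn14 (10 * n) x H ?_ T hT).trans (le_of_eq ?_)
  · have h1 := one_add_mul_le_pow (a := (1 / 10 : ℝ)) (by norm_num) (10 * n)
    have h2 := inv_le_collision x
    rw [div_le_iff₀ hn] at h2
    have h3 : (1 + 1 / 10 : ℝ) = 11 / 10 := by norm_num
    rw [h3] at h1
    push_cast at h1
    have h4 : n + 1 ≤ (11 / 10 : ℝ) ^ (10 * n) := by linarith
    nlinarith [H.pos]
  · have : Real.exp (-(2 * ℓ)) = 1 / n ^ 2 := by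
      rw [Real.exp_neg, ← H.exp_eq, ← Real.exp_nat_mul]; norm_num
    rw [this]
    push_cast
    field_simp

end IsPluralityDynamics

/-! ### The start from many small opinions, and the lower bound. -/

namespace IsPluralityDynamics

variable {n k : ℕ} [NeZero n] {W : Type*} [Fintype W] [Nonempty W]
  {step : Config n k → W → Config n k} {noise : Config n k → Fin k → ℝ} {S : ℝ → ℝ} {d ℓ g : ℝ}

/-- Exponential tail at the extreme rate n/2: mean and noise together account for at most 4α_i, so
exceeding this by `a` costs e^(-na/2). -/
lemma expect_exp_fraction_sub_le (h : IsPluralityDynamics step noise S d) (hS : IsNoiseScale S)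
    (x : Config n k) (i : Fin k) (a : ℝ) :
    𝔼 w, Real.exp (n / 2 * (fraction (step x w) i - (4 * fraction x i + a))) ≤
      Real.exp (-(n / 2 * a)) := by
  have hn : (0 : ℝ) < n := cast_pos_of_neZero
  have h1 := h.expect_exp_fraction_le x i (t := n / 2) (abs_of_nonneg (by positivity)).le
  have h2 : ∀ w, Real.exp (n / 2 * (fraction (step x w) i - (4 * fraction x i + a))) =
      Real.exp (-(n / 2 * (4 * fraction x i + a))) *
        Real.exp (n / 2 * fraction (step x w) i) := fun w => by
    rw [← Real.exp_add]; congr 1; ring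
  simp_rw [h2]
  rw [← mul_expect]
  refine (mul_le_mul_of_nonneg_left h1 (Real.exp_pos _).le).trans ?_
  rw [← Real.exp_add]
  refine Real.exp_le_exp.2 ?_
  have h3 : noise x i ≤ 2 := (h.noise_le x i 1 (fraction_le_one x i) (collision_le_one x)).trans
    (hS.le_two 1 zero_le_one le_rfl)
  have h0 := fraction_nonneg x i
  have h4 : fraction x i * (1 + fraction x i - collision x) ≤ 2 * fraction x i := by
    nlinarith [fraction_le_one x i, collision_nonneg x]
  have h5 : ((n : ℝ) / 2) ^ 2 / n * (2 * fraction x i * noise x i) =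
      n / 2 * (fraction x i * noise x i) := by field_simp
  rw [h5]
  have h6 : fraction x i * noise x i ≤ fraction x i * 2 := mul_le_mul_of_nonneg_left h3 h0
  have h7 : (n : ℝ) / 2 * (fraction x i * (1 + fraction x i - collision x) +
      fraction x i * noise x i) ≤ n / 2 * (4 * fraction x i) :=
    mul_le_mul_of_nonneg_left (by linarith) (by positivity)
  linarith

lemma collision_le_of_fraction_le (hk : k ≤ n) {x y : Config n k} {a : ℝ}
    (hxy : ∀ i, fraction y i ≤ 4 * fraction x i + a) :
    collision y ≤ 32 * collision x + 2 * n * a ^ 2 := by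
  have h1 : ∀ i, fraction y i ^ 2 ≤ 32 * fraction x i ^ 2 + 2 * a ^ 2 := fun i => by
    have h2 : fraction y i ^ 2 ≤ (4 * fraction x i + a) ^ 2 :=
      pow_le_pow_left₀ (fraction_nonneg y i) (hxy i) 2
    nlinarith [sq_nonneg (4 * fraction x i - a)]
  calc collision y ≤ ∑ i, (32 * fraction x i ^ 2 + 2 * a ^ 2) := sum_le_sum fun i _ => h1 i
    _ = 32 * collision x + k * (2 * a ^ 2) := by
        rw [sum_add_distrib, ← mul_sum, ← collision, sum_const, card_univ, Fintype.card_fin,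
          nsmul_eq_mul]
    _ ≤ 32 * collision x + n * (2 * a ^ 2) := by
        have : (k : ℝ) ≤ n := by exact_mod_cast hk
        gcongr
    _ = _ := by ring

/-- The collision probability reaches the level `g` within `O(g / d)` rounds with constant
probability. -/
lemma surv_collision_lt_le (h : IsPluralityDynamics step noise S d) (hS : IsNoiseScale S)
    (hk : k ≤ n) (hn2 : 2 ≤ n) (hℓ : 1 ≤ ℓ) (hexp : Real.exp ℓ = n) (hg : 200 * ℓ ^ 2 ≤ n * g)
    (hg1 : g ≤ 1 / 16) (hd : 1 / (2 * (n : ℝ) ^ 2) ≤ d) {T : ℕ} (hT : 264 * g ≤ T * d)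
    (x : Config n k) :
    surv step (fun y => collision y < g) (fun _ => 1) T x ≤ 1 / 4 := by
  have hn : (0 : ℝ) < n := cast_pos_of_neZero
  have hg0 : 0 < g := by
    by_contra hc
    push Not at hc
    nlinarith
  have hd0 : 0 < d := lt_of_lt_of_le (by positivity) hd
  set a := 10 * ℓ / n with ha
  have ha0 : 0 ≤ a := by positivity
  -- Truncating γ at 33g bounds the potential. From below g one round rarely exceeds this cap, since
  -- fractions at most 4α_i + a give γ' ≤ 32γ + 2na² ≤ 33g; the exceptional event costs at most half
  -- of the drift.
  have key := surv_mul_le_of_drift (step := step) (D := fun y => collision y < g)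
    (φ := fun y => min (collision y) (33 * g)) (d := d / 2) (M := 33 * g)
    (fun y => min_le_right _ _) (fun y => le_min (collision_nonneg y) (by positivity))
    (by positivity) ?_ T x
  · have h1 : 33 * g * (4 * surv step (fun y => collision y < g) (fun _ => 1) T x) ≤
        33 * g * 1 := by
      have h2 := surv_nonneg (step := step) (D := fun y => collision y < g) (f := fun _ => 1)
        (fun _ => zero_le_one) T x
      nlinarith
    have := le_of_mul_le_mul_left h1 (by positivity)
    linarith
  · intro y hy
    have h1 : ∀ w, collision (step y w) ≤ min (collision (step y w)) (33 * g) +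
        ∑ i, Real.exp (n / 2 * (fraction (step y w) i - (4 * fraction y i + a))) := by
      intro w
      by_cases hc : ∀ i, fraction (step y w) i ≤ 4 * fraction y i + a
      · have h2 := collision_le_of_fraction_le hk hc
        have h3 : 2 * n * a ^ 2 ≤ g := by
          have : 2 * (n : ℝ) * a ^ 2 = 200 * ℓ ^ 2 / n := by rw [ha]; field_simp; ring
          rw [this, div_le_iff₀ hn]; linarith
        rw [min_eq_left (by linarith)]
        have : 0 ≤ ∑ i, Real.exp (n / 2 * (fraction (step y w) i - (4 * fraction y i + a))) :=
          sum_nonneg fun i _ => (Real.exp_pos _).le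
        linarith
      · push Not at hc
        obtain ⟨i, hi⟩ := hc
        have h2 : 1 ≤ ∑ i, Real.exp (n / 2 * (fraction (step y w) i - (4 * fraction y i + a))) := by
          refine le_trans ?_ (single_le_sum (f := fun i => Real.exp (n / 2 *
            (fraction (step y w) i - (4 * fraction y i + a))))
            (fun i _ => (Real.exp_pos _).le) (mem_univ i))
          exact Real.one_le_exp (mul_nonneg (by positivity) (by linarith))
        have h3 : 0 ≤ min (collision (step y w)) (33 * g) :=
          le_min (collision_nonneg _) (by positivity)
        linarith [collision_le_one (step y w)]
    have h2 := expect_le_expect fun w (_ : w ∈ univ) => h1 w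
    rw [expect_add_distrib, expect_sum_comm] at h2
    have h3 : ∑ i, 𝔼 w, Real.exp (n / 2 * (fraction (step y w) i - (4 * fraction y i + a))) ≤
        d / 2 := by
      calc _ ≤ ∑ i : Fin k, Real.exp (-(n / 2 * a)) :=
            sum_le_sum fun i _ => h.expect_exp_fraction_sub_le hS y i a
        _ = k * Real.exp (-(5 * ℓ)) := by
            rw [sum_const, card_univ, Fintype.card_fin, nsmul_eq_mul, ha]
            congr 3; field_simp; norm_num
        _ ≤ n * (1 / n ^ 5) := by
            have h4 : Real.exp (-(5 * ℓ)) = 1 / n ^ 5 := by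
              rw [Real.exp_neg, ← hexp, ← Real.exp_nat_mul]; norm_num
            rw [h4]
            have : (k : ℝ) ≤ n := by exact_mod_cast hk
            gcongr
        _ ≤ 1 / (2 * (n : ℝ) ^ 2) / 2 := by
            rw [div_div, mul_one_div, div_le_div_iff₀ (by positivity) (by positivity)]
            have h5 : (2 : ℝ) ≤ n := by exact_mod_cast hn2
            have h6 : (4 : ℝ) ≤ n ^ 2 := by nlinarith
            have h7 : (0 : ℝ) ≤ n ^ 3 := by positivity
            have h8 := mul_le_mul_of_nonneg_left h6 h7
            linear_combination h8
        _ ≤ d / 2 := by linarith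
    have h4 := h.drift y (hy.le.trans hg1)
    rw [min_eq_left (by linarith)]
    linarith

/-- From every configuration, consensus is reached within `O(g / d + ℓ / g)` rounds with
constant probability. -/
lemma surv_not_consensus_le_half (h : IsPluralityDynamics step noise S d)
    (hS : IsNoiseScale S) (hk : k ≤ n) (hn : 40 ≤ n) (H : IsLargeScale n S ℓ g)
    (hg1 : g ≤ 1 / 16) (hd : 1 / (2 * (n : ℝ) ^ 2) ≤ d) {T₁ T₂ : ℕ} (hT1 : 264 * g ≤ T₁ * d)
    (hT2 : 3 * 10 ^ 14 * ℓ ≤ T₂ * g) (x : Config n k) :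
    surv step (fun y => ¬ Consensus y) (fun _ => 1) (T₁ + T₂) x ≤ 1 / 2 := by
  have hn40 : (40 : ℝ) ≤ n := by exact_mod_cast hn
  have hℓ := H.one_le
  have h10 : (10 : ℝ) / n ≤ 1 / 4 := by rw [div_le_div_iff₀ (by linarith) (by norm_num)]; linarith
  have hg : 200 * ℓ ^ 2 ≤ n * g := by
    refine le_trans ?_ (H.le_mul hS)
    have : ℓ ^ 2 ≤ ℓ ^ 3 := pow_le_pow_right₀ hℓ (by norm_num)
    nlinarith
  refine (surv_first_hit (R := fun y => g ≤ collision y) (ε := 1 / 4) (by norm_num)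
    (fun _ => le_rfl) ?_ x).trans ?_
  · intro y _ hy m hm _
    refine (h.surv_not_consensus_le hS hk (by omega) (H.mono hS hy (collision_le_one y))
      ?_).trans h10
    refine hT2.trans ?_
    have : (T₂ : ℝ) ≤ m := by exact_mod_cast hm
    have := H.pos
    gcongr
  · have h1 := h.surv_collision_lt_le hS hk (by omega) hℓ H.exp_eq hg hg1 hd hT1 x
    have h2 := surv_mono (step := step) (D := fun y => ¬ Consensus y ∧ ¬ g ≤ collision y)
      (E := fun y => collision y < g) (f := fun _ => 1) (g := fun _ => 1)
      (fun y hy => not_le.1 hy.2) (fun _ => zero_le_one) (fun _ _ => le_rfl) T₁ x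
    linarith

/-- Independent repetitions turn a constant probability of consensus into a high one. -/
lemma surv_not_consensus_le_inv {T m : ℕ} (hexp : Real.exp ℓ = n)
    (hT : ∀ x, surv step (fun y => ¬ Consensus y) (fun _ => 1) T x ≤ 1 / 2)
    (hm : 2 * ℓ ≤ m) (x : Config n k) :
    surv step (fun y => ¬ Consensus y) (fun _ => 1) (m * T) x ≤ 1 / n := by
  refine (surv_mul_le_pow (by norm_num) hT m x).trans ?_
  -- With 2ℓ blocks the halvings give e^(-ℓ) = 1/n.
  have h1 : (1 / 2 : ℝ) ≤ Real.exp (-(1 / 2)) := by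
    linarith [Real.add_one_le_exp (-(1 / 2) : ℝ)]
  calc (1 / 2 : ℝ) ^ m ≤ Real.exp (-(1 / 2)) ^ m := pow_le_pow_left₀ (by norm_num) h1 m
    _ = Real.exp (-(m / 2)) := by rw [← Real.exp_nat_mul]; congr 1; ring
    _ ≤ Real.exp (-ℓ) := Real.exp_le_exp.2 (by linarith)
    _ = 1 / n := by rw [Real.exp_neg, hexp, one_div]

/-- While all opinions are small they stay small. -/
lemma le_surv_not_consensus (h : IsPluralityDynamics step noise S d)
    (hk : k ≤ n) (hℓ : 1 ≤ ℓ) (hexp : Real.exp ℓ = n) {m : ℕ} (hm : 8 * ℓ < m) (hmn : m ≤ n)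
    (hS : m ^ 2 * S (8 * ℓ / m) ≤ 16 * ℓ * n) {T : ℕ} (hT : T * (96 * ℓ ^ 2) ≤ m)
    {x : Config n k} (hx : ∀ j, fraction x j ≤ 2 / m) :
    1 - 1 / n ≤ surv step (fun y => ¬ Consensus y) (fun _ => 1) T x := by
  have hn : (0 : ℝ) < n := cast_pos_of_neZero
  have hm0 : (0 : ℝ) < m := by linarith
  set u := 8 * ℓ / m with hu
  have hu0 : 0 < u := by positivity
  have hu1 : u < 1 := by rw [hu, div_lt_one hm0]; exact hm
  let D : Config n k → Prop := fun y => ∀ j, fraction y j ≤ u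
  have hD : ∀ y, D y → ¬ Consensus y := by
    rintro y hy ⟨i, hi⟩
    have h1 : fraction y i = 1 := by
      unfold fraction support
      rw [filter_true_of_mem fun v _ => hi v, card_univ, Fintype.card_fin, div_self hn.ne']
    linarith [hy i]
  have h1 := surv_mono (step := step) (D := D) (E := fun y => ¬ Consensus y) (f := fun _ => 1)
    (g := fun _ => 1) hD (fun _ => zero_le_one) (fun _ _ => le_rfl) T x
  have h2 := one_sub_exitProb_le (step := step) (D := D) T x
  have h3 : exitProb step D (fun _ => True) T x ≤ exitProb step D (fun y => ∃ j, u < fraction y j)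
      T x := exitProb_mono (fun y hy _ => by simpa [D] using hy) T x
  have h4 := exitProb_exists (step := step) (D := D) (B := fun j y => u < fraction y j) T x
  set c := 96 * ℓ ^ 2 / m with hc
  have hc0 : 0 ≤ c := by positivity
  have hmn' : (m : ℝ) ≤ n := by exact_mod_cast hmn
  have h5 : ∀ j, exitProb step D (fun y => u < fraction y j) T x ≤ Real.exp (-(2 * ℓ)) := by
    intro j
    -- At rate m/2 the initial fraction 2/m contributes 1, the ceiling `u` contributes 4ℓ, and drift
    -- (32ℓ²/m) and noise (64ℓ²/m) contribute at most 1 over all `T` rounds. This leaves e^(-2ℓ) per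
    -- opinion.
    have key := exitProb_le_of_supersolution (step := step) (D := D)
      (B := fun y => u < fraction y j) (T := T)
      (F := fun s y => Real.exp (-(m / 2 * u) + s * c) * Real.exp (m / 2 * fraction y j))
      (fun s y => by positivity) ?_ ?_ T le_rfl x
    · refine key.trans ?_
      rw [← Real.exp_add]
      refine Real.exp_le_exp.2 ?_
      have h6 : T * c ≤ 1 := by
        rw [hc, ← mul_div_assoc, div_le_one hm0]; exact hT
      have h7 : (m : ℝ) / 2 * u = 4 * ℓ := by rw [hu]; field_simp; norm_num
      have h8 : (m : ℝ) / 2 * fraction x j ≤ m / 2 * (2 / m) :=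
        mul_le_mul_of_nonneg_left (hx j) (by positivity)
      have h9 : (m : ℝ) / 2 * (2 / m) = 1 := by field_simp
      linarith
    · intro s _ y _ hy
      rw [← Real.exp_add]
      refine Real.one_le_exp ?_
      have h6 : 0 ≤ s * c := by positivity
      have h7 : (m : ℝ) / 2 * u ≤ m / 2 * fraction y j :=
        mul_le_mul_of_nonneg_left hy.le (by positivity)
      linarith
    · intro s _ y hy
      rw [← mul_expect]
      refine (mul_le_mul_of_nonneg_left (h.expect_exp_fraction_le y j (t := m / 2)
        (by rw [abs_of_nonneg (by positivity)]; linarith)) (Real.exp_pos _).le).trans ?_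
      rw [← Real.exp_add, ← Real.exp_add]
      refine Real.exp_le_exp.2 ?_
      have h0 := fraction_nonneg y j
      have hγ := collision_nonneg y
      have h6 : noise y j ≤ S u := h.noise_le y j u (hy j) (collision_le_of_le y hy)
      have h7 : fraction y j * (1 + fraction y j - collision y) ≤ fraction y j + u ^ 2 := by
        have h8 : fraction y j * fraction y j ≤ u * u := mul_le_mul (hy j) (hy j) h0 hu0.le
        nlinarith
      have h8 : (m / 2 : ℝ) ^ 2 / n * (2 * fraction y j * noise y j) ≤ 64 * ℓ ^ 2 / m := by
        calc (m / 2 : ℝ) ^ 2 / n * (2 * fraction y j * noise y j)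
            ≤ (m / 2 : ℝ) ^ 2 / n * (2 * u * S u) := by
              have := h.noise_nonneg y j
              have := hy j
              gcongr
          _ = 4 * ℓ / (m * n) * (m ^ 2 * S u) := by
              generalize S u = q
              rw [hu]; field_simp; ring
          _ ≤ 4 * ℓ / (m * n) * (16 * ℓ * n) := mul_le_mul_of_nonneg_left hS (by positivity)
          _ = _ := by field_simp; norm_num
      have h9 := mul_le_mul_of_nonneg_left h7 (show (0 : ℝ) ≤ m / 2 by positivity)
      have h10 : (m : ℝ) / 2 * u ^ 2 = 32 * ℓ ^ 2 / m := by rw [hu]; field_simp; norm_num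
      have h11 : c = 32 * ℓ ^ 2 / m + 64 * ℓ ^ 2 / m := by rw [hc]; ring
      push_cast
      linarith
  have h6 : ∑ j, exitProb step D (fun y => u < fraction y j) T x ≤ 1 / n := by
    calc _ ≤ ∑ _j : Fin k, Real.exp (-(2 * ℓ)) := sum_le_sum fun j _ => h5 j
      _ = k * (1 / n ^ 2) := by
          have : Real.exp (-(2 * ℓ)) = 1 / n ^ 2 := by
            rw [Real.exp_neg, ← hexp, ← Real.exp_nat_mul]; norm_num
          rw [sum_const, card_univ, Fintype.card_fin, nsmul_eq_mul, this]
      _ ≤ n * (1 / n ^ 2) := by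
          have : (k : ℝ) ≤ n := by exact_mod_cast hk
          gcongr
      _ = 1 / n := by field_simp
  linarith

end IsPluralityDynamics

/-- Colour the vertices by their residues modulo `m`. -/
lemma exists_balanced {n k m : ℕ} [NeZero n] (hm : 2 ≤ m) (hmk : m ≤ k) (hmn : m ≤ n) :
    ∃ x : Config n k, (∀ j, fraction x j ≤ 2 / m) ∧ ¬ Consensus x := by
  have hn : (0 : ℝ) < n := cast_pos_of_neZero
  let x : Config n k := fun v => ⟨v % m, (Nat.mod_lt _ (by omega)).trans_le hmk⟩
  refine ⟨x, fun j => ?_, ?_⟩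
  · have h1 : support x j ≤ n / m + 1 := by
      rw [support, ← card_range (n / m + 1)]
      refine card_le_card_of_injOn (fun v => (v : ℕ) / m) ?_ ?_
      · intro v _
        simp only [coe_range, Set.mem_Iio]
        exact Nat.lt_succ_of_le (Nat.div_le_div_right v.2.le)
      · intro v hv w hw hvw
        simp only [coe_filter, mem_univ, true_and, Set.mem_ofPred_eq] at hv hw
        have h2 : (v : ℕ) % m = (w : ℕ) % m := by
          have := congrArg Fin.val (hv.trans hw.symm)
          simpa [x] using this
        refine Fin.ext ?_
        rw [← Nat.div_add_mod (v : ℕ) m, ← Nat.div_add_mod (w : ℕ) m, h2]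
        simp only at hvw
        rw [hvw]
    have hm0 : (0 : ℝ) < m := by exact_mod_cast (by omega : 0 < m)
    unfold fraction
    rw [div_le_div_iff₀ hn hm0]
    have h2 : support x j * m ≤ 2 * n := by
      calc support x j * m ≤ (n / m + 1) * m := Nat.mul_le_mul_right _ h1
        _ = n / m * m + m := by ring
        _ ≤ n + n := add_le_add (Nat.div_mul_le_self n m) hmn
        _ = 2 * n := by ring
    exact_mod_cast h2
  · rintro ⟨i, hi⟩
    have h0 := hi ⟨0, by omega⟩
    have h1 := hi ⟨1, by omega⟩
    have := congrArg Fin.val (h0.trans h1.symm)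
    simp only [x, Nat.zero_mod] at this
    rw [Nat.mod_eq_of_lt (by omega)] at this
    omega

/-! ### Fractions relative to the expected growth of the leader. -/

section Normalized

variable {n k : ℕ} {W : Type*}

/-- The chain together with the factor by which the opinion `i` is expected to have grown. -/
noncomputable def normalizedStep (step : Config n k → W → Config n k) (i : Fin k)
    (s : Config n k × Set.Ici (1 : ℝ)) (w : W) : Config n k × Set.Ici (1 : ℝ) :=
  -- The absolute value only serves to keep the factor at least 1 in all states; when i leads, α_i ≥
  -- γ and it disappears.
  (step s.1 w, ⟨s.2 * (1 + |fraction s.1 i - collision s.1|),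
    Set.mem_Ici.2 (one_le_mul_of_one_le_of_one_le s.2.2 (le_add_of_nonneg_right (abs_nonneg _)))⟩)

/-- The size of the opinion `j` relative to the expected growth of the leading opinion. -/
noncomputable def relSize (j : Fin k) (s : Config n k × Set.Ici (1 : ℝ)) : ℝ :=
  fraction s.1 j / s.2

/-- The opinion `i` leads, and its relative size is close to `z`. -/
structure Leads (i : Fin k) (z : ℝ) (s : Config n k × Set.Ici (1 : ℝ)) : Prop where
  ge : 9 / 10 * z ≤ relSize i s
  le : relSize i s ≤ 11 / 10 * z
  lt : ∀ j, j ≠ i → fraction s.1 j < fraction s.1 i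

variable [NeZero n] {i : Fin k} {z : ℝ} {s : Config n k × Set.Ici (1 : ℝ)}

lemma growth_pos (s : Config n k × Set.Ici (1 : ℝ)) : (0 : ℝ) < s.2 :=
  zero_lt_one.trans_le s.2.2

lemma relSize_mul (j : Fin k) (s : Config n k × Set.Ici (1 : ℝ)) :
    relSize j s * s.2 = fraction s.1 j := div_mul_cancel₀ _ (growth_pos s).ne'

lemma relSize_nonneg (j : Fin k) (s : Config n k × Set.Ici (1 : ℝ)) : 0 ≤ relSize j s :=
  div_nonneg (fraction_nonneg _ _) (growth_pos s).le

lemma relSize_le_fraction (j : Fin k) (s : Config n k × Set.Ici (1 : ℝ)) :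
    relSize j s ≤ fraction s.1 j :=
  div_le_self (fraction_nonneg _ _) s.2.2

namespace Leads

lemma fraction_le (h : Leads i z s) (j : Fin k) : fraction s.1 j ≤ fraction s.1 i := by
  rcases eq_or_ne j i with rfl | hj
  exacts [le_rfl, (h.lt j hj).le]

lemma relSize_le (h : Leads i z s) (j : Fin k) : relSize j s ≤ relSize i s :=
  div_le_div_of_nonneg_right (h.fraction_le j) (growth_pos s).le

lemma fraction_le_mul (h : Leads i z s) (j : Fin k) : fraction s.1 j ≤ 11 / 10 * z * s.2 := by
  rw [← relSize_mul]
  exact mul_le_mul_of_nonneg_right ((h.relSize_le j).trans h.le) (growth_pos s).le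

lemma collision_le (h : Leads i z s) : collision s.1 ≤ fraction s.1 i :=
  collision_le_of_le _ h.fraction_le

lemma relSize_step (h : Leads i z s) (step : Config n k → W → Config n k) (j : Fin k) (w : W) :
    relSize j (normalizedStep step i s w) =
      1 / (s.2 * (1 + (fraction s.1 i - collision s.1))) * fraction (step s.1 w) j := by
  unfold relSize normalizedStep
  simp only
  rw [abs_of_nonneg (sub_nonneg.2 h.collision_le)]
  ring

variable [Fintype W] [Nonempty W]
  {step : Config n k → W → Config n k} {noise : Config n k → Fin k → ℝ} {S : ℝ → ℝ} {d t : ℝ}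

/-- Fractions are at most 11z/10 times the growth factor p, and S is at most linear under scaling,
so the noise grows at most like p². Division by p cancels this: normalized noise stays of order z
S(z)/n for all times. -/
lemma fraction_mul_noise_le (h : Leads i z s) (hP : IsPluralityDynamics step noise S d)
    (hS : IsNoiseScale S) (hz : 0 ≤ z) (j : Fin k) :
    fraction s.1 j * noise s.1 j ≤ 5 / 4 * (s.2 : ℝ) ^ 2 * (z * S z) := by
  have hp : (1 : ℝ) ≤ s.2 := s.2.2
  have h1 : noise s.1 j ≤ 11 / 10 * s.2 * S z := by
    refine (hP.noise_le s.1 j (11 / 10 * s.2 * z) ?_ ?_).trans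
      (hS.scale _ z (by linarith) hz)
    · linarith [h.fraction_le_mul j]
    · linarith [h.fraction_le_mul i, h.collision_le]
  have h0 := hP.noise_nonneg s.1 j
  have hSz : 0 ≤ 11 / 10 * s.2 * S z := h0.trans h1
  have hq : 0 ≤ S z := by
    by_contra hc
    push Not at hc
    have : 11 / 10 * (s.2 : ℝ) * S z < 0 := mul_neg_of_pos_of_neg (by positivity) hc
    linarith
  calc fraction s.1 j * noise s.1 j ≤ (11 / 10 * z * s.2) * (11 / 10 * s.2 * S z) :=
        mul_le_mul (h.fraction_le_mul j) h1 h0 (by positivity)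
    _ = 121 / 100 * ((s.2 : ℝ) ^ 2 * (z * S z)) := by ring
    _ ≤ 5 / 4 * ((s.2 : ℝ) ^ 2 * (z * S z)) :=
        mul_le_mul_of_nonneg_right (by norm_num) (by positivity)
    _ = _ := by ring

lemma growth_step_pos (h : Leads i z s) :
    1 ≤ 1 + (fraction s.1 i - collision s.1) ∧ 1 + (fraction s.1 i - collision s.1) ≤ 2 :=
  ⟨by linarith [h.collision_le], by linarith [fraction_le_one s.1 i, collision_nonneg s.1]⟩

lemma noise_term_le (h : Leads i z s) (hS : IsNoiseScale S) (hz : 0 ≤ z) (hz1 : z ≤ 1) {q a : ℝ}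
    (hq : q ≤ a * (5 / 4 * (s.2 : ℝ) ^ 2 * (z * S z))) (ha4 : a ≤ 4) :
    (t / (s.2 * (1 + (fraction s.1 i - collision s.1)))) ^ 2 / n * q ≤
      t ^ 2 * (5 * (z * S z) / n) := by
  have hp := growth_pos s
  have hr := h.growth_step_pos.1
  set r := 1 + (fraction s.1 i - collision s.1)
  have hn : (0 : ℝ) < n := cast_pos_of_neZero
  have hSz : 0 ≤ S z := hz.trans (hS.le z hz hz1)
  have h1 : 1 / r ^ 2 ≤ 1 := by
    rw [div_le_one (by positivity)]; exact one_le_pow₀ hr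
  calc (t / (s.2 * r)) ^ 2 / n * q
      ≤ (t / (s.2 * r)) ^ 2 / n * (a * (5 / 4 * (s.2 : ℝ) ^ 2 * (z * S z))) :=
        mul_le_mul_of_nonneg_left hq (by positivity)
    _ ≤ (t / (s.2 * r)) ^ 2 / n * (4 * (5 / 4 * (s.2 : ℝ) ^ 2 * (z * S z))) := by gcongr
    _ = t ^ 2 * (5 * (z * S z) / n) * (1 / r ^ 2) := by field_simp
    _ ≤ t ^ 2 * (5 * (z * S z) / n) * 1 := mul_le_mul_of_nonneg_left h1 (by positivity)
    _ = _ := mul_one _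

lemma abs_div_growth_le (h : Leads i z s) (ht : |t| ≤ n / 2) :
    |t / (s.2 * (1 + (fraction s.1 i - collision s.1)))| ≤ n / 2 := by
  have h1 : 1 ≤ s.2 * (1 + (fraction s.1 i - collision s.1)) :=
    one_le_mul_of_one_le_of_one_le s.2.2 h.growth_step_pos.1
  rw [abs_div, abs_of_pos (zero_lt_one.trans_le h1)]
  exact (div_le_self (abs_nonneg t) h1).trans ht

/-- For j = i the normalized size is a martingale; a rival loses at a rate proportional to how far
it is behind. -/
lemma expect_relSize (h : Leads i z s) (hP : IsPluralityDynamics step noise S d) (j : Fin k) :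
    𝔼 w, relSize j (normalizedStep step i s w) =
      relSize j s * (1 - (fraction s.1 i - fraction s.1 j) /
        (1 + (fraction s.1 i - collision s.1))) := by
  have hp := growth_pos s
  have hr := h.growth_step_pos.1
  simp_rw [h.relSize_step]
  rw [← mul_expect, hP.expect_fraction, relSize]
  field_simp
  ring

lemma expect_exp_relSize_le (h : Leads i z s) (hP : IsPluralityDynamics step noise S d)
    (hS : IsNoiseScale S) (hz : 0 ≤ z) (hz1 : z ≤ 1) (ht : |t| ≤ n / 2) (j : Fin k) :
    𝔼 w, Real.exp (t * relSize j (normalizedStep step i s w)) ≤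
      Real.exp (t * (relSize j s * (1 - (fraction s.1 i - fraction s.1 j) /
        (1 + (fraction s.1 i - collision s.1)))) + t ^ 2 * (5 * (z * S z) / n)) := by
  have hp := growth_pos s
  have hr := h.growth_step_pos.1
  have h1 := hP.expect_exp_fraction_le s.1 j (h.abs_div_growth_le ht)
  have h2 : ∀ w, t * relSize j (normalizedStep step i s w) =
      t / (s.2 * (1 + (fraction s.1 i - collision s.1))) * fraction (step s.1 w) j := fun w => by
    rw [h.relSize_step]; ring
  simp_rw [h2]
  refine h1.trans (Real.exp_le_exp.2 (add_le_add (le_of_eq ?_)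
    (h.noise_term_le hS hz hz1 (a := 2) ?_ (by norm_num))))
  · rw [relSize]
    field_simp
    ring
  · linarith [h.fraction_mul_noise_le hP hS hz j]

/-- The normalized lead is multiplied by 1 + α_j/(1 + α_i - γ) in expectation: a comparable rival is
what makes the lead grow. -/
lemma expect_exp_lead_le (h : Leads i z s) (hP : IsPluralityDynamics step noise S d)
    (hS : IsNoiseScale S) (hz : 0 ≤ z) (hz1 : z ≤ 1) (ht : |t| ≤ n / 2) {j : Fin k}
    (hj : j ≠ i) :
    𝔼 w, Real.exp (t * (relSize i (normalizedStep step i s w) -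
        relSize j (normalizedStep step i s w))) ≤
      Real.exp (t * ((relSize i s - relSize j s) * (1 + fraction s.1 j /
        (1 + (fraction s.1 i - collision s.1)))) + t ^ 2 * (5 * (z * S z) / n)) := by
  have hp := growth_pos s
  have hr := h.growth_step_pos.1
  have h1 := hP.expect_exp_sub_le s.1 hj.symm (h.abs_div_growth_le ht)
  have h2 : ∀ w, t * (relSize i (normalizedStep step i s w) -
      relSize j (normalizedStep step i s w)) =
      t / (s.2 * (1 + (fraction s.1 i - collision s.1))) *
        (fraction (step s.1 w) i - fraction (step s.1 w) j) := fun w => by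
    rw [h.relSize_step, h.relSize_step]; ring
  simp_rw [h2]
  refine h1.trans (Real.exp_le_exp.2 (add_le_add (le_of_eq ?_)
    (h.noise_term_le hS hz hz1 (a := 4) ?_ le_rfl)))
  · rw [relSize, relSize]
    field_simp
    ring
  · linarith [h.fraction_mul_noise_le hP hS hz j, h.fraction_mul_noise_le hP hS hz i]

end Leads

end Normalized

lemma exitProb_exp_le {S W : Type*} [Fintype W] [Nonempty W] {step : S → W → S} {D B : S → Prop}
    {X : S → ℝ} {v a : ℝ} (hv : 0 ≤ v)
    (hX : ∀ s, D s → 𝔼 w, Real.exp (X (step s w)) ≤ Real.exp (X s + v))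
    (hB : ∀ s, ¬ D s → B s → a ≤ X s) (t : ℕ) (s : S) :
    exitProb step D B t s ≤ Real.exp (X s - a + t * v) := by
  refine exitProb_le_of_supersolution (T := t) (F := fun t s => Real.exp (X s - a + t * v))
    (fun _ _ => (Real.exp_pos _).le) ?_ ?_ t le_rfl s
  · intro r _ x hx hb
    refine Real.one_le_exp ?_
    have := hB x hx hb
    have : 0 ≤ r * v := by positivity
    linarith
  · intro r _ x hx
    have h1 : ∀ w, Real.exp (X (step x w) - a + r * v) =
        Real.exp (-a + r * v) * Real.exp (X (step x w)) := fun w => by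
      rw [← Real.exp_add]; congr 1; ring
    simp_rw [h1]
    rw [← mul_expect]
    refine (mul_le_mul_of_nonneg_left (hX x hx) (Real.exp_pos _).le).trans (le_of_eq ?_)
    rw [← Real.exp_add]
    congr 1
    push_cast
    ring

/-! ### The leader, the weak rivals and the comparable rivals. -/

/-- The size `z` of the leading opinion and the number `N` of rounds are such that within `2 N`
rounds the relative size of an opinion hardly moves. -/
structure IsPluralityScale (n : ℕ) (S : ℝ → ℝ) (ℓ z : ℝ) (N : ℕ) : Prop where
  one_le : 1 ≤ ℓ
  exp_eq : Real.exp ℓ = n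
  pos : 0 < z
  le_one : z ≤ 1
  threshold : 10 ^ 6 * ℓ ^ 2 * S z ≤ n * z ^ 2
  time_ge : 40 * ℓ ≤ N * z
  time_le : N * z ≤ 41 * ℓ

namespace IsPluralityScale

variable {n : ℕ} {S : ℝ → ℝ} {ℓ z : ℝ} {N : ℕ}

lemma cast_pos (H : IsPluralityScale n S ℓ z N) : (0 : ℝ) < n := H.exp_eq ▸ Real.exp_pos ℓ

lemma scale_pos (H : IsPluralityScale n S ℓ z N) (hS : IsNoiseScale S) : 0 < S z :=
  H.pos.trans_le (hS.le z H.pos.le H.le_one)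

lemma rate_le (H : IsPluralityScale n S ℓ z N) (hS : IsNoiseScale S) :
    30 * ℓ / z ≤ n / 2 := by
  have hz := H.pos
  have h1 : z * (60 * ℓ) ≤ z * (n * z) := by
    calc z * (60 * ℓ) ≤ 10 ^ 6 * ℓ ^ 2 * S z := by
          have := hS.le z hz.le H.le_one
          have := H.one_le
          calc z * (60 * ℓ) = 60 * ℓ * z := by ring
            _ ≤ 10 ^ 6 * ℓ ^ 2 * z := mul_le_mul_of_nonneg_right (by nlinarith) hz.le
            _ ≤ _ := by gcongr
      _ ≤ _ := H.threshold
      _ = _ := by ring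
  have h2 := le_of_mul_le_mul_left h1 hz
  rw [div_le_div_iff₀ hz two_pos]
  linarith

lemma cost_le (H : IsPluralityScale n S ℓ z N) (hS : IsNoiseScale S) {t : ℕ} (ht : t ≤ N + N) :
    t * ((30 * ℓ / z) ^ 2 * (5 * (z * S z) / n)) ≤ ℓ := by
  have hz := H.pos
  have hn := H.cast_pos
  have hℓ := H.one_le
  have hSz := H.scale_pos hS
  have h1 : (t : ℝ) * z ≤ 82 * ℓ := by
    have : (t : ℝ) ≤ N + N := by exact_mod_cast ht
    nlinarith [H.time_le]
  have h2 : 369000 * ℓ ^ 2 * S z ≤ n * z ^ 2 := by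
    refine le_trans ?_ H.threshold
    gcongr
    norm_num
  calc t * ((30 * ℓ / z) ^ 2 * (5 * (z * S z) / n))
      = (t * z) * (4500 * ℓ ^ 2 * S z) / (n * z ^ 2) := by field_simp; ring
    _ ≤ (82 * ℓ) * (4500 * ℓ ^ 2 * S z) / (n * z ^ 2) := by gcongr
    _ = ℓ * (369000 * ℓ ^ 2 * S z) / (n * z ^ 2) := by ring
    _ ≤ ℓ * (n * z ^ 2) / (n * z ^ 2) := by gcongr
    _ = ℓ := by field_simp

lemma le_pow (H : IsPluralityScale n S ℓ z N) : (n : ℝ) ≤ (1 + z / 4) ^ N := by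
  have hz := H.pos
  have hz1 := H.le_one
  have h1 : Real.exp (z / 8) ≤ 1 + z / 4 := by
    have h2 := Real.add_one_le_exp (-(z / 8))
    have h3 : 1 ≤ (1 + z / 4) * (1 - z / 8) := by nlinarith
    have h4 : Real.exp (z / 8) * Real.exp (-(z / 8)) = 1 := by rw [← Real.exp_add]; simp
    have h5 : Real.exp (z / 8) * (1 - z / 8) ≤ (1 + z / 4) * (1 - z / 8) := by
      refine le_trans ?_ h3
      rw [← h4]
      exact mul_le_mul_of_nonneg_left (by linarith) (Real.exp_pos _).le
    exact le_of_mul_le_mul_right h5 (by linarith)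
  calc (n : ℝ) = Real.exp ℓ := H.exp_eq.symm
    _ ≤ Real.exp (z / 8) ^ N := by
        rw [← Real.exp_nat_mul]
        refine Real.exp_le_exp.2 ?_
        nlinarith [H.time_ge, H.one_le]
    _ ≤ _ := pow_le_pow_left₀ (Real.exp_pos _).le h1 N

lemma noiseTerm_nonneg (H : IsPluralityScale n S ℓ z N) (hS : IsNoiseScale S) (t : ℝ) :
    0 ≤ t ^ 2 * (5 * (z * S z) / n) := by
  have := H.pos
  have := H.scale_pos hS
  positivity

end IsPluralityScale

section Plurality

variable {n k : ℕ} [NeZero n] {W : Type*} [Fintype W] [Nonempty W]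
  {step : Config n k → W → Config n k} {noise : Config n k → Fin k → ℝ} {S : ℝ → ℝ} {d ℓ z : ℝ}
  {N : ℕ} {i j : Fin k} {s : Config n k × Set.Ici (1 : ℝ)}

namespace IsPluralityScale

/-- The martingale would have to move by z/10, worth 3ℓ at rate 30ℓ/z, while `2N` rounds of noise
cost ℓ. -/
lemma exitProb_leader_up (H : IsPluralityScale n S ℓ z N)
    (hP : IsPluralityDynamics step noise S d) (hS : IsNoiseScale S) (hs : relSize i s = z) :
    exitProb (normalizedStep step i) (Leads i z) (fun s => 11 / 10 * z < relSize i s) (N + N) s ≤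
      Real.exp (-(2 * ℓ)) := by
  have hz := H.pos
  have hℓ := H.one_le
  have hr : 0 ≤ 30 * ℓ / z := by positivity
  refine (exitProb_exp_le (X := fun s => 30 * ℓ / z * relSize i s) (a := 33 * ℓ)
    (H.noiseTerm_nonneg hS (30 * ℓ / z)) ?_ ?_ (N + N) s).trans ?_
  · intro s h
    refine (h.expect_exp_relSize_le hP hS hz.le H.le_one
      (by rw [abs_of_nonneg hr]; exact H.rate_le hS) i).trans (le_of_eq ?_)
    rw [sub_self, zero_div, sub_zero, mul_one]
  · intro s _ h
    calc 33 * ℓ = 30 * ℓ / z * (11 / 10 * z) := by field_simp; norm_num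
      _ ≤ _ := mul_le_mul_of_nonneg_left h.le hr
  · refine Real.exp_le_exp.2 ?_
    have h1 := H.cost_le hS (le_refl (N + N))
    have h2 : 30 * ℓ / z * z = 30 * ℓ := by field_simp
    rw [hs, h2]
    linarith

lemma exitProb_leader_down (H : IsPluralityScale n S ℓ z N)
    (hP : IsPluralityDynamics step noise S d) (hS : IsNoiseScale S) (hs : relSize i s = z) :
    exitProb (normalizedStep step i) (Leads i z) (fun s => relSize i s < 9 / 10 * z) (N + N) s ≤
      Real.exp (-(2 * ℓ)) := by
  have hz := H.pos
  have hℓ := H.one_le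
  have hr : 0 ≤ 30 * ℓ / z := by positivity
  refine (exitProb_exp_le (X := fun s => -(30 * ℓ / z) * relSize i s) (a := -(27 * ℓ))
    (H.noiseTerm_nonneg hS (-(30 * ℓ / z))) ?_ ?_ (N + N) s).trans ?_
  · intro s h
    refine (h.expect_exp_relSize_le hP hS hz.le H.le_one
      (by rw [abs_neg, abs_of_nonneg hr]; exact H.rate_le hS) i).trans (le_of_eq ?_)
    rw [sub_self, zero_div, sub_zero, mul_one]
  · intro s _ h
    have h1 : 30 * ℓ / z * relSize i s ≤ 27 * ℓ :=
      calc 30 * ℓ / z * relSize i s ≤ 30 * ℓ / z * (9 / 10 * z) :=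
            mul_le_mul_of_nonneg_left h.le hr
        _ = _ := by field_simp; norm_num
    linarith
  · refine Real.exp_le_exp.2 ?_
    have h1 := H.cost_le hS (le_refl (N + N))
    have h2 : 30 * ℓ / z * z = 30 * ℓ := by field_simp
    rw [hs, neg_sq, neg_mul, h2]
    linarith

/-- While i leads, the rival's normalized size is a supermartingale; climbing z/5 is worth 6ℓ. -/
lemma exitProb_weak (H : IsPluralityScale n S ℓ z N)
    (hP : IsPluralityDynamics step noise S d) (hS : IsNoiseScale S) {t : ℕ} (ht : t ≤ N + N)
    (hs : relSize j s ≤ z / 2) :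
    exitProb (normalizedStep step i) (fun s => Leads i z s ∧ relSize j s ≤ 7 / 10 * z)
      (fun s => 7 / 10 * z < relSize j s) t s ≤ Real.exp (-(2 * ℓ)) := by
  have hz := H.pos
  have hℓ := H.one_le
  have hr : 0 ≤ 30 * ℓ / z := by positivity
  refine (exitProb_exp_le (X := fun s => 30 * ℓ / z * relSize j s) (a := 21 * ℓ)
    (H.noiseTerm_nonneg hS (30 * ℓ / z)) ?_ ?_ t s).trans ?_
  · rintro s ⟨h, -⟩
    refine (h.expect_exp_relSize_le hP hS hz.le H.le_one
      (by rw [abs_of_nonneg hr]; exact H.rate_le hS) j).trans (Real.exp_le_exp.2 ?_)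
    gcongr
    refine mul_le_of_le_one_right (relSize_nonneg j s) (sub_le_self _ ?_)
    exact div_nonneg (sub_nonneg.2 (h.fraction_le j)) (zero_le_one.trans h.growth_step_pos.1)
  · intro s _ h
    calc 21 * ℓ = 30 * ℓ / z * (7 / 10 * z) := by field_simp; norm_num
      _ ≤ _ := mul_le_mul_of_nonneg_left h.le hr
  · refine Real.exp_le_exp.2 ?_
    have h1 := H.cost_le hS ht
    have h2 : 30 * ℓ / z * relSize j s ≤ 15 * ℓ :=
      calc 30 * ℓ / z * relSize j s ≤ 30 * ℓ / z * (z / 2) := mul_le_mul_of_nonneg_left hs hr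
        _ = _ := by field_simp; norm_num
    linarith

-- The normalized gap of at least z/5 makes the rival contract by 1 - z/10. The growth factor is at
-- most 1/(9z/10), as the leader's fraction is at most 1; so a living rival has normalized size at
-- least (9z/10)/n, and Markov's inequality applies.
open Classical in
lemma surv_weak (H : IsPluralityScale n S ℓ z N)
    (hP : IsPluralityDynamics step noise S d) {t : ℕ} (ht : N ≤ t) (hs : relSize j s ≤ z / 2) :
    surv (normalizedStep step i) (fun s => Leads i z s ∧ relSize j s ≤ 7 / 10 * z)
      (fun s => if 1 / (n : ℝ) ≤ fraction s.1 j then 1 else 0) t s ≤ Real.exp (-(2 * ℓ)) := by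
  have hz := H.pos
  have hz1 := H.le_one
  have hn := H.cast_pos
  have hq : 0 ≤ 1 - z / 10 := by linarith
  refine (surv_le_of_supersolution (T := t)
    (F := fun t s => n / (9 / 10 * z) * (1 - z / 10) ^ t * relSize j s)
    (fun t s => mul_nonneg (by positivity) (relSize_nonneg j s)) ?_ ?_ t le_rfl s).trans ?_
  · rintro s ⟨h, -⟩
    have h0 := relSize_nonneg j s
    split_ifs with h1
    · have hp := growth_pos s
      have h2 : 9 / 10 * z * s.2 ≤ 1 :=
        (mul_le_mul_of_nonneg_right h.ge hp.le).trans
          ((relSize_mul i s).le.trans (fraction_le_one _ _))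
      rw [← relSize_mul, div_le_iff₀ hn] at h1
      rw [pow_zero, mul_one, div_mul_eq_mul_div, le_div_iff₀ (by positivity), one_mul]
      have h3 : (9 / 10 * z) * 1 ≤ 9 / 10 * z * (relSize j s * s.2 * n) :=
        mul_le_mul_of_nonneg_left h1 (by positivity)
      have h4 : 9 / 10 * z * s.2 * (relSize j s * n) ≤ 1 * (relSize j s * n) :=
        mul_le_mul_of_nonneg_right h2 (by positivity)
      nlinarith
    · positivity
  · rintro t _ s ⟨h, h7⟩
    rw [← mul_expect, h.expect_relSize hP, pow_succ]
    have hp : (1 : ℝ) ≤ s.2 := s.2.2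
    have hr := h.growth_step_pos
    have h0 := relSize_nonneg j s
    have h2 : z / 10 ≤ (fraction s.1 i - fraction s.1 j) /
        (1 + (fraction s.1 i - collision s.1)) := by
      rw [le_div_iff₀ (by linarith), ← relSize_mul i, ← relSize_mul j]
      have h3 : 1 / 5 * z ≤ relSize i s - relSize j s := by linarith [h.ge]
      have h4 : z / 10 * (1 + (relSize i s * s.2 - collision s.1)) ≤ z / 10 * 2 := by
        rw [relSize_mul]; gcongr; exact hr.2
      nlinarith
    have h3 : relSize j s * (1 - (fraction s.1 i - fraction s.1 j) /
        (1 + (fraction s.1 i - collision s.1))) ≤ relSize j s * (1 - z / 10) :=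
      mul_le_mul_of_nonneg_left (by linarith) h0
    calc n / (9 / 10 * z) * (1 - z / 10) ^ t * (relSize j s *
          (1 - (fraction s.1 i - fraction s.1 j) / (1 + (fraction s.1 i - collision s.1))))
        ≤ n / (9 / 10 * z) * (1 - z / 10) ^ t * (relSize j s * (1 - z / 10)) :=
          mul_le_mul_of_nonneg_left h3 (by positivity)
      _ = _ := by ring
  · have h1 : (1 - z / 10) ^ t ≤ Real.exp (-(4 * ℓ)) := by
      calc (1 - z / 10) ^ t ≤ Real.exp (-(z / 10)) ^ t :=
            pow_le_pow_left₀ hq (by linarith [Real.add_one_le_exp (-(z / 10))]) t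
        _ = Real.exp (-(t * z / 10)) := by rw [← Real.exp_nat_mul]; congr 1; ring
        _ ≤ _ := by
            refine Real.exp_le_exp.2 ?_
            have : (N : ℝ) ≤ t := by exact_mod_cast ht
            nlinarith [H.time_ge]
    have h0 := relSize_nonneg j s
    calc n / (9 / 10 * z) * (1 - z / 10) ^ t * relSize j s
        ≤ n / (9 / 10 * z) * Real.exp (-(4 * ℓ)) * (z / 2) := by gcongr
      _ = 5 / 9 * (n * Real.exp (-(4 * ℓ))) := by field_simp; norm_num
      _ = 5 / 9 * Real.exp (-(3 * ℓ)) := by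
          rw [← H.exp_eq, ← Real.exp_add]; congr 2; ring
      _ ≤ 1 * Real.exp (-(2 * ℓ)) := by
          refine mul_le_mul (by norm_num) (Real.exp_le_exp.2 ?_) (Real.exp_pos _).le zero_le_one
          linarith [H.one_le]
      _ = _ := one_mul _

/-- One round turns the rate r into r(1 + z/4). The correction 10 S(z) r²/n makes the test function
reproduce itself: replacing r by r(1 + z/4) increases it by at least 5z S(z) r²/n, which is exactly
the noise term. -/
lemma expect_exp_lead_le (H : IsPluralityScale n S ℓ z N)
    (hP : IsPluralityDynamics step noise S d) (hS : IsNoiseScale S) (h : Leads i z s)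
    (hj : j ≠ i) (hjs : z / 2 < relSize j s) {r : ℝ} (hr : 0 ≤ r) (hrn : r ≤ n / 2) :
    𝔼 w, Real.exp (-r * (relSize i (normalizedStep step i s w) -
        relSize j (normalizedStep step i s w)) + 10 * S z / n * r ^ 2) ≤
      Real.exp (-(r * (1 + z / 4)) * (relSize i s - relSize j s) +
        10 * S z / n * (r * (1 + z / 4)) ^ 2) := by
  have hz := H.pos
  have hn := H.cast_pos
  have hSz := H.scale_pos hS
  simp_rw [Real.exp_add _ (10 * S z / n * r ^ 2)]
  rw [← expect_mul]
  refine (mul_le_mul_of_nonneg_right (h.expect_exp_lead_le hP hS hz.le H.le_one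
    (by rwa [abs_neg, abs_of_nonneg hr]) hj) (Real.exp_pos _).le).trans ?_
  rw [← Real.exp_add]
  refine Real.exp_le_exp.2 ?_
  have hg := h.growth_step_pos
  have h0 : 0 ≤ relSize i s - relSize j s := sub_nonneg.2 (h.relSize_le j)
  have h1 : z / 4 ≤ fraction s.1 j / (1 + (fraction s.1 i - collision s.1)) := by
    rw [le_div_iff₀ (by linarith)]
    have h2 : z / 2 ≤ fraction s.1 j := hjs.le.trans (relSize_le_fraction j s)
    nlinarith
  have h2 : (relSize i s - relSize j s) * (1 + z / 4) ≤ (relSize i s - relSize j s) *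
      (1 + fraction s.1 j / (1 + (fraction s.1 i - collision s.1))) :=
    mul_le_mul_of_nonneg_left (by linarith) h0
  have h3 := mul_le_mul_of_nonneg_left h2 hr
  have h4 : 10 * S z / n * (r * (1 + z / 4)) ^ 2 =
      r ^ 2 * (5 * (z * S z) / n) + 10 * S z / n * r ^ 2 +
        10 * S z / n * r ^ 2 * (z ^ 2 / 16) := by ring
  have h5 : 0 ≤ 10 * S z / n * r ^ 2 * (z ^ 2 / 16) := by positivity
  rw [neg_sq]
  linarith

end IsPluralityScale

end Plurality

section Plurality

variable {n k : ℕ} [NeZero n] {W : Type*} [Fintype W] [Nonempty W]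
  {step : Config n k → W → Config n k} {noise : Config n k → Fin k → ℝ} {S : ℝ → ℝ} {d ℓ z δ : ℝ}
  {N : ℕ} {i j : Fin k} {s : Config n k × Set.Ici (1 : ℝ)}

namespace IsPluralityScale

/-- The exponent with which the lead `δ` is tested. -/
lemma lead_exponent (H : IsPluralityScale n S ℓ z N) (hS : IsNoiseScale S) (hδ : 0 ≤ δ)
    (hδz : δ ≤ z) (hδn : 200 * ℓ * S z ≤ n * δ ^ 2) :
    0 ≤ δ * n / (20 * S z) ∧ δ * n / (20 * S z) ≤ n / 2 ∧
      -(δ * n / (20 * S z)) * δ + 10 * S z / n * (δ * n / (20 * S z)) ^ 2 ≤ -(5 * ℓ) := by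
  have hn := H.cast_pos
  have hSz := H.scale_pos hS
  refine ⟨by positivity, ?_, ?_⟩
  · rw [div_le_div_iff₀ (by positivity) two_pos]
    have : δ ≤ S z := hδz.trans (hS.le z H.pos.le H.le_one)
    nlinarith
  · have h1 : -(δ * n / (20 * S z)) * δ + 10 * S z / n * (δ * n / (20 * S z)) ^ 2 =
        -(n * δ ^ 2 / (40 * S z)) := by field_simp; ring
    rw [h1, neg_le_neg_iff, le_div_iff₀ (by positivity)]
    linarith

/-- The test function is at least 1 once the lead is nonpositive. The rates form a geometric
schedule that reaches the optimal one at the initial time. -/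
lemma exitProb_lead (H : IsPluralityScale n S ℓ z N)
    (hP : IsPluralityDynamics step noise S d) (hS : IsNoiseScale S) (hj : j ≠ i) (hδ : 0 ≤ δ)
    (hδz : δ ≤ z) (hδn : 200 * ℓ * S z ≤ n * δ ^ 2) (hs : δ ≤ relSize i s - relSize j s) :
    exitProb (normalizedStep step i) (fun s => Leads i z s ∧ ¬ relSize j s ≤ z / 2)
      (fun s => fraction s.1 i ≤ fraction s.1 j) (N + N) s ≤ Real.exp (-(2 * ℓ)) := by
  have hz := H.pos
  have hn := H.cast_pos
  have hSz := H.scale_pos hS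
  obtain ⟨hr0, hrn, hrδ⟩ := H.lead_exponent hS hδ hδz hδn
  set r := δ * n / (20 * S z)
  set ρ := 1 + z / 4 with hρ
  have hρ1 : 1 ≤ ρ := by linarith
  have hμ : ∀ t ≤ N + N, r / ρ ^ (N + N) * ρ ^ t ≤ r := fun t ht => by
    rw [div_mul_eq_mul_div, div_le_iff₀ (by positivity)]
    exact mul_le_mul_of_nonneg_left (pow_le_pow_right₀ hρ1 ht) hr0
  refine (exitProb_le_of_supersolution (T := N + N)
    (F := fun t s => Real.exp (-(r / ρ ^ (N + N) * ρ ^ t) * (relSize i s - relSize j s) +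
      10 * S z / n * (r / ρ ^ (N + N) * ρ ^ t) ^ 2)) (fun _ _ => (Real.exp_pos _).le) ?_ ?_ _
      le_rfl s).trans ?_
  · intro t _ s _ hb
    refine Real.one_le_exp ?_
    have h1 : relSize i s - relSize j s ≤ 0 :=
      sub_nonpos.2 (div_le_div_of_nonneg_right hb (growth_pos s).le)
    have h2 : 0 ≤ -(r / ρ ^ (N + N) * ρ ^ t) * (relSize i s - relSize j s) :=
      mul_nonneg_of_nonpos_of_nonpos (neg_nonpos.2 (by positivity)) h1
    positivity
  · rintro t ht s ⟨h, hR⟩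
    have h1 := H.expect_exp_lead_le hP hS h hj (not_le.1 hR)
      (r := r / ρ ^ (N + N) * ρ ^ t) (by positivity) ((hμ t ht.le).trans hrn)
    rwa [← hρ, mul_assoc, ← pow_succ] at h1
  · refine Real.exp_le_exp.2 ?_
    rw [div_mul_cancel₀ r (by positivity)]
    have h1 := mul_le_mul_of_nonneg_left hs hr0
    linarith [H.one_le]

/-- The lead would grow by (1 + z/4)^N ≥ n and become impossibly large. At the final time the rate
is at most 1/2 and the lead at most 2, so the prefactor e^(2ℓ) makes the test function at least 1.
-/
lemma surv_strong (H : IsPluralityScale n S ℓ z N)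
    (hP : IsPluralityDynamics step noise S d) (hS : IsNoiseScale S) (hj : j ≠ i) (hδ : 0 ≤ δ)
    (hδz : δ ≤ z) (hδn : 200 * ℓ * S z ≤ n * δ ^ 2) (hs : δ ≤ relSize i s - relSize j s) :
    surv (normalizedStep step i) (fun s => Leads i z s ∧ ¬ relSize j s ≤ z / 2)
      (fun _ => 1) N s ≤ Real.exp (-(2 * ℓ)) := by
  have hz := H.pos
  have hz1 := H.le_one
  have hn := H.cast_pos
  have hSz := H.scale_pos hS
  have hℓ := H.one_le
  obtain ⟨hr0, hrn, hrδ⟩ := H.lead_exponent hS hδ hδz hδn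
  set r := δ * n / (20 * S z)
  set ρ := 1 + z / 4 with hρ
  have hρ1 : 1 ≤ ρ := by linarith
  have hμ : ∀ t ≤ N, r / ρ ^ N * ρ ^ t ≤ r := fun t ht => by
    rw [div_mul_eq_mul_div, div_le_iff₀ (by positivity)]
    exact mul_le_mul_of_nonneg_left (pow_le_pow_right₀ hρ1 ht) hr0
  refine (surv_le_of_supersolution (T := N)
    (F := fun t s => Real.exp (2 * ℓ) *
      Real.exp (-(r / ρ ^ N * ρ ^ t) * (relSize i s - relSize j s) +
        10 * S z / n * (r / ρ ^ N * ρ ^ t) ^ 2)) (fun _ _ => by positivity) ?_ ?_ _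
      le_rfl s).trans ?_
  · rintro s ⟨h, -⟩
    rw [← Real.exp_add]
    refine Real.one_le_exp ?_
    have h1 : r / ρ ^ N * ρ ^ 0 ≤ 1 / 2 := by
      rw [pow_zero, mul_one, div_le_iff₀ (by positivity)]
      linarith [H.le_pow]
    have h2 : relSize i s - relSize j s ≤ 2 := by linarith [h.le, relSize_nonneg j s]
    have h3 : r / ρ ^ N * ρ ^ 0 * (relSize i s - relSize j s) ≤ 1 / 2 * 2 :=
      mul_le_mul h1 h2 (sub_nonneg.2 (h.relSize_le j)) (by norm_num)
    have h4 : 0 ≤ 10 * S z / n * (r / ρ ^ N * ρ ^ 0) ^ 2 := by positivity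
    linarith
  · rintro t ht s ⟨h, hR⟩
    have h1 := H.expect_exp_lead_le hP hS h hj (not_le.1 hR)
      (r := r / ρ ^ N * ρ ^ t) (by positivity) ((hμ t ht.le).trans hrn)
    rw [← hρ, mul_assoc, ← pow_succ] at h1
    rw [← mul_expect]
    exact mul_le_mul_of_nonneg_left h1 (Real.exp_pos _).le
  · rw [← Real.exp_add]
    refine Real.exp_le_exp.2 ?_
    rw [div_mul_cancel₀ r (by positivity)]
    have h1 := mul_le_mul_of_nonneg_left hs hr0
    linarith

open Classical in
lemma surv_other (H : IsPluralityScale n S ℓ z N)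
    (hP : IsPluralityDynamics step noise S d) (hS : IsNoiseScale S) (hj : j ≠ i) (hδ : 0 ≤ δ)
    (hδz : δ ≤ z) (hδn : 200 * ℓ * S z ≤ n * δ ^ 2) (hs : δ ≤ relSize i s - relSize j s) :
    surv (normalizedStep step i) (Leads i z)
      (fun s => if 1 / (n : ℝ) ≤ fraction s.1 j then 1 else 0) (N + N) s ≤
        3 * Real.exp (-(2 * ℓ)) := by
  have hf1 : ∀ s : Config n k × Set.Ici (1 : ℝ),
      (if 1 / (n : ℝ) ≤ fraction s.1 j then (1 : ℝ) else 0) ≤ 1 := fun s => by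
    split_ifs <;> norm_num
  refine (surv_first_hit (R := fun s => relSize j s ≤ z / 2) (ε := 2 * Real.exp (-(2 * ℓ)))
    (by positivity) hf1 ?_ s).trans ?_
  · intro s _ hR m hm hm2
    have h1 := surv_le_restrict (step := normalizedStep step i) (D := Leads i z)
      (fun s => relSize j s ≤ 7 / 10 * z) hf1 m s
    have h2 := H.surv_weak hP (i := i) hm hR
    have h3 := H.exitProb_weak hP hS (i := i) hm2 hR
    simp only [not_le] at h1
    linarith
  · linarith [H.surv_strong hP hS hj hδ hδz hδn hs]

/-- Before the rival becomes weak its lead-based test applies. Afterwards overtaking a leader of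
normalized size at least 9z/10 forces it through the level 7z/10; that is why this size is part of
the exit event. -/
lemma exitProb_overtake (H : IsPluralityScale n S ℓ z N)
    (hP : IsPluralityDynamics step noise S d) (hS : IsNoiseScale S) (hj : j ≠ i) (hδ : 0 ≤ δ)
    (hδz : δ ≤ z) (hδn : 200 * ℓ * S z ≤ n * δ ^ 2) (hs : δ ≤ relSize i s - relSize j s) :
    exitProb (normalizedStep step i) (Leads i z)
      (fun s => fraction s.1 i ≤ fraction s.1 j ∧ 9 / 10 * z ≤ relSize i s) (N + N) s ≤
        2 * Real.exp (-(2 * ℓ)) := by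
  have hz := H.pos
  have h1 := exitProb_first_hit (step := normalizedStep step i) (D := Leads i z)
    (B := fun s => fraction s.1 i ≤ fraction s.1 j ∧ 9 / 10 * z ≤ relSize i s)
    (R := fun s => relSize j s ≤ z / 2) (T := N + N) (Real.exp_pos (-(2 * ℓ))).le ?_ _ le_rfl s
  · have h2 := exitProb_mono (step := normalizedStep step i)
      (D := fun s => Leads i z s ∧ ¬ relSize j s ≤ z / 2)
      (B := fun s => (fraction s.1 i ≤ fraction s.1 j ∧ 9 / 10 * z ≤ relSize i s) ∧ ¬ Leads i z s)
      (B' := fun s => fraction s.1 i ≤ fraction s.1 j) (fun s _ h => h.1.1) (N + N) s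
    linarith [H.exitProb_lead hP hS hj hδ hδz hδn hs]
  · intro s _ hR m hm
    refine (exitProb_le_restrict (fun s => relSize j s ≤ 7 / 10 * z) m s).trans
      (le_trans (exitProb_mono ?_ m s) (H.exitProb_weak hP hS (i := i) hm hR))
    rintro s - (h | ⟨-, h1, h2⟩)
    · exact not_le.1 h
    · have : relSize i s ≤ relSize j s := div_le_div_of_nonneg_right h1 (growth_pos s).le
      linarith

/-- A plurality with a sufficient lead wins with high probability. -/
theorem surv_not_consensusOn_le (H : IsPluralityScale n S ℓ z N)
    (hP : IsPluralityDynamics step noise S d) (hS : IsNoiseScale S) (hk : k ≤ n) (hδ : 0 ≤ δ)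
    (hδn : 200 * ℓ * S z ≤ n * δ ^ 2) {x : Config n k} (hi : fraction x i = z)
    (hx : ∀ j, j ≠ i → fraction x j + δ ≤ z) :
    surv step (fun y => ¬ ConsensusOn y i) (fun _ => 1) (N + N) x ≤ 7 / n := by
  classical
  have hn := H.cast_pos
  set q := Real.exp (-(2 * ℓ)) with hq
  have hqn : q = 1 / n ^ 2 := by rw [hq, Real.exp_neg, ← H.exp_eq, ← Real.exp_nat_mul]; norm_num
  have hq0 : 0 < q := Real.exp_pos _
  let s : Config n k × Set.Ici (1 : ℝ) := (x, ⟨1, Set.self_mem_Ici⟩)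
  have hsj : ∀ j, relSize j s = fraction x j := fun j => by simp [relSize, s]
  have hδz : ∀ j, j ≠ i → δ ≤ z := fun j hj => by linarith [hx j hj, fraction_nonneg x j]
  have hsδ : ∀ j, j ≠ i → δ ≤ relSize i s - relSize j s := fun j hj => by
    rw [hsj, hsj, hi]; linarith [hx j hj]
  let f : Fin k → Config n k × Set.Ici (1 : ℝ) → ℝ := fun j s =>
    if j ≠ i ∧ 1 / (n : ℝ) ≤ fraction s.1 j then 1 else 0
  let B : Fin k → Config n k × Set.Ici (1 : ℝ) → Prop := fun j s =>
    j ≠ i ∧ fraction s.1 i ≤ fraction s.1 j ∧ 9 / 10 * z ≤ relSize i s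
  have hf0 : ∀ j s, 0 ≤ f j s := fun j s => by simp only [f]; split_ifs <;> norm_num
  have h1 := surv_prod (step := step) (D := fun y => ¬ ConsensusOn y i) (f := fun _ => 1)
    -- The growth factor does not depend on the samples of the current round, so an arbitrary choice
    -- may be inserted here.
    (fun s => (normalizedStep step i s (Classical.arbitrary W)).2) (N + N) x s.2
  have h2 := surv_not_le (step := normalizedStep step i) (D := Leads i z)
    (U := fun s => ConsensusOn s.1 i)
    (B := fun s => 11 / 10 * z < relSize i s ∨ (relSize i s < 9 / 10 * z ∨ ∃ j, B j s)) ?_ (N + N) s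
  · have h3 := surv_mono (step := normalizedStep step i) (D := Leads i z) (E := Leads i z)
      (f := fun y => @ite ℝ (ConsensusOn y.1 i) (Classical.propDecidable _) 0 1)
      (g := fun y => ∑ j, f j y) (fun _ h => h) (fun y => sum_nonneg fun j _ => hf0 j y)
      (fun y _ => ?_) (N + N) s
    · rw [surv_sum] at h3
      have h4 : ∀ j, surv (normalizedStep step i) (Leads i z) (f j) (N + N) s ≤ 3 * q := by
        intro j
        rcases eq_or_ne j i with rfl | hj
        · refine (surv_le_of_le le_rfl (fun y => ?_) _ s).trans (by positivity)
          simp [f]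
        · have := H.surv_other hP hS hj hδ (hδz j hj) hδn (hsδ j hj)
          simpa [f, hj] using this
      have h5 : ∀ j, exitProb (normalizedStep step i) (Leads i z) (B j) (N + N) s ≤ 2 * q := by
        intro j
        rcases eq_or_ne j i with rfl | hj
        · refine (exitProb_le_of_supersolution (T := N + N) (F := fun _ _ => 0)
            (fun _ _ => le_rfl) ?_ (by simp) _ le_rfl s).trans (by positivity)
          rintro t - y - ⟨hb, -⟩
          exact absurd rfl hb
        · exact (exitProb_mono (fun y _ hb => hb.2) _ s).trans
            (H.exitProb_overtake hP hS hj hδ (hδz j hj) hδn (hsδ j hj))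
      have h6 := exitProb_or (step := normalizedStep step i) (D := Leads i z)
        (B := fun s => 11 / 10 * z < relSize i s)
        (B' := fun s => relSize i s < 9 / 10 * z ∨ ∃ j, B j s) (N + N) s
      have h7 := exitProb_or (step := normalizedStep step i) (D := Leads i z)
        (B := fun s => relSize i s < 9 / 10 * z) (B' := fun s => ∃ j, B j s) (N + N) s
      have h8 := exitProb_exists (step := normalizedStep step i) (D := Leads i z) (B := B) (N + N) s
      have h9 := H.exitProb_leader_up hP hS (i := i) (s := s) ((hsj i).trans hi)
      have h10 := H.exitProb_leader_down hP hS (i := i) (s := s) ((hsj i).trans hi)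
      have h11 : ∑ j, surv (normalizedStep step i) (Leads i z) (f j) (N + N) s ≤ k * (3 * q) := by
        simpa using sum_le_card_nsmul univ _ _ fun j _ => h4 j
      have h12 : ∑ j, exitProb (normalizedStep step i) (Leads i z) (B j) (N + N) s ≤
          k * (2 * q) := by
        simpa using sum_le_card_nsmul univ _ _ fun j _ => h5 j
      have h13 : (k : ℝ) ≤ n := by exact_mod_cast hk
      have h14 : (1 : ℝ) ≤ n := one_le_cast_of_neZero
      have h15 : (k : ℝ) * (3 * q) + k * (2 * q) + (q + q) ≤ 7 / n := by
        calc (k : ℝ) * (3 * q) + k * (2 * q) + (q + q)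
            ≤ n * (3 * q) + n * (2 * q) + (n * q + n * q) := by
              gcongr <;> exact le_mul_of_one_le_left hq0.le h14
          _ = 7 / n := by rw [hqn]; field_simp; norm_num
      have h16 : surv step (fun y => ¬ ConsensusOn y i) (fun _ => 1) (N + N) x =
          surv (normalizedStep step i) (fun s => ¬ ConsensusOn s.1 i) (fun _ => 1) (N + N) s :=
        h1.symm
      linarith
    · split_ifs with hU
      · exact sum_nonneg fun j _ => hf0 j y
      · obtain ⟨j, hj, hj'⟩ := exists_alive_of_not_consensusOn hU
        refine le_trans ?_ (single_le_sum (f := fun j => f j y) (fun j _ => hf0 j y) (mem_univ j))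
        simp only [f]
        rw [if_pos ⟨hj, hj'⟩]
  · intro y hy _
    by_contra hc
    simp only [not_or, not_lt, not_exists, B, not_and] at hc
    refine hy ⟨hc.2.1, hc.1, fun j hj => ?_⟩
    by_contra hlt
    exact hc.2.2 j hj (not_lt.1 hlt) hc.2.1

end IsPluralityScale

end Plurality

/-! ### Assembly: explicit levels, times and constants. -/

namespace IsPluralityDynamics

variable {n k : ℕ} [NeZero n] {W : Type*} [Fintype W] [Nonempty W]
  {step : Config n k → W → Config n k} {noise : Config n k → Fin k → ℝ} {S : ℝ → ℝ} {d ℓ g : ℝ}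

lemma exists_time_of_few_opinions (h : IsPluralityDynamics step noise S d) (hS : IsNoiseScale S)
    (hk : k ≤ n) (hn : 14 ≤ n) (H : IsLargeScale n S ℓ g) (hg : k * g ≤ 1) (x : Config n k) :
    ∃ T : ℕ, (T : ℝ) ≤ 3 * 10 ^ 14 * ℓ * k + 1 ∧
      surv step (fun y => ¬ Consensus y) (fun _ => 1) T x ≤ 10 / n := by
  have h1 := inv_card_le_collision x
  have hγ := collision_nonneg x
  have hℓ := H.one_le
  have hk0 : (0 : ℝ) < k := by
    by_contra hc
    nlinarith
  have hgc : g ≤ collision x := le_of_mul_le_mul_left (hg.trans h1) hk0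
  refine ⟨⌈3 * 10 ^ 14 * ℓ * k⌉₊, (Nat.ceil_lt_add_one (by positivity)).le,
    h.surv_not_consensus_le hS hk hn (H.mono hS hgc (collision_le_one x)) ?_⟩
  calc 3 * 10 ^ 14 * ℓ = 3 * 10 ^ 14 * ℓ * 1 := (mul_one _).symm
    _ ≤ 3 * 10 ^ 14 * ℓ * (k * collision x) := mul_le_mul_of_nonneg_left h1 (by positivity)
    _ = 3 * 10 ^ 14 * ℓ * k * collision x := by ring
    _ ≤ _ := mul_le_mul_of_nonneg_right (Nat.le_ceil _) hγ

lemma exists_time (h : IsPluralityDynamics step noise S d) (hS : IsNoiseScale S)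
    (hk : k ≤ n) (hn : 40 ≤ n) (H : IsLargeScale n S ℓ g) (hg : g ≤ 1 / 16)
    (hd : 1 / (2 * (n : ℝ) ^ 2) ≤ d) (x : Config n k) :
    ∃ T : ℕ, (T : ℝ) ≤ 3 * ℓ * (264 * g / d + 3 * 10 ^ 14 * ℓ / g + 2) ∧
      surv step (fun y => ¬ Consensus y) (fun _ => 1) T x ≤ 1 / n := by
  have hn0 := H.cast_pos
  have hd0 : 0 < d := lt_of_lt_of_le (by positivity) hd
  have hℓ := H.one_le
  have hg0 := H.pos
  refine ⟨⌈2 * ℓ⌉₊ * (⌈264 * g / d⌉₊ + ⌈3 * 10 ^ 14 * ℓ / g⌉₊), ?_,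
    surv_not_consensus_le_inv H.exp_eq
      (fun x => h.surv_not_consensus_le_half hS hk hn H hg hd ?_ ?_ x) (Nat.le_ceil _) x⟩
  · have h1 : (⌈2 * ℓ⌉₊ : ℝ) ≤ 3 * ℓ := by
      linarith [(Nat.ceil_lt_add_one (by positivity : 0 ≤ 2 * ℓ)).le]
    have h2 := (Nat.ceil_lt_add_one (by positivity : 0 ≤ 264 * g / d)).le
    have h3 := (Nat.ceil_lt_add_one (by positivity : 0 ≤ 3 * 10 ^ 14 * ℓ / g)).le
    push_cast
    exact mul_le_mul h1 (by linarith) (by positivity) (by positivity)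
  · rw [← div_le_iff₀ hd0]; exact Nat.le_ceil _
  · rw [← div_le_iff₀ hg0]; exact Nat.le_ceil _

lemma exists_slow_config (h : IsPluralityDynamics step noise S d) (hk : k ≤ n) (hℓ : 1 ≤ ℓ)
    (hexp : Real.exp ℓ = n) {m : ℕ} (hm : 2 ≤ m) (hmk : m ≤ k)
    (hS : 8 * ℓ < m → m ^ 2 * S (8 * ℓ / m) ≤ 16 * ℓ * n) :
    ∃ (x : Config n k) (T : ℕ), (m : ℝ) / (96 * ℓ ^ 2) ≤ T + 1 ∧
      1 - 1 / n ≤ surv step (fun y => ¬ Consensus y) (fun _ => 1) T x := by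
  have hn : (0 : ℝ) < n := cast_pos_of_neZero
  obtain ⟨x, hx, hxc⟩ := exists_balanced (n := n) hm hmk (hmk.trans hk)
  refine ⟨x, ?_⟩
  rcases lt_or_ge (8 * ℓ) m with h8 | h8
  · refine ⟨⌊(m : ℝ) / (96 * ℓ ^ 2)⌋₊, (Nat.lt_floor_add_one _).le,
      h.le_surv_not_consensus hk hℓ hexp h8 (hmk.trans hk) (hS h8) ?_ hx⟩
    rw [← le_div_iff₀ (by positivity)]
    exact Nat.floor_le (by positivity)
  -- For m ≤ 8ℓ the claimed time is at most 1, and it is enough that the initial configuration is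
  -- not a consensus.
  · refine ⟨0, ?_, ?_⟩
    · rw [Nat.cast_zero, zero_add, div_le_one (by positivity)]
      nlinarith
    · have : 0 ≤ 1 / (n : ℝ) := by positivity
      simp only [surv, hxc, not_false_eq_true, if_true]
      linarith

lemma exists_plurality_time (h : IsPluralityDynamics step noise S d) (hS : IsNoiseScale S)
    (hk : k ≤ n) (hℓ : 1 ≤ ℓ) (hexp : Real.exp ℓ = n) {δ : ℝ} (hδ : 0 ≤ δ)
    {x : Config n k} {i : Fin k} (hi : 0 < fraction x i)
    (hn : 10 ^ 6 * ℓ ^ 2 * S (fraction x i) ≤ n * fraction x i ^ 2)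
    (hδn : 200 * ℓ * S (fraction x i) ≤ n * δ ^ 2)
    (hx : ∀ j, j ≠ i → fraction x j + δ ≤ fraction x i) :
    ∃ T : ℕ, surv step (fun y => ¬ ConsensusOn y i) (fun _ => 1) T x ≤ 7 / n := by
  have hi1 := fraction_le_one x i
  have H : IsPluralityScale n S ℓ (fraction x i) ⌈40 * ℓ / fraction x i⌉₊ :=
    { one_le := hℓ
      exp_eq := hexp
      pos := hi
      le_one := hi1
      threshold := hn
      time_ge := by rw [← div_le_iff₀ hi]; exact Nat.le_ceil _
      time_le := by
        have h1 := (Nat.ceil_lt_add_one (by positivity : 0 ≤ 40 * ℓ / fraction x i)).le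
        calc _ ≤ (40 * ℓ / fraction x i + 1) * fraction x i :=
              mul_le_mul_of_nonneg_right h1 hi.le
          _ = 40 * ℓ + fraction x i := by field_simp
          _ ≤ _ := by linarith }
  exact ⟨_, H.surv_not_consensusOn_le h hS hk hδ hδn rfl hx⟩

end IsPluralityDynamics

lemma one_sub_mul_rpow_le {n : ℕ} {C q : ℝ} (h : q ≤ C) :
    1 - C * (n : ℝ) ^ (-(1 : ℝ)) ≤ 1 - q / n := by
  rw [Real.rpow_neg_one, ← div_eq_mul_inv]
  have : q / n ≤ C / n := by gcongr
  linarith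

lemma one_sub_mul_rpow_nonpos {n : ℕ} [NeZero n] {C : ℝ} (h : n ≤ C) :
    1 - C * (n : ℝ) ^ (-(1 : ℝ)) ≤ 0 := by
  refine (one_sub_mul_rpow_le h).trans ?_
  rw [div_self (cast_pos_of_neZero (n := n)).ne', sub_self]

lemma one_le_log_of_three_le {n : ℕ} (hn : 3 ≤ n) : 1 ≤ Real.log n := by
  have : (3 : ℝ) ≤ n := by exact_mod_cast hn
  rw [Real.le_log_iff_exp_le (by linarith)]
  linarith [Real.exp_one_lt_d9]

lemma exists_forall_mul_log_pow_le (c : ℝ) (m : ℕ) :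
    ∃ N : ℕ, 40 ≤ N ∧ ∀ n ≥ N, c * Real.log n ^ m ≤ n := by
  have h1 := (Real.tendsto_pow_log_div_mul_add_atTop 1 0 m one_ne_zero).comp
    (tendsto_natCast_atTop_atTop (R := ℝ))
  have h2 := (h1.const_mul c).eventually_le_const (u := 1) (by simp)
  obtain ⟨N, hN⟩ := eventually_atTop.1 h2
  refine ⟨max N 40, le_max_right _ _, fun n hn => ?_⟩
  have h3 := hN n ((le_max_left _ _).trans hn)
  have hn0 : (0 : ℝ) < n := by
    have : 40 ≤ n := (le_max_right _ _).trans hn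
    exact_mod_cast (by omega : 0 < n)
  simpa [← mul_div_assoc, div_le_one hn0] using h3

/-- With probability `1 - O(1 / n)` the consensus time of the dynamics is polylogarithmically
close to `Y n k`, from above for all and from below for some initial configurations. -/
lemma exists_consensusTime_bounds {h : ℕ} {a : ℝ} (ha : 0 < a)
    (step : ∀ n k : ℕ, Config n k → (Fin n → Fin h → Fin n) → Config n k) (Y : ℕ → ℕ → ℝ)
    (A : ℝ) (N : ℕ)
    (hu : ∀ (n k : ℕ) [NeZero n], N ≤ n → 2 ≤ k → k ≤ n → ∀ x : Config n k, ∃ T : ℕ,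
      (T : ℝ) ≤ A * Real.log n ^ a * Y n k ∧
        surv (step n k) (fun y => ¬ Consensus y) (fun _ => 1) T x ≤ 10 / n)
    (hl : ∀ (n k : ℕ) [NeZero n], N ≤ n → 2 ≤ k → k ≤ n → ∃ (x : Config n k) (T : ℕ),
      Y n k ≤ A * Real.log n ^ a * (T + 1) ∧
        1 - 1 / n ≤ surv (step n k) (fun y => ¬ Consensus y) (fun _ => 1) T x)
    (hY : ∀ n k, 0 ≤ Y n k) :
    ∃ C a c : ℝ, 0 < C ∧ 0 < a ∧ 0 < c ∧
      ∀ (n k : ℕ) [NeZero n], 2 ≤ k → k ≤ n →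
        (∀ x₀ : Config n k,
          1 - C * (n : ℝ) ^ (-c) ≤ (sampleLaw n h).real
            {ω | consensusTime (process (step n k) x₀ ω) ≤
              ENNReal.ofReal (C * Real.log n ^ a * Y n k)}) ∧
        (∃ x₀ : Config n k,
          1 - C * (n : ℝ) ^ (-c) ≤ (sampleLaw n h).real
            {ω | ENNReal.ofReal (Y n k / (C * Real.log n ^ a)) ≤
              consensusTime (process (step n k) x₀ ω)}) := by
  -- For n < N the bound 1 - C/n is nonpositive, so small n need no argument.
  set C := max (max A N) 10 with hC
  have hC10 : 10 ≤ C := le_max_right _ _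
  have hCA : A ≤ C := (le_max_left _ _).trans (le_max_left _ _)
  have hCN : N ≤ C := (le_max_right _ _).trans (le_max_left _ _)
  refine ⟨C, a, 1, by linarith, ha, one_pos, fun n k _ hk hkn => ?_⟩
  rcases lt_or_ge n N with hn | hn
  · have h0 : 1 - C * (n : ℝ) ^ (-(1 : ℝ)) ≤ 0 :=
      one_sub_mul_rpow_nonpos (le_trans (by exact_mod_cast hn.le) hCN)
    exact ⟨fun _ => h0.trans measureReal_nonneg,
      ⟨fun _ => ⟨0, by omega⟩, h0.trans measureReal_nonneg⟩⟩
  · have hlog : 0 < Real.log n := Real.log_pos (by exact_mod_cast (by omega : 1 < n))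
    have hla : 0 < Real.log n ^ a := Real.rpow_pos_of_pos hlog a
    refine ⟨fun x => ?_, ?_⟩
    · obtain ⟨T, hT, hs⟩ := hu n k hn hk hkn x
      refine (one_sub_mul_rpow_le hC10).trans
        (sampleLaw_consensusTime_le (step n k) x T (hT.trans ?_) hs)
      have := hY n k
      gcongr
    · obtain ⟨x, T, hT, hs⟩ := hl n k hn hk hkn
      refine ⟨x, (one_sub_mul_rpow_le (by linarith : 1 ≤ C)).trans
        (sampleLaw_le_consensusTime (step n k) x T ?_ hs)⟩
      rw [div_le_iff₀ (by positivity), mul_comm]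
      refine hT.trans ?_
      gcongr

theorem exists_consensusTime_threeMajority :
    ∃ C a c : ℝ, 0 < C ∧ 0 < a ∧ 0 < c ∧
      ∀ (n k : ℕ) [NeZero n], 2 ≤ k → k ≤ n →
        (∀ x₀ : Config n k,
          1 - C * (n : ℝ) ^ (-c) ≤ (sampleLaw n 3).real
            {ω | consensusTime (threeMajority x₀ ω) ≤
              ENNReal.ofReal (C * Real.log n ^ a * min (√n) k)}) ∧
        (∃ x₀ : Config n k,
          1 - C * (n : ℝ) ^ (-c) ≤ (sampleLaw n 3).real
            {ω | ENNReal.ofReal (min (√n) k / (C * Real.log n ^ a)) ≤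
              consensusTime (threeMajority x₀ ω)}) := by
  obtain ⟨N, hN40, hN⟩ := exists_forall_mul_log_pow_le ((16 * 10 ^ 10) ^ 2) 4
  refine exists_consensusTime_bounds (a := 5) (by norm_num) (fun n k => threeMajorityStep)
    (fun n k => min (√n) k) (10 ^ 24) N ?_ ?_ (fun n k => by positivity)
  · intro n k _ hn hk hkn x
    have hn0 : (0 : ℝ) < n := cast_pos_of_neZero
    have hℓ := one_le_log_of_three_le (by omega : 3 ≤ n)
    have hsq := Real.sq_sqrt hn0.le
    have hs0 : 0 < √(n : ℝ) := Real.sqrt_pos.2 hn0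
    have hs1 : 1 ≤ √(n : ℝ) := Real.one_le_sqrt.2 one_le_cast_of_neZero
    have hk1 : (2 : ℝ) ≤ k := by exact_mod_cast hk
    have hlogn := hN n hn
    have hexp := Real.exp_log hn0
    set ℓ := Real.log n
    set q := √(n : ℝ)
    have hg : 10 ^ 10 * ℓ ^ 2 / q ≤ 1 / 16 := by
      rw [div_le_iff₀ hs0]
      have : 16 * 10 ^ 10 * ℓ ^ 2 ≤ q := by
        refine abs_le_of_sq_le_sq' (le_trans (le_of_eq ?_) (hlogn.trans hsq.ge)) hs0.le |>.2
        ring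
      linarith
    -- With S = 1 the threshold asks for n g² ≥ 10²⁰ ℓ³; this g gives 10²⁰ ℓ⁴.
    have H : IsLargeScale n (fun _ => 1) ℓ (10 ^ 10 * ℓ ^ 2 / q) :=
      { one_le := hℓ
        exp_eq := hexp
        pos := by positivity
        le_one := hg.trans (by norm_num)
        threshold := by
          rw [← hsq]
          have : q ^ 2 * (10 ^ 10 * ℓ ^ 2 / q) ^ 2 = 10 ^ 20 * ℓ ^ 4 := by field_simp
          rw [this, mul_one]
          gcongr
          norm_num }
    have hP := isPluralityDynamics_threeMajority n k
    have h5 : ℓ ^ (5 : ℝ) = ℓ ^ 5 := by norm_cast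
    have hℓ5 : ℓ ≤ ℓ ^ 5 := le_self_pow₀ hℓ (by norm_num)
    simp only [h5]
    -- If kg ≤ 1 then γ ≥ 1/k ≥ g from the start. Otherwise √n is at most k times a polylogarithm,
    -- and the √n-type bound from `exists_time` is comparable with min(√n, k).
    rcases le_or_gt (k * (10 ^ 10 * ℓ ^ 2 / q)) 1 with hkg | hkg
    · obtain ⟨T, hT, hs⟩ := hP.exists_time_of_few_opinions isNoiseScale_one hkn (by omega) H hkg x
      refine ⟨T, hT.trans ?_, hs⟩
      have hkq : (k : ℝ) ≤ q := by
        rw [← mul_div_assoc, div_le_one hs0] at hkg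
        have : (k : ℝ) * 1 ≤ k * (10 ^ 10 * ℓ ^ 2) := by gcongr; nlinarith
        linarith
      rw [min_eq_right hkq]
      have h6 : ℓ * k ≤ ℓ ^ 5 * k := by gcongr
      have h7 : 1 * 1 ≤ ℓ * k := mul_le_mul hℓ (by linarith) zero_le_one (by linarith)
      nlinarith
    · have hd : 1 / (2 * (n : ℝ) ^ 2) ≤ 1 / (2 * n) := by
        have : (n : ℝ) ≤ n ^ 2 := le_self_pow₀ one_le_cast_of_neZero (by norm_num)
        gcongr
      obtain ⟨T, hT, hs⟩ := hP.exists_time isNoiseScale_one hkn (by omega) H hg hd x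
      refine ⟨T, hT.trans ?_, hs.trans (by gcongr; norm_num)⟩
      have h6 : 264 * (10 ^ 10 * ℓ ^ 2 / q) / (1 / (2 * n)) = 528 * 10 ^ 10 * ℓ ^ 2 * q := by
        rw [← hsq]; field_simp; norm_num
      have h7 : 3 * 10 ^ 14 * ℓ / (10 ^ 10 * ℓ ^ 2 / q) ≤ 3 * 10 ^ 4 * (ℓ ^ 2 * q) := by
        have : 3 * 10 ^ 14 * ℓ / (10 ^ 10 * ℓ ^ 2 / q) = 3 * 10 ^ 4 * (1 / ℓ * q) := by
          field_simp
        rw [this]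
        have : 1 / ℓ ≤ 1 := by rw [div_le_one (by linarith)]; exact hℓ
        gcongr
        nlinarith
      have h8 : 1 ≤ ℓ ^ 2 * q := one_le_mul_of_one_le_of_one_le (one_le_pow₀ hℓ) hs1
      have h9 : q ≤ 10 ^ 10 * ℓ ^ 2 * min q k := by
        rcases min_cases q (k : ℝ) with ⟨h, -⟩ | ⟨h, -⟩ <;> rw [h]
        · exact le_mul_of_one_le_left hs0.le (by nlinarith)
        · rw [← mul_div_assoc, one_lt_div hs0] at hkg
          linarith
      rw [h6]
      calc 3 * ℓ * (528 * 10 ^ 10 * ℓ ^ 2 * q + 3 * 10 ^ 14 * ℓ / (10 ^ 10 * ℓ ^ 2 / q) + 2)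
          ≤ 3 * ℓ * (10 ^ 13 * (ℓ ^ 2 * q)) := by
            gcongr; linarith
        _ = 3 * 10 ^ 13 * ℓ ^ 3 * q := by ring
        _ ≤ 3 * 10 ^ 13 * ℓ ^ 3 * (10 ^ 10 * ℓ ^ 2 * min q k) := by gcongr
        _ = 3 * 10 ^ 23 * (ℓ ^ 5 * min q k) := by ring
        _ ≤ 10 ^ 24 * (ℓ ^ 5 * min q k) := by gcongr; norm_num
        _ = _ := by ring
  · intro n k _ hn hk hkn
    have hn0 : (0 : ℝ) < n := cast_pos_of_neZero
    have hℓ := one_le_log_of_three_le (by omega : 3 ≤ n)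
    have hsq := Real.sq_sqrt hn0.le
    have hexp := Real.exp_log hn0
    set ℓ := Real.log n
    set q := √(n : ℝ)
    have hs0 : 0 < q := Real.sqrt_pos.2 hn0
    have hq2 : 2 ≤ ⌊q⌋₊ := by
      refine Nat.le_floor ?_
      refine Real.le_sqrt_of_sq_le ?_
      exact_mod_cast (by omega : 2 ^ 2 ≤ n)
    have hmq : ((min k ⌊q⌋₊ : ℕ) : ℝ) ≤ q :=
      le_trans (by exact_mod_cast min_le_right _ _) (Nat.floor_le hs0.le)
    -- Constant noise requires m² ≤ 16ℓn, hence the cap at √n on the number of opinions used.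
    obtain ⟨x, T, hT, hs⟩ := (isPluralityDynamics_threeMajority n k).exists_slow_config hkn hℓ hexp
      (m := min k ⌊q⌋₊) (le_min hk hq2) (min_le_left _ _) (fun _ => by
        have : ((min k ⌊q⌋₊ : ℕ) : ℝ) ^ 2 ≤ q ^ 2 := by gcongr
        nlinarith)
    refine ⟨x, T, ?_, hs⟩
    have h5 : ℓ ^ (5 : ℝ) = ℓ ^ 5 := by norm_cast
    have h6 : min q k ≤ 2 * ((min k ⌊q⌋₊ : ℕ) : ℝ) := by
      rcases min_cases k ⌊q⌋₊ with ⟨h, -⟩ | ⟨h, -⟩ <;> rw [h]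
      · have : min q (k : ℝ) ≤ k := min_le_right _ _
        have : (0 : ℝ) ≤ k := Nat.cast_nonneg _
        linarith
      · have h7 : min q (k : ℝ) ≤ q := min_le_left _ _
        have h8 := Nat.lt_floor_add_one q
        have h9 : (2 : ℝ) ≤ ⌊q⌋₊ := by exact_mod_cast hq2
        linarith
    rw [div_le_iff₀ (by positivity)] at hT
    simp only [h5]
    have h7 : ℓ ^ 2 ≤ ℓ ^ 5 := pow_le_pow_right₀ hℓ (by norm_num)
    calc min q k ≤ 2 * ((T + 1) * (96 * ℓ ^ 2)) := by linarith
      _ = 192 * ℓ ^ 2 * (T + 1) := by ring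
      _ ≤ 10 ^ 24 * ℓ ^ 5 * (T + 1) := by gcongr; norm_num

theorem exists_consensusTime_twoChoices :
    ∃ C a c : ℝ, 0 < C ∧ 0 < a ∧ 0 < c ∧
      ∀ (n k : ℕ) [NeZero n], 2 ≤ k → k ≤ n →
        (∀ x₀ : Config n k,
          1 - C * (n : ℝ) ^ (-c) ≤ (sampleLaw n 2).real
            {ω | consensusTime (twoChoices x₀ ω) ≤
              ENNReal.ofReal (C * Real.log n ^ a * k)}) ∧
        (∃ x₀ : Config n k,
          1 - C * (n : ℝ) ^ (-c) ≤ (sampleLaw n 2).real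
            {ω | ENNReal.ofReal (k / (C * Real.log n ^ a)) ≤
              consensusTime (twoChoices x₀ ω)}) := by
  obtain ⟨N, hN40, hN⟩ := exists_forall_mul_log_pow_le (16 * (2 * 10 ^ 20)) 3
  refine exists_consensusTime_bounds (a := 7) (by norm_num) (fun n k => twoChoicesStep)
    (fun n k => k) (10 ^ 45) N ?_ ?_ (fun n k => by positivity)
  · intro n k _ hn hk hkn x
    have hn0 : (0 : ℝ) < n := cast_pos_of_neZero
    have hn1 : (1 : ℝ) ≤ n := one_le_cast_of_neZero
    have hℓ := one_le_log_of_three_le (by omega : 3 ≤ n)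
    have hk1 : (2 : ℝ) ≤ k := by exact_mod_cast hk
    have hlogn := hN n hn
    have hexp := Real.exp_log hn0
    set ℓ := Real.log n
    have hg : 2 * 10 ^ 20 * ℓ ^ 3 / n ≤ 1 / 16 := by
      rw [div_le_iff₀ hn0]; linarith
    -- With S(z) = 2z the threshold is linear in g, and this g attains equality.
    have H : IsLargeScale n (fun z => 2 * z) ℓ (2 * 10 ^ 20 * ℓ ^ 3 / n) :=
      { one_le := hℓ
        exp_eq := hexp
        pos := by positivity
        le_one := hg.trans (by norm_num)
        threshold := le_of_eq (by field_simp) }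
    have hP := isPluralityDynamics_twoChoices n k
    have h7 : ℓ ^ (7 : ℝ) = ℓ ^ 7 := by norm_cast
    have hℓ7 : ℓ ≤ ℓ ^ 7 := le_self_pow₀ hℓ (by norm_num)
    simp only [h7]
    rcases le_or_gt (k * (2 * 10 ^ 20 * ℓ ^ 3 / n)) 1 with hkg | hkg
    · obtain ⟨T, hT, hs⟩ :=
        hP.exists_time_of_few_opinions isNoiseScale_two_mul hkn (by omega) H hkg x
      refine ⟨T, hT.trans ?_, hs⟩
      have h6 : ℓ * k ≤ ℓ ^ 7 * k := by gcongr
      have h7 : 1 * 1 ≤ ℓ * k := mul_le_mul hℓ (by linarith) zero_le_one (by linarith)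
      nlinarith
    · have hd : 1 / (2 * (n : ℝ) ^ 2) ≤ 1 / n ^ 2 := by
        gcongr
        linarith [sq_nonneg (n : ℝ)]
      obtain ⟨T, hT, hs⟩ := hP.exists_time isNoiseScale_two_mul hkn (by omega) H hg hd x
      refine ⟨T, hT.trans ?_, hs.trans (by gcongr; norm_num)⟩
      have h6 : 264 * (2 * 10 ^ 20 * ℓ ^ 3 / n) / (1 / n ^ 2) = 528 * 10 ^ 20 * (ℓ ^ 3 * n) := by
        field_simp; norm_num
      have h8 : 1 ≤ ℓ ^ 3 := one_le_pow₀ hℓ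
      have h9 : (n : ℝ) ≤ ℓ ^ 3 * n := le_mul_of_one_le_left hn0.le h8
      have h10 : 3 * 10 ^ 14 * ℓ / (2 * 10 ^ 20 * ℓ ^ 3 / n) ≤ ℓ ^ 3 * n := by
        refine le_trans ?_ h9
        rw [div_div_eq_mul_div, div_le_iff₀ (by positivity)]
        have : ℓ ≤ ℓ ^ 3 := le_self_pow₀ hℓ (by norm_num)
        nlinarith
      have h11 : (n : ℝ) ≤ 2 * 10 ^ 20 * ℓ ^ 3 * k := by
        rw [← mul_div_assoc, one_lt_div hn0] at hkg
        linarith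
      rw [h6]
      calc 3 * ℓ * (528 * 10 ^ 20 * (ℓ ^ 3 * n) +
            3 * 10 ^ 14 * ℓ / (2 * 10 ^ 20 * ℓ ^ 3 / n) + 2)
          ≤ 3 * ℓ * (10 ^ 23 * (ℓ ^ 3 * n)) := by
            gcongr; linarith
        _ = 3 * 10 ^ 23 * ℓ ^ 4 * n := by ring
        _ ≤ 3 * 10 ^ 23 * ℓ ^ 4 * (2 * 10 ^ 20 * ℓ ^ 3 * k) := by gcongr
        _ = 6 * 10 ^ 43 * (ℓ ^ 7 * k) := by ring
        _ ≤ 10 ^ 45 * (ℓ ^ 7 * k) := by gcongr; norm_num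
        _ = _ := by ring
  · intro n k _ hn hk hkn
    have hn0 : (0 : ℝ) < n := cast_pos_of_neZero
    have hℓ := one_le_log_of_three_le (by omega : 3 ≤ n)
    have hexp := Real.exp_log hn0
    set ℓ := Real.log n
    have hk0 : (0 : ℝ) < k := by exact_mod_cast (by omega : 0 < k)
    have hkn' : (k : ℝ) ≤ n := by exact_mod_cast hkn
    obtain ⟨x, T, hT, hs⟩ := (isPluralityDynamics_twoChoices n k).exists_slow_config hkn hℓ hexp
      -- Noise proportional to the size permits every m ≤ n, so no cap at √n appears.
      (m := k) hk le_rfl (fun _ => by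
        have : (k : ℝ) ^ 2 * (2 * (8 * ℓ / k)) = 16 * ℓ * k := by field_simp; norm_num
        rw [this]
        gcongr)
    refine ⟨x, T, ?_, hs⟩
    have h7 : ℓ ^ (7 : ℝ) = ℓ ^ 7 := by norm_cast
    rw [div_le_iff₀ (by positivity)] at hT
    simp only [h7]
    have h8 : ℓ ^ 2 ≤ ℓ ^ 7 := pow_le_pow_right₀ hℓ (by norm_num)
    calc (k : ℝ) ≤ (T + 1) * (96 * ℓ ^ 2) := hT
      _ = 96 * ℓ ^ 2 * (T + 1) := by ring
      _ ≤ 10 ^ 45 * ℓ ^ 7 * (T + 1) := by gcongr; norm_num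

lemma one_le_mul_fraction_of_max {n k : ℕ} [NeZero n] {x : Config n k} {i : Fin k}
    (h : ∀ j, j ≠ i → fraction x j ≤ fraction x i) : 1 ≤ k * fraction x i := by
  have h1 : ∑ j, fraction x j ≤ ∑ _j : Fin k, fraction x i := by
    refine sum_le_sum fun j _ => ?_
    rcases eq_or_ne j i with rfl | hj
    exacts [le_rfl, h j hj]
  rw [sum_fraction] at h1
  simpa using h1

lemma fraction_add_le_of_support {n k : ℕ} [NeZero n] {x : Config n k} {i j : Fin k} {a : ℝ}
    (h : (support x j : ℝ) + a ≤ support x i) : fraction x j + a / n ≤ fraction x i := by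
  unfold fraction
  rw [← add_div]
  exact div_le_div_of_nonneg_right h (Nat.cast_nonneg n)

/-- A uniform bound for all large `n` on the probability of consensus on the plurality opinion
gives a bound for all `n`. -/
lemma le_sampleLaw_consensusOn {h n k : ℕ} [NeZero n] {N : ℕ} {C : ℝ} (hC : 7 ≤ C) (hCN : N ≤ C)
    {step : Config n k → (Fin n → Fin h → Fin n) → Config n k} {x : Config n k} {i : Fin k}
    (hT : N ≤ n → ∃ T : ℕ, surv step (fun y => ¬ ConsensusOn y i) (fun _ => 1) T x ≤ 7 / n) :
    1 - C * (n : ℝ) ^ (-(1 : ℝ)) ≤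
      (sampleLaw n h).real {ω | ∃ t, ConsensusOn (process step x ω t) i} := by
  rcases lt_or_ge n N with hn | hn
  · exact (one_sub_mul_rpow_nonpos (le_trans (by exact_mod_cast hn.le) hCN)).trans
      measureReal_nonneg
  · obtain ⟨T, hT⟩ := hT hn
    have : IsProbabilityMeasure (sampleLaw n h) := by unfold sampleLaw; infer_instance
    have h1 := sampleLaw_real_hit step (fun y => ConsensusOn y i) x T
    refine (one_sub_mul_rpow_le hC).trans (le_trans (by linarith) (h1.symm.le.trans
      (measureReal_mono ?_)))
    rintro ω ⟨t, -, ht⟩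
    exact ⟨t, ht⟩

lemma exists_forall_small_large {ε g : ℕ → ℝ} (hε : Tendsto ε atTop (𝓝 0))
    (hg : Tendsto g atTop atTop) {a : ℝ} (ha : 0 < a) (b : ℝ) :
    ∃ N : ℕ, 3 ≤ N ∧ ∀ n ≥ N, ε n ≤ a ∧ b ≤ g n := by
  obtain ⟨N, hN⟩ := eventually_atTop.1
    ((hε.eventually_le_const ha).and (hg.eventually_ge_atTop b))
  exact ⟨max N 3, le_max_right _ _, fun n hn => hN n ((le_max_left _ _).trans hn)⟩

theorem exists_plurality_threeMajority :
    ∃ c : ℝ, 0 < c ∧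
      ∀ ε g : ℕ → ℝ, Tendsto ε atTop (𝓝 0) → Tendsto g atTop atTop →
      ∃ C : ℝ, 0 < C ∧
      ∀ (n k : ℕ) [NeZero n], 2 ≤ n → 1 ≤ k → k ≤ n → (k : ℝ) ≤ ε n * (√n / Real.log n) →
      ∀ (x₀ : Config n k) (i : Fin k),
        (∀ j, j ≠ i →
          (support x₀ j : ℝ) + g n * √(n * Real.log n) ≤ (support x₀ i : ℝ)) →
        1 - C * (n : ℝ) ^ (-c) ≤ (sampleLaw n 3).real
          {ω | ∃ t, ConsensusOn (threeMajority x₀ ω t) i} := by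
  refine ⟨1, one_pos, fun ε g hε hg => ?_⟩
  -- The leader has α_i ≥ 1/k, so k ≤ 10⁻³ √n/ℓ yields the threshold 10⁶ ℓ² ≤ n α_i²; 15² ≥ 200
  -- covers the condition on the lead.
  obtain ⟨N, hN3, hN⟩ := exists_forall_small_large hε hg (a := 1 / 10 ^ 3) (by norm_num) 15
  refine ⟨max N 7, lt_of_lt_of_le (by norm_num) (le_max_right _ _),
    fun n k _ _ hk hkn hkε x i hx => ?_⟩
  refine le_sampleLaw_consensusOn (N := N) (le_max_right _ _) (le_max_left _ _) fun hn => ?_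
  obtain ⟨hεn, hgn⟩ := hN n hn
  have hn0 : (0 : ℝ) < n := cast_pos_of_neZero
  have hℓ := one_le_log_of_three_le (by omega : 3 ≤ n)
  have hexp := Real.exp_log hn0
  have hsq := Real.sq_sqrt hn0.le
  have hs0 : 0 < √(n : ℝ) := Real.sqrt_pos.2 hn0
  set ℓ := Real.log n
  have hδ : 0 ≤ g n * √(n * ℓ) / n := by positivity
  have hx' : ∀ j, j ≠ i → fraction x j + g n * √(n * ℓ) / n ≤ fraction x i :=
    fun j hj => fraction_add_le_of_support (hx j hj)
  have hkz := one_le_mul_fraction_of_max fun j hj => by linarith [hx' j hj]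
  have hz := fraction_nonneg x i
  have hk0 : (0 : ℝ) < k := by exact_mod_cast hk
  have hz0 : 0 < fraction x i := by
    by_contra hc
    nlinarith
  refine (isPluralityDynamics_threeMajority n k).exists_plurality_time isNoiseScale_one hkn hℓ hexp
    hδ hz0 ?_ ?_ hx'
  · have h1 : (k : ℝ) * (10 ^ 3 * ℓ) ≤ √n := by
      have h2 : (k : ℝ) ≤ 1 / 10 ^ 3 * (√n / ℓ) := hkε.trans (by gcongr)
      rw [← le_div_iff₀ (by positivity)]
      refine h2.trans (le_of_eq ?_)
      field_simp
    have h2 : 10 ^ 3 * ℓ ≤ √n * fraction x i := by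
      calc 10 ^ 3 * ℓ = 10 ^ 3 * ℓ * 1 := (mul_one _).symm
        _ ≤ 10 ^ 3 * ℓ * (k * fraction x i) := by gcongr
        _ = k * (10 ^ 3 * ℓ) * fraction x i := by ring
        _ ≤ _ := by gcongr
    calc 10 ^ 6 * ℓ ^ 2 * 1 = (10 ^ 3 * ℓ) ^ 2 := by ring
      _ ≤ (√n * fraction x i) ^ 2 := by gcongr
      _ = _ := by rw [mul_pow, hsq]
  · have h1 : n * (g n * √(n * ℓ) / n) ^ 2 = g n ^ 2 * ℓ := by
      rw [div_pow, mul_pow, Real.sq_sqrt (by positivity)]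
      field_simp
    rw [h1]
    have h2 : (200 : ℝ) ≤ g n ^ 2 := by nlinarith
    nlinarith

theorem exists_plurality_twoChoices :
    ∃ c : ℝ, 0 < c ∧
      ∀ ε g : ℕ → ℝ, Tendsto ε atTop (𝓝 0) → Tendsto g atTop atTop →
      ∃ C : ℝ, 0 < C ∧
      ∀ (n k : ℕ) [NeZero n], 2 ≤ n → 1 ≤ k → k ≤ n → (k : ℝ) ≤ ε n * (n / Real.log n ^ 2) →
      ∀ (x₀ : Config n k) (i : Fin k),
        (∀ j, j ≠ i →
          (support x₀ j : ℝ) + g n * √(fraction x₀ i * n * Real.log n) ≤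
            (support x₀ i : ℝ)) →
        1 - C * (n : ℝ) ^ (-c) ≤ (sampleLaw n 2).real
          {ω | ∃ t, ConsensusOn (twoChoices x₀ ω t) i} := by
  refine ⟨1, one_pos, fun ε g hε hg => ?_⟩
  -- Now S(α_i) = 2α_i: one factor α_i cancels from the threshold, and the lead condition needs 20²
  -- = 400.
  obtain ⟨N, hN3, hN⟩ := exists_forall_small_large hε hg (a := 1 / (2 * 10 ^ 6)) (by norm_num) 20
  refine ⟨max N 7, lt_of_lt_of_le (by norm_num) (le_max_right _ _),
    fun n k _ _ hk hkn hkε x i hx => ?_⟩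
  refine le_sampleLaw_consensusOn (N := N) (le_max_right _ _) (le_max_left _ _) fun hn => ?_
  obtain ⟨hεn, hgn⟩ := hN n hn
  have hn0 : (0 : ℝ) < n := cast_pos_of_neZero
  have hℓ := one_le_log_of_three_le (by omega : 3 ≤ n)
  have hexp := Real.exp_log hn0
  set ℓ := Real.log n
  have hz := fraction_nonneg x i
  have hδ : 0 ≤ g n * √(fraction x i * n * ℓ) / n := by positivity
  have hx' : ∀ j, j ≠ i → fraction x j + g n * √(fraction x i * n * ℓ) / n ≤ fraction x i :=
    fun j hj => fraction_add_le_of_support (hx j hj)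
  have hkz := one_le_mul_fraction_of_max fun j hj => by linarith [hx' j hj]
  have hk0 : (0 : ℝ) < k := by exact_mod_cast hk
  have hz0 : 0 < fraction x i := by
    by_contra hc
    nlinarith
  refine (isPluralityDynamics_twoChoices n k).exists_plurality_time isNoiseScale_two_mul hkn hℓ
    hexp hδ hz0 ?_ ?_ hx'
  · have h1 : (k : ℝ) * (2 * 10 ^ 6 * ℓ ^ 2) ≤ n := by
      have h2 : (k : ℝ) ≤ 1 / (2 * 10 ^ 6) * (n / ℓ ^ 2) := hkε.trans (by gcongr)
      rw [← le_div_iff₀ (by positivity)]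
      refine h2.trans (le_of_eq ?_)
      field_simp
    have h2 : 2 * 10 ^ 6 * ℓ ^ 2 ≤ n * fraction x i := by
      calc 2 * 10 ^ 6 * ℓ ^ 2 = 2 * 10 ^ 6 * ℓ ^ 2 * 1 := (mul_one _).symm
        _ ≤ 2 * 10 ^ 6 * ℓ ^ 2 * (k * fraction x i) := by gcongr
        _ = k * (2 * 10 ^ 6 * ℓ ^ 2) * fraction x i := by ring
        _ ≤ _ := by gcongr
    calc 10 ^ 6 * ℓ ^ 2 * (2 * fraction x i) = 2 * 10 ^ 6 * ℓ ^ 2 * fraction x i := by ring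
      _ ≤ n * fraction x i * fraction x i := by gcongr
      _ = _ := by ring
  · have h1 : n * (g n * √(fraction x i * n * ℓ) / n) ^ 2 = g n ^ 2 * (fraction x i * ℓ) := by
      rw [div_pow, mul_pow, Real.sq_sqrt (by positivity)]
      field_simp
    rw [h1]
    have h2 : (400 : ℝ) ≤ g n ^ 2 := by nlinarith
    calc 200 * ℓ * (2 * fraction x i) = 400 * (fraction x i * ℓ) := by ring
      _ ≤ _ := by gcongr

end ConsensusDynamics

theorem theorem1 :
    -- 3-Majority: consensus time
    (∃ C a c : ℝ, 0 < C ∧ 0 < a ∧ 0 < c ∧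
      ∀ (n k : ℕ) [NeZero n], 2 ≤ k → k ≤ n →
        (∀ x₀ : Config n k,
          1 - C * (n : ℝ) ^ (-c) ≤ (sampleLaw n 3).real
            {ω | consensusTime (threeMajority x₀ ω) ≤
              ENNReal.ofReal (C * Real.log n ^ a * min (√n) k)}) ∧
        (∃ x₀ : Config n k,
          1 - C * (n : ℝ) ^ (-c) ≤ (sampleLaw n 3).real
            {ω | ENNReal.ofReal (min (√n) k / (C * Real.log n ^ a)) ≤
              consensusTime (threeMajority x₀ ω)})) ∧
    -- 3-Majority: plurality
    (∃ c : ℝ, 0 < c ∧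
      ∀ ε g : ℕ → ℝ, Tendsto ε atTop (𝓝 0) → Tendsto g atTop atTop →
      ∃ C : ℝ, 0 < C ∧
      ∀ (n k : ℕ) [NeZero n], 2 ≤ n → 1 ≤ k → k ≤ n → (k : ℝ) ≤ ε n * (√n / Real.log n) →
      ∀ (x₀ : Config n k) (i : Fin k),
        (∀ j, j ≠ i →
          (support x₀ j : ℝ) + g n * √(n * Real.log n) ≤ (support x₀ i : ℝ)) →
        1 - C * (n : ℝ) ^ (-c) ≤ (sampleLaw n 3).real
          {ω | ∃ t, ConsensusOn (threeMajority x₀ ω t) i}) ∧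
    -- 2-Choices: consensus time
    (∃ C a c : ℝ, 0 < C ∧ 0 < a ∧ 0 < c ∧
      ∀ (n k : ℕ) [NeZero n], 2 ≤ k → k ≤ n →
        (∀ x₀ : Config n k,
          1 - C * (n : ℝ) ^ (-c) ≤ (sampleLaw n 2).real
            {ω | consensusTime (twoChoices x₀ ω) ≤
              ENNReal.ofReal (C * Real.log n ^ a * k)}) ∧
        (∃ x₀ : Config n k,
          1 - C * (n : ℝ) ^ (-c) ≤ (sampleLaw n 2).real
            {ω | ENNReal.ofReal (k / (C * Real.log n ^ a)) ≤
              consensusTime (twoChoices x₀ ω)})) ∧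
    -- 2-Choices: plurality
    (∃ c : ℝ, 0 < c ∧
      ∀ ε g : ℕ → ℝ, Tendsto ε atTop (𝓝 0) → Tendsto g atTop atTop →
      ∃ C : ℝ, 0 < C ∧
      ∀ (n k : ℕ) [NeZero n], 2 ≤ n → 1 ≤ k → k ≤ n → (k : ℝ) ≤ ε n * (n / Real.log n ^ 2) →
      ∀ (x₀ : Config n k) (i : Fin k),
        (∀ j, j ≠ i →
          (support x₀ j : ℝ) + g n * √(fraction x₀ i * n * Real.log n) ≤
            (support x₀ i : ℝ)) →
        1 - C * (n : ℝ) ^ (-c) ≤ (sampleLaw n 2).real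
          {ω | ∃ t, ConsensusOn (twoChoices x₀ ω t) i}) :=
  ⟨exists_consensusTime_threeMajority, exists_plurality_threeMajority,
    exists_consensusTime_twoChoices, exists_plurality_twoChoices⟩
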